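/- Let $R$ be a ring with $\mathbb Z\subseteq R\subseteq\mathbb C$ and let $F\subseteq\mathbb C$ be its quotient field. For a group $G$ let $\mathcal N(G)$ be its group von Neumann algebra, i.e. the algebra of bounded operators on $L^2(G)$ commuting with the left $G$-action, and let $\mathcal U(G)$ be the algebra of operators affiliated to $\mathcal N(G)$, i.e. the Ore localization of $\mathcal N(G)$ at its non-zero-divisors; the group ring $\mathbb C G$ embeds into $\mathcal N(G)\subseteq\mathcal U(G)$ by the right regular representation. Let $\mathcal D(G;F)$ be the division closure of $FG$ in $\mathcal U(G)$ (the smallest subring of $\mathcal U(G)$ which contains $FG$ and in which every element that is invertible in $\mathcal U(G)$ is invertible), and let $\mathcal R(G;F)$ be the rational closure of $FG$ in $\mathcal U(G)$ (the smallest subring which contains $FG$ and over which every square matrix that is invertible over $\mathcal U(G)$ is invertible). A torsionfree group $G$ has property (ULA) with respect to $F$ if $\mathcal D(G;F)$ is a skew field and the canonical ring homomorphism $FG_\Sigma\to\mathcal R(G;F)$ is bijective, where $FG_\Sigma$ is the universal localization of $FG$ at the set $\Sigma$ of all square matrices over $FG$ which become invertible over $\mathcal R(G;F)$. Let $\omega\colon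 RG\to\mathcal D(G;F)$ be the inclusion. Let $K_1^w(RG)$ be the abelian group generated by the classes $[f]$ of endomorphisms $f\colon P\to P$ of finitely generated projective $RG$-modules for which $\omega_*f=\operatorname{id}\otimes_{RG}f$ is an isomorphism of $\mathcal D(G;F)$-modules, with the relations $[g\circ f]=[g]+[f]$ for such endomorphisms $f,g$ of the same module $P$, and $[f_1]=[f_0]+[f_2]$ for every endomorphism $(f_0,f_1,f_2)$ of a short exact sequence $0\to P_0\to P_1\to P_2\to 0$ of finitely generated projective $RG$-modules with all $\omega_*f_i$ bijective. Define $\widetilde K_1^w(RG)$ and $\operatorname{Wh}^w(G;R)$ as the cokernels of the canonical maps $\{\pm1\}\to K_1(\mathbb Z)\to K_1(\mathbb Z G)\to K_1^w(RG)$ and $\{\pm g\mid g\in G\}\to K_1(\mathbb Z G)\to K_1^w(RG)$, and $\widetilde K_1(\mathcal D(G;F))$ and $\operatorname{Wh}(\mathcal D(G;F))$ in the same way with $K_1(\mathcal D(G;F))$ in place of $K_1^w(RG)$. **Theorem.** Let $G$ be a torsionfree group with property (ULA) with respect to $F$. Then the canonical maps sending $[f]$ to $[\omega_*f]$ $$\omega_*\colon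 K_1^w(RG)\to K_1(\mathcal D(G;F)),\qquad \omega_*\colon\widetilde K_1^w(RG)\to\widetilde K_1(\mathcal D(G;F)),\qquad \omega_*\colon\operatorname{Wh}^w(G;R)\to\operatorname{Wh}(\mathcal D(G;F))$$ are well defined and bijective. Moreover, $D=\mathcal D(G;F)$ is a skew field and the Dieudonné determinant of invertible matrices over $D$ induces an isomorphism $$\det\nolimits_D\colon K_1(D)\xrightarrow{\ \cong\ }D^\times/[D^\times,D^\times].$$ -/

import Mathlib

universe u

namespace L2

section Ore

open ContinuousLinearMap Filter Topology

variable {H : Type*} [NormedAddCommGroup H] [InnerProductSpace ℂ H] {S : Set (H →L[ℂ] H)}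

theorem mem_cent {T : H →L[ℂ] H} :
    T ∈ Subalgebra.centralizer ℂ S ↔ ∀ g ∈ S, g * T = T * g := Subalgebra.mem_centralizer_iff ℂ

theorem clm_mul (T T' : H →L[ℂ] H) (v : H) : (T * T') v = T (T' v) := rfl

theorem inner_self_ofReal (v : H) : inner ℂ v v = ((‖v‖ ^ 2 : ℝ) : ℂ) := by
  rw [inner_self_eq_norm_sq_to_K]; norm_cast

variable [CompleteSpace H]

theorem star_mem_cent (hS : ∀ g ∈ S, star g ∈ S) {T : H →L[ℂ] H}
    (hT : T ∈ Subalgebra.centralizer ℂ S) : star T ∈ Subalgebra.centralizer ℂ S := by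
  rw [mem_cent] at *
  intro g hg
  have h := congrArg star (hT _ (hS g hg))
  simpa using h.symm

/-- The orthogonal projection onto the kernel of an element of the commutant is in the commutant. -/
theorem kerProj_mem_cent (hS : ∀ g ∈ S, star g ∈ S) {T : H →L[ℂ] H}
    (hT : T ∈ Subalgebra.centralizer ℂ S) :
    (LinearMap.ker T.toLinearMap).starProjection ∈ Subalgebra.centralizer ℂ S := by
  have key : ∀ g ∈ S, ∀ x : H, T x = 0 → T (g x) = 0 := by
    intro g hg x hx
    have h := congrArg (fun f : H →L[ℂ] H => f x) (mem_cent.1 hT g hg)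
    simp only [clm_mul, hx, map_zero] at h
    exact h.symm
  rw [mem_cent]
  intro g hg
  ext x
  simp only [clm_mul]
  refine Eq.symm (Submodule.eq_starProjection_of_mem_orthogonal
    (K := LinearMap.ker T.toLinearMap) ?_ ?_)
  · have := (LinearMap.ker T.toLinearMap).starProjection_apply_mem x
    exact key g hg _ this
  · rw [← map_sub, Submodule.mem_orthogonal]
    intro k hk
    rw [← ContinuousLinearMap.adjoint_inner_left, ← ContinuousLinearMap.star_eq_adjoint]
    have h1 := Submodule.sub_starProjection_mem_orthogonal (K := LinearMap.ker T.toLinearMap) x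
    rw [Submodule.mem_orthogonal] at h1
    exact h1 _ (key _ (hS g hg) k hk)

/-- A left non zero divisor of the commutant is an injective operator. -/
theorem injective_of_nzd (hS : ∀ g ∈ S, star g ∈ S) {T : H →L[ℂ] H}
    (hT : T ∈ Subalgebra.centralizer ℂ S)
    (h : ∀ b ∈ Subalgebra.centralizer ℂ S, T * b = 0 → b = 0) (x : H) (hx : T x = 0) :
    x = 0 := by
  have h0 := h _ (kerProj_mem_cent hS hT) (by
    ext y
    exact (LinearMap.ker T.toLinearMap).starProjection_apply_mem y)
  have h1 : (LinearMap.ker T.toLinearMap).starProjection x = x :=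
    Submodule.starProjection_eq_self_iff.2 hx
  rw [← h1, h0]; rfl

theorem denseRange_of_adjoint {T : H →L[ℂ] H} (h : ∀ x, star T x = 0 → x = 0) :
    DenseRange T := by
  have h1 : (LinearMap.range T.toLinearMap)ᗮ = ⊥ := by
    rw [Submodule.eq_bot_iff]
    intro x hx
    apply h
    rw [Submodule.mem_orthogonal'] at hx
    apply ext_inner_right ℂ
    intro y
    rw [ContinuousLinearMap.star_eq_adjoint, ContinuousLinearMap.adjoint_inner_left, inner_zero_left]
    exact hx _ ⟨y, rfl⟩
  have h2 := Submodule.topologicalClosure_eq_top_iff.2 h1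
  intro y
  have : y ∈ (LinearMap.range T.toLinearMap).topologicalClosure := by rw [h2]; trivial
  exact this

/-- If `y` is a contraction whose adjoint is injective, then the powers of `(1 - y y*)²` tend to
zero in mean. -/
theorem average_tendsto {y : H →L[ℂ] H} (hy : ‖y‖ ≤ 1) (hinj : ∀ x, star y x = 0 → x = 0)
    (δ : H) :
    Tendsto (fun n : ℕ => (n : ℝ)⁻¹ * ∑ k ∈ Finset.range n,
      ‖((1 - y * star y) ^ k) δ‖ ^ 2) atTop (𝓝 0) := by
  set B : H →L[ℂ] H := 1 - y * star y with hB
  have hsa : IsSelfAdjoint B := by simp [hB, IsSelfAdjoint]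
  have hyy : ∀ v, inner ℂ v ((y * star y) v) = ((‖star y v‖ ^ 2 : ℝ) : ℂ) := by
    intro v
    rw [clm_mul, ← ContinuousLinearMap.adjoint_inner_left,
      ← ContinuousLinearMap.star_eq_adjoint, inner_self_ofReal]
  have hsy : ∀ v, ‖star y v‖ ≤ ‖v‖ := by
    intro v
    calc ‖star y v‖ ≤ ‖star y‖ * ‖v‖ := (star y).le_opNorm v
      _ ≤ 1 * ‖v‖ := by gcongr; rwa [norm_star]
      _ = _ := one_mul _
  have hy' : ∀ v, ‖y v‖ ≤ ‖v‖ := by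
    intro v
    calc ‖y v‖ ≤ ‖y‖ * ‖v‖ := y.le_opNorm v
      _ ≤ 1 * ‖v‖ := by gcongr
      _ = _ := one_mul _
  have hBv : ∀ v, B v = v - (y * star y) v := fun v => rfl
  have hBn : ∀ v, ‖B v‖ ≤ ‖v‖ := by
    intro v
    have h1 : ‖B v‖ ^ 2 ≤ ‖v‖ ^ 2 := by
      rw [hBv, @norm_sub_sq ℂ, hyy]
      have : ‖(y * star y) v‖ ≤ ‖star y v‖ := hy' _
      have h3 : ‖(y * star y) v‖ ^ 2 ≤ ‖star y v‖ ^ 2 := by gcongr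
      have : RCLike.re (((‖star y v‖ ^ 2 : ℝ) : ℂ)) = ‖star y v‖ ^ 2 := by
        simp only [RCLike.re_eq_complex_re, Complex.ofReal_re]
      rw [this]
      nlinarith [sq_nonneg ‖star y v‖]
    exact le_of_sq_le_sq h1 (norm_nonneg _)
  have hE : ‖B ^ 2‖ ≤ 1 := by
    refine ContinuousLinearMap.opNorm_le_bound _ zero_le_one fun v => ?_
    rw [one_mul, pow_two]
    exact (hBn _).trans (hBn v)
  have hfix : ∀ v, (B ^ 2) v = v → v = 0 := by
    intro v hv
    set w := v - B v with hw
    have hw1 : w = (y * star y) v := by rw [hw, hBv]; abel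
    have hBw : B w = - w := by
      rw [hw, map_sub]
      have : B (B v) = v := by rw [← clm_mul, ← pow_two]; exact hv
      rw [this]; abel
    have h1 : inner ℂ w (B w) = ((‖w‖ ^ 2 - ‖star y w‖ ^ 2 : ℝ) : ℂ) := by
      rw [hBv, inner_sub_right, hyy, inner_self_ofReal]
      push_cast; rfl
    rw [hBw, inner_neg_right, inner_self_ofReal] at h1
    have h2 : -(‖w‖ ^ 2) = ‖w‖ ^ 2 - ‖star y w‖ ^ 2 := by exact_mod_cast h1
    have h3 : ‖star y w‖ ^ 2 ≤ ‖w‖ ^ 2 := by gcongr; exact hsy w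
    have h4 : ‖w‖ = 0 := by
      have : ‖w‖ ^ 2 ≤ 0 := by linarith
      nlinarith [norm_nonneg w]
    have h5 : (y * star y) v = 0 := by rw [← hw1]; exact norm_eq_zero.1 h4
    have h6 := hyy v
    rw [h5, inner_zero_right] at h6
    have h7 : ‖star y v‖ ^ 2 = 0 := by exact_mod_cast h6.symm
    exact hinj v (norm_eq_zero.1 (by simpa using h7))
  obtain ⟨E, hEB⟩ : ∃ E : H →L[ℂ] H, E = B ^ 2 := ⟨_, rfl⟩
  rw [← hEB] at hE hfix
  have hmain := E.tendsto_birkhoffAverage_orthogonalProjection hE δ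
  have hzero : ((E.eqLocus (1 : H →L[ℂ] H)).orthogonalProjectionOnto δ : H) = 0 :=
    hfix _ ((E.eqLocus (1 : H →L[ℂ] H)).orthogonalProjectionOnto δ).2
  rw [hzero] at hmain
  have h8 : Tendsto (fun n : ℕ => Complex.re (inner ℂ δ (birkhoffAverage ℂ E _root_.id n δ)))
      atTop (𝓝 0) := by
    have : Continuous fun z : H => Complex.re (inner ℂ δ z) := by fun_prop
    have h := (this.tendsto 0).comp hmain
    simpa [Function.comp_def] using h
  refine h8.congr fun n => ?_
  have hit : ∀ k, E^[k] δ = (B ^ (2 * k)) δ := by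
    intro k
    rw [pow_mul, ← hEB]
    induction k with
    | zero => simp
    | succ k ih => rw [Function.iterate_succ_apply', ih, pow_succ' E k]; rfl
  have hn : ∀ k, inner ℂ δ ((B ^ (2 * k)) δ) = ((‖(B ^ k) δ‖ ^ 2 : ℝ) : ℂ) := by
    intro k
    rw [two_mul, pow_add, clm_mul, ← ContinuousLinearMap.adjoint_inner_left,
      ← ContinuousLinearMap.star_eq_adjoint, (hsa.pow k).star_eq, inner_self_ofReal]
  simp only [birkhoffAverage, birkhoffSum, _root_.id, hit, inner_smul_right, inner_sum, hn]
  rw [← Complex.ofReal_natCast, ← Complex.ofReal_inv, Complex.re_ofReal_mul]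
  congr 1
  rw [← Complex.ofReal_sum, Complex.ofReal_re]

/-- The left Ore condition for the non zero divisors of the commutant of `S`, in the presence of
a separating vector `δ` which defines a trace. -/
theorem ore_cent (hS : ∀ g ∈ S, star g ∈ S) (δ : H)
    (hsep : ∀ T ∈ Subalgebra.centralizer ℂ S, T δ = 0 → T = 0)
    (htr : ∀ T ∈ Subalgebra.centralizer ℂ S, ∀ T' ∈ Subalgebra.centralizer ℂ S,
      inner ℂ δ ((T * T') δ) = inner ℂ δ ((T' * T) δ))
    {r s : H →L[ℂ] H} (hr : r ∈ Subalgebra.centralizer ℂ S)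
    (hs : s ∈ Subalgebra.centralizer ℂ S)
    (hs1 : ∀ b ∈ Subalgebra.centralizer ℂ S, s * b = 0 → b = 0)
    (hs2 : ∀ b ∈ Subalgebra.centralizer ℂ S, b * s = 0 → b = 0) :
    ∃ r' ∈ Subalgebra.centralizer ℂ S, ∃ s' ∈ Subalgebra.centralizer ℂ S,
      (∀ b ∈ Subalgebra.centralizer ℂ S, s' * b = 0 → b = 0) ∧
      (∀ b ∈ Subalgebra.centralizer ℂ S, b * s' = 0 → b = 0) ∧ s' * r = r' * s := by
  set N := Subalgebra.centralizer ℂ S with hN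
  have hst : ∀ {T}, T ∈ N → star T ∈ N := fun hT => star_mem_cent hS hT
  have sinj := injective_of_nzd hS hs hs1
  have sinj' := injective_of_nzd hS (hst hs) (fun b hb h => by
    have h2 := hs2 (star b) (hst hb) (by simpa using congrArg star h)
    simpa using h2)
  set A : H →L[ℂ] H := star r * r + star s * s with hA
  have hA0 : 0 ≤ A := add_nonneg (star_mul_self_nonneg r) (star_mul_self_nonneg s)
  have hAN : A ∈ N := add_mem (mul_mem (hst hr) hr) (mul_mem (hst hs) hs)
  set Q : H →L[ℂ] H := CFC.sqrt A with hQ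
  have hQQ : Q * Q = A := CFC.sqrt_mul_sqrt_self A hA0
  have hQsa : star Q = Q := (CFC.sqrt_nonneg A).isSelfAdjoint.star_eq
  have hQN : Q ∈ N := by
    rw [mem_cent] at hAN ⊢
    intro g hg
    have : Commute A g := (hAN g hg).symm
    exact (this.cfcₙ_nnreal NNReal.sqrt).symm
  have hnorm : ∀ h, ‖Q h‖ ^ 2 = ‖r h‖ ^ 2 + ‖s h‖ ^ 2 := by
    intro h
    have e : ∀ T : H →L[ℂ] H, inner ℂ h ((star T * T) h) = ((‖T h‖ ^ 2 : ℝ) : ℂ) := by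
      intro T
      rw [clm_mul, ContinuousLinearMap.star_eq_adjoint,
        ContinuousLinearMap.adjoint_inner_right, inner_self_ofReal]
    have h1 : inner ℂ h ((star Q * Q) h) = inner ℂ h (A h) := by rw [hQsa, hQQ]
    rw [hA, add_apply, inner_add_right, e, e, e] at h1
    exact_mod_cast h1
  have Qinj : ∀ x, Q x = 0 → x = 0 := by
    intro x hx
    have h1 := hnorm x
    rw [hx, norm_zero] at h1
    apply sinj
    apply norm_eq_zero.1
    nlinarith [sq_nonneg ‖r x‖, sq_nonneg ‖s x‖]
  have Qdense : DenseRange Q.toLinearMap := denseRange_of_adjoint (by rwa [hQsa])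
  have hrb : ∀ h, ‖r.toLinearMap h‖ ≤ 1 * ‖Q.toLinearMap h‖ := by
    intro h
    rw [one_mul]
    refine le_of_sq_le_sq ?_ (norm_nonneg _)
    have := hnorm h
    change ‖r h‖ ^ 2 ≤ ‖Q h‖ ^ 2
    nlinarith [sq_nonneg ‖s h‖]
  have hsb : ∀ h, ‖s.toLinearMap h‖ ≤ 1 * ‖Q.toLinearMap h‖ := by
    intro h
    rw [one_mul]
    refine le_of_sq_le_sq ?_ (norm_nonneg _)
    have := hnorm h
    change ‖s h‖ ^ 2 ≤ ‖Q h‖ ^ 2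
    nlinarith [sq_nonneg ‖r h‖]
  have eqD : ∀ {T T' : H →L[ℂ] H}, T * Q = T' * Q → T = T' := by
    intro T T' h
    refine ContinuousLinearMap.ext fun v => ?_
    refine congrFun (Qdense.equalizer T.continuous T'.continuous (funext fun w => ?_)) v
    exact congrArg (fun f : H →L[ℂ] H => f w) h
  have memD : ∀ {T T' : H →L[ℂ] H}, T' ∈ N → T * Q = T' → T ∈ N := by
    intro T T' hT' h
    rw [mem_cent] at hT' hQN ⊢
    intro g hg
    apply eqD
    rw [mul_assoc, h, mul_assoc, hQN g hg, ← mul_assoc, h, hT' g hg]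
  set x : H →L[ℂ] H := r.toLinearMap.extendOfNorm Q.toLinearMap with hx
  set y : H →L[ℂ] H := s.toLinearMap.extendOfNorm Q.toLinearMap with hy
  have hxQ : x * Q = r := ContinuousLinearMap.ext fun h =>
    LinearMap.extendOfNorm_eq Qdense ⟨1, hrb⟩ h
  have hyQ : y * Q = s := ContinuousLinearMap.ext fun h =>
    LinearMap.extendOfNorm_eq Qdense ⟨1, hsb⟩ h
  have hxN : x ∈ N := memD hr hxQ
  have hyN : y ∈ N := memD hs hyQ
  have hy1 : ‖y‖ ≤ 1 := LinearMap.opNorm_extendOfNorm_le Qdense zero_le_one hsb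
  have hx1 : ‖x‖ ≤ 1 := LinearMap.opNorm_extendOfNorm_le Qdense zero_le_one hrb
  have hsum : star x * x + star y * y = 1 := by
    apply eqD
    have h1 : Q * ((star x * x + star y * y) * Q) = Q * (1 * Q) := by
      have : Q * ((star x * x + star y * y) * Q) = star (x * Q) * (x * Q) + star (y * Q) * (y * Q) := by
        simp only [star_mul, hQsa]; noncomm_ring
      rw [this, hxQ, hyQ, one_mul, hQQ]
    refine ContinuousLinearMap.ext fun v => ?_
    have h2 := congrArg (fun f : H →L[ℂ] H => f v) h1
    have h3 : Q (((star x * x + star y * y) * Q) v - (1 * Q) v) = 0 := by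
      rw [map_sub]; exact sub_eq_zero.2 h2
    exact sub_eq_zero.1 (Qinj _ h3)
  have yinj' : ∀ v, star y v = 0 → v = 0 := by
    intro v hv
    apply sinj'
    rw [← hyQ, star_mul, hQsa, clm_mul, hv, map_zero]
  set B : H →L[ℂ] H := 1 - y * star y with hB
  set a : H →L[ℂ] H := x * star x with ha
  have hBN : B ∈ N := sub_mem (one_mem N) (mul_mem hyN (hst hyN))
  have haN : a ∈ N := mul_mem hxN (hst hxN)
  have hBsa : IsSelfAdjoint B := by simp [hB, IsSelfAdjoint]
  have hasa : IsSelfAdjoint a := by simp [ha, IsSelfAdjoint]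
  -- comparison of the traces of the powers
  have tr1 : ∀ k, inner ℂ δ ((a ^ k) δ) = inner ℂ δ (((star x * x) ^ k) δ) := by
    intro k
    cases k with
    | zero => simp
    | succ k =>
      have e1 : a ^ (k + 1) = x * ((star x * x) ^ k * star x) := by
        have : ∀ k : ℕ, a ^ k * x = x * (star x * x) ^ k := by
          intro k
          induction k with
          | zero => simp
          | succ k ih =>
            rw [pow_succ' a, mul_assoc, ih, pow_succ' (star x * x)]
            simp only [ha, mul_assoc]
        rw [pow_succ, ← mul_assoc (a := x), ← this, ha]; simp only [mul_assoc]
      rw [e1, htr x hxN _ (mul_mem (pow_mem (mul_mem (hst hxN) hxN) k) (hst hxN)), mul_assoc,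
        ← pow_succ]
  have tr2 : ∀ k, inner ℂ δ ((B ^ k) δ) = inner ℂ δ (((star x * x) ^ k) δ) := by
    have hC : star x * x = 1 - star y * y := by rw [← hsum]; abel
    rw [hC]
    intro k
    induction k with
    | zero => simp
    | succ k ih =>
      have e0 : ∀ k : ℕ, (1 - star y * y) ^ k * star y = star y * B ^ k := by
        intro k
        induction k with
        | zero => simp
        | succ k ih =>
          rw [pow_succ', mul_assoc, ih, pow_succ' B]
          simp only [hB]; noncomm_ring
      have e1 : B ^ (k + 1) = B ^ k - (B ^ k * y) * star y := by
        rw [pow_succ]; simp only [hB]; noncomm_ring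
      have e2 : (1 - star y * y) ^ (k + 1) =
          (1 - star y * y) ^ k - star y * (B ^ k * y) := by
        rw [pow_succ, mul_sub, mul_one, ← mul_assoc, e0, mul_assoc]
      rw [e1, e2, sub_apply, sub_apply, inner_sub_right,
        inner_sub_right, ih, htr (star y) (hst hyN) _ (mul_mem (pow_mem hBN k) hyN)]
  have hsq : ∀ {c : H →L[ℂ] H}, IsSelfAdjoint c → ∀ k : ℕ,
      inner ℂ δ ((c ^ (k + k)) δ) = ((‖(c ^ k) δ‖ ^ 2 : ℝ) : ℂ) := by
    intro c hc k
    rw [pow_add, clm_mul, ← ContinuousLinearMap.adjoint_inner_left,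
      ← ContinuousLinearMap.star_eq_adjoint, (hc.pow k).star_eq, inner_self_ofReal]
  have hnn : ∀ k, ‖(a ^ k) δ‖ ^ 2 = ‖(B ^ k) δ‖ ^ 2 := by
    intro k
    have h1 := (tr1 (k + k)).trans (tr2 (k + k)).symm
    rw [hsq hasa, hsq hBsa] at h1
    exact_mod_cast h1
  have hs'sa : star (1 - a) = 1 - a := by simp [hasa.star_eq]
  have hnzd : ∀ b ∈ N, (1 - a) * b = 0 → b = 0 := by
    intro b hb hab
    have h1 : a * b = b := by
      rw [sub_mul, one_mul, sub_eq_zero] at hab; exact hab.symm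
    have h2 : ∀ k : ℕ, a ^ k * b = b := by
      intro k
      induction k with
      | zero => simp
      | succ k ih => rw [pow_succ, mul_assoc, h1, ih]
    have h3 : ∀ k : ℕ, star b * a ^ k = star b := by
      intro k
      have := congrArg star (h2 k)
      rwa [star_mul, (hasa.pow k).star_eq] at this
    have h4 : ∀ k : ℕ, ‖star b δ‖ ^ 2 ≤ ‖star b‖ ^ 2 * ‖(B ^ k) δ‖ ^ 2 := by
      intro k
      rw [← hnn, ← mul_pow]
      have : star b δ = star b ((a ^ k) δ) := by
        conv_lhs => rw [← h3 k]
        rfl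
      rw [this]
      gcongr
      exact (star b).le_opNorm _
    have h5 := (average_tendsto hy1 yinj' δ).const_mul (‖star b‖ ^ 2)
    rw [mul_zero] at h5
    have h6 : ‖star b δ‖ ^ 2 ≤ 0 := by
      refine ge_of_tendsto h5 ?_
      filter_upwards [eventually_gt_atTop 0] with n hn
      have hn' : (0 : ℝ) < n := by exact_mod_cast hn
      have : (n : ℝ) * ‖star b δ‖ ^ 2 ≤ ‖star b‖ ^ 2 * ∑ k ∈ Finset.range n, ‖(B ^ k) δ‖ ^ 2 := by
        rw [Finset.mul_sum]
        have := Finset.sum_le_sum (s := Finset.range n) (fun k _ => h4 k)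
        simpa using this
      calc ‖star b δ‖ ^ 2 = (n : ℝ)⁻¹ * ((n : ℝ) * ‖star b δ‖ ^ 2) := by field_simp
        _ ≤ (n : ℝ)⁻¹ * (‖star b‖ ^ 2 * ∑ k ∈ Finset.range n, ‖(B ^ k) δ‖ ^ 2) := by gcongr
        _ = _ := by ring
    have h7 : star b δ = 0 := norm_eq_zero.1 (by nlinarith [norm_nonneg (star b δ)])
    have h8 := hsep _ (hst hb) h7
    simpa using congrArg star h8
  refine ⟨x * star y, mul_mem hxN (hst hyN), 1 - a, sub_mem (one_mem N) haN, hnzd, ?_, ?_⟩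
  · intro b hb h
    have h1 := hnzd (star b) (hst hb) (by rw [← hs'sa, ← star_mul, h, star_zero])
    simpa using congrArg star h1
  · have e1 : (1 - a) * x = x * star y * y := by
      have : star y * y = 1 - star x * x := by rw [← hsum]; abel
      rw [mul_assoc, this, ha]; noncomm_ring
    rw [← hxQ, ← mul_assoc, e1, mul_assoc, hyQ]

end Ore


section GroupVonNeumann

open scoped nonZeroDivisors

variable (G : Type u) [Group G]

/-- The Hilbert space `L²(G)` of square summable functions `G → ℂ`. -/
abbrev Hilb : Type u := lp (fun _ : G => ℂ) 2

variable {G}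

set_option linter.unusedSectionVars false in
theorem memlp_comp (e : G ≃ G) (f : Hilb G) : Memℓp (fun x => (f : G → ℂ) (e x)) 2 := by
  have h := lp.memℓp f
  rw [memℓp_gen_iff (by norm_num)] at h ⊢
  exact (e.summable_iff (f := fun i => ‖(f : G → ℂ) i‖ ^ (2 : ENNReal).toReal)).2 h

/-- The bounded operator `f ↦ f ∘ e` on `L²(G)` given by a permutation `e` of `G`. -/
noncomputable def permOp (e : G ≃ G) : Hilb G →L[ℂ] Hilb G :=
  LinearMap.mkContinuous
    { toFun := fun f => ⟨fun x => (f : G → ℂ) (e x), memlp_comp e f⟩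
      map_add' := fun _ _ => rfl
      map_smul' := fun _ _ => rfl } 1 (fun f => by
    rw [one_mul]
    apply le_of_eq
    rw [lp.norm_eq_tsum_rpow (by norm_num), lp.norm_eq_tsum_rpow (by norm_num)]
    congr 1
    exact e.tsum_eq (fun i => ‖(f : G → ℂ) i‖ ^ (2 : ENNReal).toReal))

theorem permOp_apply (e : G ≃ G) (f : Hilb G) (x : G) :
    (permOp e f : G → ℂ) x = (f : G → ℂ) (e x) := rfl

variable (G) in
/-- The left regular representation, `(g • f)(x) = f (g⁻¹ x)`. -/
noncomputable def leftReg (g : G) : Hilb G →L[ℂ] Hilb G := permOp (Equiv.mulLeft g⁻¹)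

variable (G) in
/-- The right regular representation, `(R_g f)(x) = f (x g)`. -/
noncomputable def rightReg (g : G) : Hilb G →L[ℂ] Hilb G := permOp (Equiv.mulRight g)

variable (G) in
/-- The group von Neumann algebra `𝒩(G) = ℬ(L²(G))^G` of bounded operators on `L²(G)` that
commute with the left action of `G`. -/
noncomputable def NAlg : Subalgebra ℂ (Hilb G →L[ℂ] Hilb G) :=
  Subalgebra.centralizer ℂ (Set.range (leftReg G))

theorem leftReg_apply (g : G) (f : Hilb G) (x : G) :
    (leftReg G g f : G → ℂ) x = (f : G → ℂ) (g⁻¹ * x) := rfl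

theorem rightReg_apply (g : G) (f : Hilb G) (x : G) :
    (rightReg G g f : G → ℂ) x = (f : G → ℂ) (x * g) := rfl

theorem star_leftReg (g : G) : star (leftReg G g) = leftReg G g⁻¹ := by
  rw [ContinuousLinearMap.star_eq_adjoint]
  symm
  rw [ContinuousLinearMap.eq_adjoint_iff]
  intro f f'
  rw [lp.inner_eq_tsum, lp.inner_eq_tsum,
    ← (Equiv.mulLeft g).tsum_eq (fun i => inner ℂ ((f : G → ℂ) i) ((leftReg G g f' : G → ℂ) i))]
  refine tsum_congr fun x => ?_
  simp [leftReg_apply]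

theorem star_range_leftReg : ∀ g ∈ Set.range (leftReg G), star g ∈ Set.range (leftReg G) := by
  rintro _ ⟨g, rfl⟩
  exact ⟨g⁻¹, (star_leftReg g).symm⟩

open Classical in
/-- The basis vector of `L²(G)` at `g`. -/
noncomputable def delta (g : G) : Hilb G := lp.single 2 g 1

theorem leftReg_delta (g h : G) : leftReg G g (delta h) = delta (g * h) := by
  classical
  ext x
  rw [leftReg_apply]
  simp only [delta, lp.single_apply, Pi.single_apply]
  simp only [inv_mul_eq_iff_eq_mul]

set_option linter.unusedSectionVars false in
theorem inner_delta (g : G) (f : Hilb G) : inner ℂ (delta g) f = (f : G → ℂ) g := by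
  classical
  rw [delta, lp.inner_single_left]; simp

theorem NAlg_comm {T : Hilb G →L[ℂ] Hilb G} (hT : T ∈ NAlg G) (g : G) (f : Hilb G) :
    T (leftReg G g f) = leftReg G g (T f) :=
  (congrArg (fun F : Hilb G →L[ℂ] Hilb G => F f) (mem_cent.1 hT _ ⟨g, rfl⟩)).symm

theorem NAlg_delta {T : Hilb G →L[ℂ] Hilb G} (hT : T ∈ NAlg G) (g : G) :
    T (delta g) = leftReg G g (T (delta 1)) := by
  rw [← NAlg_comm hT, leftReg_delta, mul_one]

theorem NAlg_sep (T : Hilb G →L[ℂ] Hilb G) (hT : T ∈ NAlg G) (h : T (delta 1) = 0) :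
    T = 0 := by
  classical
  ext1 f
  have h0 : ∀ g, T (delta g) = 0 := fun g => by rw [NAlg_delta hT, h, map_zero]
  have h1 := (lp.hasSum_single (p := 2) (by norm_num) f).mapL T
  have h2 : ∀ g : G, T (lp.single 2 g ((f : G → ℂ) g)) = 0 := by
    intro g
    have : lp.single (E := fun _ : G => ℂ) 2 g ((f : G → ℂ) g)
        = ((f : G → ℂ) g) • delta g := by
      rw [delta, ← lp.single_smul, smul_eq_mul, mul_one]
    rw [this, map_smul, h0, smul_zero]
  simp only [h2] at h1
  exact h1.unique hasSum_zero

theorem NAlg_trace (T : Hilb G →L[ℂ] Hilb G) (hT : T ∈ NAlg G) (T' : Hilb G →L[ℂ] Hilb G)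
    (hT' : T' ∈ NAlg G) :
    inner ℂ (delta 1) ((T * T') (delta 1)) = inner ℂ (delta 1) ((T' * T) (delta 1)) := by
  have key : ∀ U ∈ NAlg G, ∀ V : Hilb G →L[ℂ] Hilb G,
      inner ℂ (delta 1) ((U * V) (delta 1)) =
        ∑' x : G, (U (delta 1) : G → ℂ) x⁻¹ * (V (delta 1) : G → ℂ) x := by
    intro U hU V
    rw [clm_mul, ← ContinuousLinearMap.adjoint_inner_left, lp.inner_eq_tsum]
    refine tsum_congr fun x => ?_
    have h1 : ((ContinuousLinearMap.adjoint U) (delta 1) : G → ℂ) x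
        = (starRingEnd ℂ) ((U (delta 1) : G → ℂ) x⁻¹) := by
      rw [← inner_delta x, ContinuousLinearMap.adjoint_inner_right, NAlg_delta hU,
        ← inner_conj_symm, inner_delta, leftReg_apply, mul_one]
    rw [h1]
    simp [mul_comm]
  rw [key T hT, key T' hT',
    ← (Equiv.inv G).tsum_eq (fun x => (T' (delta 1) : G → ℂ) x⁻¹ * (T (delta 1) : G → ℂ) x)]
  refine tsum_congr fun x => ?_
  simp [mul_comm]

/-- The non zero divisors of the group von Neumann algebra satisfy the Ore condition. -/
theorem nonempty_oreSet_NAlg : Nonempty (OreLocalization.OreSet (NAlg G)⁰) := by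
  rw [OreLocalization.nonempty_oreSet_iff]
  constructor
  · intro r₁ r₂ s h
    refine ⟨1, ?_⟩
    have : (r₁ - r₂) * (s : NAlg G) = 0 := by rw [sub_mul, h, sub_self]
    rw [sub_eq_zero.1 (s.2.2 _ this)]
  · rintro ⟨r, hr⟩ ⟨⟨s, hs⟩, hs1, hs2⟩
    obtain ⟨r', hr', s', hs', h1, h2, h3⟩ := ore_cent star_range_leftReg (delta (1 : G)) NAlg_sep
      NAlg_trace hr hs
      (fun b hb h => congrArg Subtype.val (hs1 ⟨b, hb⟩ (Subtype.ext h)))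
      (fun b hb h => congrArg Subtype.val (hs2 ⟨b, hb⟩ (Subtype.ext h)))
    refine ⟨⟨r', hr'⟩, ⟨⟨s', hs'⟩, ?_, ?_⟩, Subtype.ext h3⟩
    · rintro ⟨b, hb⟩ h
      exact Subtype.ext (h1 b hb (congrArg Subtype.val h))
    · rintro ⟨b, hb⟩ h
      exact Subtype.ext (h2 b hb (congrArg Subtype.val h))

variable (G) in
noncomputable instance oreSetNAlg : OreLocalization.OreSet (NAlg G)⁰ :=
  nonempty_oreSet_NAlg.some

variable (G) in
/-- The algebra `𝒰(G)` of operators affiliated to the group von Neumann algebra, realized as the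
Ore localization of `𝒩(G)` with respect to all non zero divisors. -/
def UAlg : Type u := OreLocalization (NAlg G)⁰ (NAlg G)

noncomputable instance : Ring (UAlg G) :=
  inferInstanceAs (Ring (OreLocalization (NAlg G)⁰ (NAlg G)))

variable (G) in
/-- The canonical homomorphism `𝒩(G) → 𝒰(G)`. -/
noncomputable def NAlg.toUAlg : NAlg G →+* UAlg G :=
  (OreLocalization.numeratorRingHom : NAlg G →+* OreLocalization (NAlg G)⁰ (NAlg G))

theorem rightReg_mem (g : G) : rightReg G g ∈ NAlg G := by
  rw [NAlg, mem_cent]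
  rintro _ ⟨h, rfl⟩
  ext f x
  change (leftReg G h (rightReg G g f) : G → ℂ) x = (rightReg G g (leftReg G h f) : G → ℂ) x
  simp only [leftReg_apply, rightReg_apply, mul_assoc]

variable (G) in
/-- The right regular representation as a homomorphism from `G` to `𝒩(G)`. -/
noncomputable def rightRegHom : G →* NAlg G where
  toFun g := ⟨rightReg G g, rightReg_mem g⟩
  map_one' := by
    apply Subtype.ext
    ext f x
    change (f : G → ℂ) (x * 1) = (f : G → ℂ) x
    rw [mul_one]
  map_mul' g h := by
    apply Subtype.ext
    ext f x
    change (f : G → ℂ) (x * (g * h)) = (f : G → ℂ) (x * g * h)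
    rw [mul_assoc]

variable (G) in
/-- The embedding of `ℂ[G]` into `𝒰(G)` via `𝒩(G)`. -/
noncomputable def toUAlg : MonoidAlgebra ℂ G →+* UAlg G :=
  (NAlg.toUAlg G).comp
    ((MonoidAlgebra.lift ℂ (NAlg G) G (rightRegHom G)) : MonoidAlgebra ℂ G →+* NAlg G)

end GroupVonNeumann

section Closures

variable {S : Type*} [Ring S]

/-- A subring `T` of `S` is division closed if every element of `T` which is invertible in `S` is
already invertible in `T`. -/
def DivisionClosed (T : Subring S) : Prop :=
  ∀ x : T, IsUnit (x : S) → IsUnit x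

/-- A subring `T` of `S` is rationally closed if every square matrix over `T` which is invertible
over `S` is already invertible over `T`. -/
def RationallyClosed (T : Subring S) : Prop :=
  ∀ (n : ℕ) (M : Matrix (Fin n) (Fin n) T), IsUnit (M.map T.subtype) → IsUnit M

/-- The division closure of the subring `R` of `S`: the smallest division closed subring of `S`
containing `R`. -/
def divisionClosure (R : Subring S) : Subring S :=
  sInf {T | R ≤ T ∧ DivisionClosed T}

/-- The rational closure of the subring `R` of `S`: the smallest rationally closed subring of `S`
containing `R`. -/
def rationalClosure (R : Subring S) : Subring S :=
  sInf {T | R ≤ T ∧ RationallyClosed T}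

theorem le_divisionClosure (R : Subring S) : R ≤ divisionClosure R :=
  le_sInf fun _ h => h.1

theorem le_rationalClosure (R : Subring S) : R ≤ rationalClosure R :=
  le_sInf fun _ h => h.1

end Closures

section UniversalLocalization

variable {A : Type*} [Ring A] {B : Type*} [Ring B]

/-- A square matrix over `A`, of arbitrary size. -/
abbrev SqMatrix (A : Type*) : Type _ := Σ n : ℕ, Matrix (Fin n) (Fin n) A

/-- The set of all square matrices over `A` which become invertible over `B`. -/
def invertedBy (φ : A →+* B) : Set (SqMatrix A) := {M | IsUnit (φ.mapMatrix M.2)}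

/-- The symbols generating the universal localization: the elements of `A` and a symbol for each
entry of each matrix in `Σ`. -/
abbrev LocSymbol (X : Set (SqMatrix A)) : Type _ := A ⊕ (Σ M : X, Fin M.1.1 × Fin M.1.1)

/-- The matrix of symbols `M̄` which is to become the inverse of `M`. -/
def symbolMatrix {X : Set (SqMatrix A)} (M : X) :
    Matrix (Fin M.1.1) (Fin M.1.1) (FreeAlgebra ℤ (LocSymbol X)) :=
  fun i j => FreeAlgebra.ι ℤ (Sum.inr ⟨M, (i, j)⟩)

/-- The matrix `M` viewed as a matrix of symbols. -/
def coeffMatrix {X : Set (SqMatrix A)} (M : X) :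
    Matrix (Fin M.1.1) (Fin M.1.1) (FreeAlgebra ℤ (LocSymbol X)) :=
  fun i j => FreeAlgebra.ι ℤ (Sum.inl (M.1.2 i j))

/-- The defining relations of the universal localization. -/
inductive LocRel (X : Set (SqMatrix A)) :
    FreeAlgebra ℤ (LocSymbol X) → FreeAlgebra ℤ (LocSymbol X) → Prop
  | one : LocRel X (FreeAlgebra.ι ℤ (Sum.inl 1)) 1
  | add (a b : A) : LocRel X (FreeAlgebra.ι ℤ (Sum.inl (a + b)))
      (FreeAlgebra.ι ℤ (Sum.inl a) + FreeAlgebra.ι ℤ (Sum.inl b))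
  | mul (a b : A) : LocRel X (FreeAlgebra.ι ℤ (Sum.inl (a * b)))
      (FreeAlgebra.ι ℤ (Sum.inl a) * FreeAlgebra.ι ℤ (Sum.inl b))
  | inv_mul (M : X) (i j : Fin M.1.1) :
      LocRel X ((symbolMatrix M * coeffMatrix M) i j) ((1 : Matrix _ _ _) i j)
  | mul_inv (M : X) (i j : Fin M.1.1) :
      LocRel X ((coeffMatrix M * symbolMatrix M) i j) ((1 : Matrix _ _ _) i j)

/-- The universal localization `A_Σ` of the ring `A` at a set `Σ` of square matrices: the ring
obtained from `A` by adjoining the entries of formal inverses of the matrices in `Σ`. -/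
def UnivLoc (X : Set (SqMatrix A)) : Type _ := RingQuot (LocRel X)

noncomputable instance (X : Set (SqMatrix A)) : Ring (UnivLoc X) :=
  inferInstanceAs (Ring (RingQuot (LocRel X)))

/-- The values of the symbols in `B`, for a ring homomorphism inverting the matrices of `Σ`. -/
noncomputable def symbolValue (φ : A →+* B) {X : Set (SqMatrix A)} (h : X ⊆ invertedBy φ) :
    LocSymbol X → B
  | Sum.inl a => φ a
  | Sum.inr ⟨M, (i, j)⟩ => ((h M.2).unit⁻¹ : (Matrix _ _ B)ˣ).1 i j

theorem symbolValue_rel (φ : A →+* B) {X : Set (SqMatrix A)} (h : X ⊆ invertedBy φ)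
    ⦃x y : FreeAlgebra ℤ (LocSymbol X)⦄ (hxy : LocRel X x y) :
    FreeAlgebra.lift ℤ (symbolValue φ h) x = FreeAlgebra.lift ℤ (symbolValue φ h) y := by
  have h1 : ∀ M : X, (coeffMatrix M).map (FreeAlgebra.lift ℤ (symbolValue φ h))
      = φ.mapMatrix M.1.2 := by
    intro M; ext i j; simp [coeffMatrix, symbolValue]
  have h2 : ∀ M : X, (symbolMatrix M).map (FreeAlgebra.lift ℤ (symbolValue φ h))
      = ((h M.2).unit⁻¹ : (Matrix _ _ B)ˣ).1 := by
    intro M; ext i j; simp [symbolMatrix, symbolValue]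
  have h3 : ∀ (M : X) (P Q : Matrix (Fin M.1.1) (Fin M.1.1) (FreeAlgebra ℤ (LocSymbol X))),
      P.map (FreeAlgebra.lift ℤ (symbolValue φ h)) * Q.map (FreeAlgebra.lift ℤ (symbolValue φ h))
        = 1 → ∀ i j, FreeAlgebra.lift ℤ (symbolValue φ h) ((P * Q) i j) =
          FreeAlgebra.lift ℤ (symbolValue φ h) ((1 : Matrix _ _ _) i j) := by
    intro M P Q hPQ i j
    have e1 := congrFun (congrFun (Matrix.map_mul (L := P) (M := Q)
      (f := FreeAlgebra.lift ℤ (symbolValue φ h))) i) j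
    rw [Matrix.map_apply] at e1
    rw [e1, hPQ, Matrix.one_apply, Matrix.one_apply]
    split_ifs <;> simp
  induction hxy with
  | one => simp [symbolValue]
  | add a b => simp [symbolValue]
  | mul a b => simp [symbolValue]
  | inv_mul M i j => exact h3 M _ _ (by rw [h1, h2]; exact (h M.2).val_inv_mul) i j
  | mul_inv M i j => exact h3 M _ _ (by rw [h1, h2]; exact (h M.2).mul_val_inv) i j

/-- The ring homomorphism `A_Σ → B` induced by a `Σ`-inverting ring homomorphism `φ : A → B`. -/
noncomputable def UnivLoc.lift (φ : A →+* B) {X : Set (SqMatrix A)} (h : X ⊆ invertedBy φ) :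
    UnivLoc X →+* B :=
  (RingQuot.lift ⟨(FreeAlgebra.lift ℤ (symbolValue φ h) : _ →+* B),
    symbolValue_rel φ h⟩ : RingQuot (LocRel X) →+* B)

/-- The canonical ring homomorphism `λ : A_Σ → B`, where `Σ` consists of all square matrices over
`A` which become invertible over `B`. -/
noncomputable def locMap (φ : A →+* B) : UnivLoc (invertedBy φ) →+* B :=
  UnivLoc.lift φ (le_refl (invertedBy φ))

end UniversalLocalization

section BaseChange

variable {A : Type*} [Ring A] {B : Type*} [Ring B] (φ : A →+* B)

open scoped TensorProduct

/-- The relations `(b φ(a)) ⊗ p = b ⊗ (a p)`. -/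
def baseChangeRel (P : Type*) [AddCommGroup P] [Module A P] : Submodule B (B ⊗[ℤ] P) :=
  Submodule.span B {z | ∃ (b : B) (a : A) (p : P), z = (b * φ a) ⊗ₜ[ℤ] p - b ⊗ₜ[ℤ] (a • p)}

/-- The left `B`-module `φ_* P = B ⊗_A P`, for a left `A`-module `P`. -/
abbrev BaseChange (P : Type*) [AddCommGroup P] [Module A P] : Type _ :=
  (B ⊗[ℤ] P) ⧸ baseChangeRel φ P

variable {P : Type*} [AddCommGroup P] [Module A P] {Q : Type*} [AddCommGroup Q] [Module A Q]
  {M : Type*} [AddCommGroup M] [Module B M]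

namespace BaseChange

/-- The element `b ⊗ p` of `B ⊗_A P`. -/
def tmul (b : B) (p : P) : BaseChange φ P := (baseChangeRel φ P).mkQ (b ⊗ₜ[ℤ] p)

theorem smul_tmul (b c : B) (p : P) : b • tmul φ c p = tmul φ (b * c) p := by
  rw [tmul, ← map_smul, TensorProduct.smul_tmul', smul_eq_mul]; rfl

theorem tmul_smul (b : B) (a : A) (p : P) : tmul φ b (a • p) = tmul φ (b * φ a) p := by
  symm
  rw [tmul, tmul, ← sub_eq_zero, ← map_sub, Submodule.mkQ_apply, Submodule.Quotient.mk_eq_zero]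
  exact Submodule.subset_span ⟨b, a, p, rfl⟩

theorem tmul_add (b : B) (p q : P) : tmul φ b (p + q) = tmul φ b p + tmul φ b q := by
  rw [tmul, TensorProduct.tmul_add, map_add]; rfl

/-- Two `B`-linear maps out of `B ⊗_A P` agree if they agree on all `1 ⊗ p`. -/
theorem hom_ext {f g : BaseChange φ P →ₗ[B] M} (h : ∀ p, f (tmul φ 1 p) = g (tmul φ 1 p)) :
    f = g := by
  refine Submodule.linearMap_qext _ ?_
  refine LinearMap.ext fun x => ?_
  induction x using TensorProduct.induction_on with
  | zero => simp
  | tmul b p =>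
    change f (tmul φ b p) = g (tmul φ b p)
    have := smul_tmul φ b 1 p
    rw [mul_one] at this
    rw [← this, map_smul, map_smul, h]
  | add x y hx hy => rw [map_add, map_add, hx, hy]

/-- The `B`-linear map `B ⊗_A P → M` induced by a `φ`-semilinear map `P → M`. -/
def lift (f : P →ₛₗ[φ] M) : BaseChange φ P →ₗ[B] M :=
  (baseChangeRel φ P).liftQ
    (TensorProduct.AlgebraTensorModule.lift
      { toFun := fun b => b • f.toAddMonoidHom.toIntLinearMap
        map_add' := fun b c => add_smul b c _
        map_smul' := fun b c => mul_smul b c _ })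
    (by
      rw [baseChangeRel, Submodule.span_le]
      rintro _ ⟨b, a, p, rfl⟩
      simp [mul_smul])

theorem lift_tmul (f : P →ₛₗ[φ] M) (b : B) (p : P) : lift φ f (tmul φ b p) = b • f p := rfl

/-- The `φ`-semilinear map `p ↦ 1 ⊗ p`. -/
def incl : P →ₛₗ[φ] BaseChange φ P where
  toFun p := tmul φ 1 p
  map_add' := tmul_add φ 1
  map_smul' a p := by rw [tmul_smul, smul_tmul, one_mul, mul_one]

/-- The induced map `φ_* f = id_B ⊗_A f : B ⊗_A P → B ⊗_A Q` of an `A`-linear map `f`. -/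
def map (f : P →ₗ[A] Q) : BaseChange φ P →ₗ[B] BaseChange φ Q :=
  lift φ ((incl φ).comp f)

theorem map_tmul (f : P →ₗ[A] Q) (b : B) (p : P) :
    map φ f (tmul φ b p) = tmul φ b (f p) := by
  change b • tmul φ 1 (f p) = _
  rw [smul_tmul, mul_one]

theorem map_id : map φ (LinearMap.id : P →ₗ[A] P) = LinearMap.id :=
  hom_ext φ fun p => by simp [map_tmul]

theorem map_comp {Q' : Type*} [AddCommGroup Q'] [Module A Q'] (g : Q →ₗ[A] Q') (f : P →ₗ[A] Q) :
    map φ (g ∘ₗ f) = map φ g ∘ₗ map φ f :=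
  hom_ext φ fun p => by simp [map_tmul]

theorem map_zero' : map φ (0 : P →ₗ[A] Q) = 0 :=
  hom_ext φ fun p => by
    rw [map_tmul, tmul]; simp

theorem map_add' (f g : P →ₗ[A] Q) : map φ (f + g) = map φ f + map φ g :=
  hom_ext φ fun p => by
    rw [LinearMap.add_apply, map_tmul, map_tmul, map_tmul, LinearMap.add_apply, tmul_add]

theorem map_surjective {f : P →ₗ[A] Q} (hf : Function.Surjective f) :
    Function.Surjective (map φ f) := by
  rw [← LinearMap.range_eq_top]
  refine Submodule.eq_top_iff'.2 fun z => ?_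
  obtain ⟨x, rfl⟩ := Submodule.mkQ_surjective _ z
  induction x using TensorProduct.induction_on with
  | zero => rw [map_zero]; exact zero_mem _
  | tmul b q =>
    obtain ⟨p, rfl⟩ := hf q
    exact ⟨tmul φ b p, map_tmul φ f b p⟩
  | add x y hx hy => rw [map_add]; exact add_mem hx hy

instance finite [Module.Finite A P] : Module.Finite B (BaseChange φ P) := by
  classical
  obtain ⟨s, hs⟩ := (inferInstance : Module.Finite A P).fg_top
  refine ⟨⟨s.image (tmul φ 1), ?_⟩⟩
  rw [Submodule.eq_top_iff']
  intro z
  obtain ⟨x, rfl⟩ := Submodule.mkQ_surjective _ z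
  induction x using TensorProduct.induction_on with
  | zero => rw [map_zero]; exact zero_mem _
  | tmul b p =>
    change tmul φ b p ∈ _
    have hp : p ∈ Submodule.span A (s : Set P) := by rw [hs]; trivial
    have h1 : tmul φ (1 : B) p ∈ Submodule.span B (s.image (tmul φ (1 : B)) : Set _) := by
      induction hp using Submodule.span_induction with
      | mem x hx => exact Submodule.subset_span (by simpa using ⟨x, hx, rfl⟩)
      | zero => rw [show tmul φ (1 : B) (0 : P) = 0 from (incl (P := P) φ).map_zero]; exact zero_mem _
      | add x y _ _ hx hy => rw [tmul_add]; exact add_mem hx hy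
      | smul a x _ hx =>
        rw [show tmul φ (1 : B) (a • x) = φ a • tmul φ 1 x from (incl (P := P) φ).map_smulₛₗ a x]
        exact Submodule.smul_mem _ _ hx
    have := smul_tmul φ b 1 p
    rw [mul_one] at this
    rw [← this]
    exact Submodule.smul_mem _ _ h1
  | add x y hx hy => rw [map_add]; exact add_mem hx hy

instance projective [Module.Projective A P] : Module.Projective B (BaseChange φ P) := by
  refine Module.Projective.of_lifting_property'' fun f hf => ?_
  obtain ⟨s, hs⟩ := (Module.projective_def'.1 (inferInstance : Module.Projective A P))
  choose y hy using fun p : P => hf (tmul φ (1 : B) p)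
  let σ : P →ₛₗ[φ] (BaseChange φ P →₀ B) :=
    { toFun := fun p => (s p).sum fun q a => φ a • y q
      map_add' := fun p q => by
        rw [map_add, Finsupp.sum_add_index'] <;> simp [add_smul]
      map_smul' := fun a p => by
        rw [map_smul, Finsupp.sum_smul_index' (by simp), Finsupp.smul_sum]
        simp [mul_smul] }
  refine ⟨lift φ σ, hom_ext φ fun p => ?_⟩
  have h1 : f (σ p) = incl φ p := by
    have h2 : Finsupp.linearCombination A (fun q : P => q) (s p) = p :=
      LinearMap.congr_fun hs p
    conv_rhs => rw [← h2, Finsupp.linearCombination_apply, Finsupp.sum, map_sum]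
    change f ((s p).sum fun q a => φ a • y q) = _
    rw [Finsupp.sum, map_sum]
    refine Finset.sum_congr rfl fun q _ => ?_
    rw [map_smul, hy, LinearMap.map_smulₛₗ]; rfl
  rw [LinearMap.comp_apply, lift_tmul, one_smul, h1]; rfl

theorem map_bijective {f : P →ₗ[A] P} (hf : Function.Bijective f) :
    Function.Bijective (map φ f) := by
  let e := LinearEquiv.ofBijective f hf
  have h1 : (e.symm : P →ₗ[A] P) ∘ₗ f = LinearMap.id :=
    LinearMap.ext fun x => e.symm_apply_apply x
  have h2 : f ∘ₗ (e.symm : P →ₗ[A] P) = LinearMap.id :=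
    LinearMap.ext fun x => e.apply_symm_apply x
  refine Function.bijective_iff_has_inverse.2 ⟨map φ (e.symm : P →ₗ[A] P), fun x => ?_, fun x => ?_⟩
  · rw [← LinearMap.comp_apply, ← map_comp, h1, map_id]; rfl
  · rw [← LinearMap.comp_apply, ← map_comp, h2, map_id]; rfl

/-- Base change preserves short exact sequences whose last term is projective. -/
theorem map_shortExact {Q' : Type*} [AddCommGroup Q'] [Module A Q'] [Module.Projective A Q']
    {i : P →ₗ[A] Q} {p : Q →ₗ[A] Q'} (hi : Function.Injective i) (hip : Function.Exact i p)
    (hp : Function.Surjective p) :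
    Function.Injective (map φ i) ∧ Function.Exact (map φ i) (map φ p) ∧
      Function.Surjective (map φ p) := by
  obtain ⟨s, hs⟩ := Module.projective_lifting_property p LinearMap.id hp
  have hs' : ∀ x, p (s x) = x := fun x => LinearMap.congr_fun hs x
  have hex : ∀ x, ∃ y, i y = x - s (p x) := fun x =>
    (hip (x - s (p x))).1 (by rw [map_sub, hs', sub_self])
  choose r hr using hex
  let ρ : Q →ₗ[A] P :=
    { toFun := r
      map_add' := fun x y => hi (by rw [map_add, hr, hr, hr, map_add, map_add]; abel)
      map_smul' := fun a x => hi (by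
        rw [map_smul, hr, hr, map_smul, map_smul, smul_sub]; rfl) }
  have h1 : ρ ∘ₗ i = LinearMap.id := LinearMap.ext fun x => hi (by
    change i (r (i x)) = i x
    rw [hr, hip.apply_apply_eq_zero, map_zero, sub_zero])
  have h2 : i ∘ₗ ρ + s ∘ₗ p = LinearMap.id := LinearMap.ext fun x => by
    change i (r x) + s (p x) = x
    rw [hr, sub_add_cancel]
  have h3 : p ∘ₗ i = 0 := LinearMap.ext fun x => hip.apply_apply_eq_zero x
  refine ⟨?_, fun z => ⟨fun hz => ⟨map φ ρ z, ?_⟩, ?_⟩, map_surjective φ hp⟩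
  · refine Function.LeftInverse.injective (g := map φ ρ) fun x => ?_
    rw [← LinearMap.comp_apply, ← map_comp, h1, map_id]; rfl
  · have h4 := LinearMap.congr_fun (congrArg (map φ) h2) z
    rw [map_add', map_comp, map_comp, map_id, LinearMap.add_apply, LinearMap.comp_apply,
      LinearMap.comp_apply, hz, map_zero, add_zero] at h4
    exact h4
  · rintro ⟨w, rfl⟩
    rw [← LinearMap.comp_apply, ← map_comp, h3, map_zero']; rfl

end BaseChange

end BaseChange

section KTheory

universe v

/-- An endomorphism of a finitely generated projective left `A`-module. -/
structure FGProjEnd (A : Type u) [Ring A] where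
  /-- The module. -/
  P : Type u
  [addCommGroup : AddCommGroup P]
  [module : Module A P]
  [finite : Module.Finite A P]
  [projective : Module.Projective A P]
  /-- The endomorphism. -/
  f : P →ₗ[A] P

attribute [instance] FGProjEnd.addCommGroup FGProjEnd.module FGProjEnd.finite FGProjEnd.projective

/-- The defining relators for the first `K`-group on those endomorphisms of finitely generated
projective modules that satisfy `W`. -/
inductive K1Relator {A : Type u} [Ring A] (W : FGProjEnd A → Prop) :
    FreeAbelianGroup {x : FGProjEnd A // W x} → Prop
  /-- `[g ∘ f] = [g] + [f]`. -/
  | comp (P : Type u) [AddCommGroup P] [Module A P] [Module.Finite A P] [Module.Projective A P]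
      (f g : P →ₗ[A] P) (hf : W ⟨P, f⟩) (hg : W ⟨P, g⟩) (hgf : W ⟨P, g ∘ₗ f⟩) :
      K1Relator W (FreeAbelianGroup.of ⟨⟨P, g ∘ₗ f⟩, hgf⟩
        - (FreeAbelianGroup.of ⟨⟨P, g⟩, hg⟩ + FreeAbelianGroup.of ⟨⟨P, f⟩, hf⟩))
  /-- `[f₁] = [f₀] + [f₂]` for an endomorphism of a short exact sequence. -/
  | exact (P₀ P₁ P₂ : Type u)
      [AddCommGroup P₀] [Module A P₀] [Module.Finite A P₀] [Module.Projective A P₀]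
      [AddCommGroup P₁] [Module A P₁] [Module.Finite A P₁] [Module.Projective A P₁]
      [AddCommGroup P₂] [Module A P₂] [Module.Finite A P₂] [Module.Projective A P₂]
      (i : P₀ →ₗ[A] P₁) (p : P₁ →ₗ[A] P₂) (f₀ : P₀ →ₗ[A] P₀) (f₁ : P₁ →ₗ[A] P₁)
      (f₂ : P₂ →ₗ[A] P₂) (hi : Function.Injective i) (hip : Function.Exact i p)
      (hp : Function.Surjective p) (h₀₁ : f₁ ∘ₗ i = i ∘ₗ f₀) (h₁₂ : f₂ ∘ₗ p = p ∘ₗ f₁)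
      (h₀ : W ⟨P₀, f₀⟩) (h₁ : W ⟨P₁, f₁⟩) (h₂ : W ⟨P₂, f₂⟩) :
      K1Relator W (FreeAbelianGroup.of ⟨⟨P₁, f₁⟩, h₁⟩
        - (FreeAbelianGroup.of ⟨⟨P₀, f₀⟩, h₀⟩ + FreeAbelianGroup.of ⟨⟨P₂, f₂⟩, h₂⟩))

/-- The abelian group generated by the endomorphisms of finitely generated projective `A`-modules
satisfying `W`, with the relations `[g ∘ f] = [g] + [f]` and `[f₁] = [f₀] + [f₂]` for
endomorphisms of short exact sequences. -/
abbrev K1Gen {A : Type u} [Ring A] (W : FGProjEnd A → Prop) : Type (u + 1) :=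
  FreeAbelianGroup {x : FGProjEnd A // W x} ⧸ AddSubgroup.closure {z | K1Relator W z}

/-- The class `[f]` of an endomorphism. -/
def K1Gen.cls {A : Type u} [Ring A] {W : FGProjEnd A → Prop} (x : FGProjEnd A) (hx : W x) :
    K1Gen W :=
  QuotientAddGroup.mk (FreeAbelianGroup.of ⟨x, hx⟩)

/-- The base change `φ_* f : φ_* P → φ_* P`. -/
def FGProjEnd.baseChange {A : Type v} {B : Type (max u v)} [Ring A] [Ring B] (φ : A →+* B)
    (x : FGProjEnd A) : FGProjEnd B :=
  ⟨BaseChange φ x.P, BaseChange.map φ x.f⟩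

/-- The homomorphism `[f] ↦ [φ_* f]`. -/
def K1Gen.baseChange {A : Type v} {B : Type (max u v)} [Ring A] [Ring B] (φ : A →+* B)
    {W : FGProjEnd A → Prop} {W' : FGProjEnd B → Prop}
    (h : ∀ x, W x → W' (FGProjEnd.baseChange.{u, v} φ x)) : K1Gen W →+ K1Gen W' :=
  QuotientAddGroup.map _ _
    (FreeAbelianGroup.map fun x : {x : FGProjEnd A // W x} =>
      (⟨FGProjEnd.baseChange.{u, v} φ x.1, h x.1 x.2⟩ : {y : FGProjEnd B // W' y})) (by
    rw [AddSubgroup.closure_le]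
    intro z hz
    refine AddSubgroup.subset_closure ?_
    induction hz with
    | comp P f g hf hg hgf =>
      simp only [map_sub, map_add, FreeAbelianGroup.map_of_apply]
      have e : FGProjEnd.baseChange.{u, v} φ ⟨P, g ∘ₗ f⟩ =
          ⟨BaseChange φ P, BaseChange.map φ g ∘ₗ BaseChange.map φ f⟩ := by
        rw [FGProjEnd.baseChange, BaseChange.map_comp]
      have e' := h _ hgf
      rw [e] at e'
      simp only [e]
      exact K1Relator.comp (BaseChange φ P) (BaseChange.map φ f) (BaseChange.map φ g) (h _ hf)
        (h _ hg) e'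
    | exact P₀ P₁ P₂ i p f₀ f₁ f₂ hi hip hp h₀₁ h₁₂ h₀ h₁ h₂ =>
      simp only [map_sub, map_add, FreeAbelianGroup.map_of_apply]
      obtain ⟨a, b, c⟩ := BaseChange.map_shortExact φ hi hip hp
      exact K1Relator.exact _ _ _ (BaseChange.map φ i) (BaseChange.map φ p)
        (BaseChange.map φ f₀) (BaseChange.map φ f₁) (BaseChange.map φ f₂) a b c
        (by rw [← BaseChange.map_comp, h₀₁, BaseChange.map_comp])
        (by rw [← BaseChange.map_comp, h₁₂, BaseChange.map_comp]) (h _ h₀) (h _ h₁) (h _ h₂))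

/-- The homomorphism `[f] ↦ [f]` that relaxes the condition on the endomorphisms. -/
def K1Gen.relax {A : Type u} [Ring A] {W W' : FGProjEnd A → Prop} (h : ∀ x, W x → W' x) :
    K1Gen W →+ K1Gen W' :=
  QuotientAddGroup.map _ _
    (FreeAbelianGroup.map fun x : {x : FGProjEnd A // W x} =>
      (⟨x.1, h x.1 x.2⟩ : {y : FGProjEnd A // W' y})) (by
    rw [AddSubgroup.closure_le]
    intro z hz
    refine AddSubgroup.subset_closure ?_
    induction hz with
    | comp P f g hf hg hgf =>
      simp only [map_sub, map_add, FreeAbelianGroup.map_of_apply]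
      exact K1Relator.comp P f g (h _ hf) (h _ hg) (h _ hgf)
    | exact P₀ P₁ P₂ i p f₀ f₁ f₂ hi hip hp h₀₁ h₁₂ h₀ h₁ h₂ =>
      simp only [map_sub, map_add, FreeAbelianGroup.map_of_apply]
      exact K1Relator.exact P₀ P₁ P₂ i p f₀ f₁ f₂ hi hip hp h₀₁ h₁₂ (h _ h₀) (h _ h₁) (h _ h₂))

/-- The first algebraic `K`-group `K₁(A)`, generated by the automorphisms of finitely generated
projective `A`-modules. -/
abbrev K1 (A : Type u) [Ring A] : Type (u + 1) :=
  K1Gen (A := A) fun x => Function.Bijective x.f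

/-- The group `K₁` of those endomorphisms `f` of finitely generated projective `A`-modules for
which `φ_* f` is an isomorphism. -/
abbrev K1Inv {A : Type u} {B : Type u} [Ring A] [Ring B] (φ : A →+* B) : Type (u + 1) :=
  K1Gen (A := A) fun x => Function.Bijective (BaseChange.map φ x.f)

/-- The homomorphism `K₁(A) → K₁(B)`, `[f] ↦ [φ_* f]`. -/
def K1.map {A : Type v} {B : Type (max u v)} [Ring A] [Ring B] (φ : A →+* B) : K1 A →+ K1 B :=
  K1Gen.baseChange.{u, v} φ fun _ hx => BaseChange.map_bijective φ hx

/-- The homomorphism `[f] ↦ [f]` from `K₁(A)` to the group of endomorphisms which become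
invertible over `B`. -/
def K1.toInv {A : Type u} {B : Type u} [Ring A] [Ring B] (φ : A →+* B) : K1 A →+ K1Inv φ :=
  K1Gen.relax fun _ hx => BaseChange.map_bijective φ hx

/-- The homomorphism `φ_*`, `[f] ↦ [φ_* f]`, from the group of endomorphisms which become
invertible over `B` to `K₁(B)`. -/
def K1Inv.toK1 {A : Type u} {B : Type u} [Ring A] [Ring B] (φ : A →+* B) : K1Inv φ →+ K1 B :=
  K1Gen.baseChange.{u, u} φ fun _ hx => hx

/-- The class in `K₁(A)` of an invertible matrix `M`, i.e. of the automorphism `x ↦ x M` of the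
left `A`-module `Aⁿ` of row vectors. -/
def K1.ofMatrix {A : Type u} [Ring A] {n : ℕ} (M : (Matrix (Fin n) (Fin n) A)ˣ) : K1 A :=
  K1Gen.cls ⟨Fin n → A, Matrix.vecMulLinear M.1⟩ (by
    refine Function.bijective_iff_has_inverse.2
      ⟨Matrix.vecMulLinear (M⁻¹).1, fun x => ?_, fun x => ?_⟩
    · simp [Matrix.vecMul_vecMul]
    · simp [Matrix.vecMul_vecMul])

/-- The homomorphism from the units of `A` to `K₁(A)` sending `u` to the class of the automorphism
`a ↦ a u` of the left `A`-module `A`. -/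
def K1.ofUnit (A : Type u) [Ring A] : Additive Aˣ →+ K1 A :=
  AddMonoidHom.mk' (fun u => K1Gen.cls ⟨A, LinearMap.toSpanSingleton A A (u.toMul : A)⟩
    (Function.bijective_iff_has_inverse.2
      ⟨fun a => a * ((u.toMul)⁻¹ : Aˣ), fun x => by simp, fun x => by simp⟩)) (by
    intro u v
    have hbij : ∀ w : Aˣ, Function.Bijective (LinearMap.toSpanSingleton A A (w : A)) := fun w =>
      Function.bijective_iff_has_inverse.2
        ⟨fun a => a * ((w⁻¹ : Aˣ) : A), fun x => by simp, fun x => by simp⟩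
    have e : LinearMap.toSpanSingleton A A (((u + v).toMul : Aˣ) : A) =
        LinearMap.toSpanSingleton A A (v.toMul : A) ∘ₗ
          LinearMap.toSpanSingleton A A (u.toMul : A) := by
      ext; simp
    rw [add_comm]
    simp only [e]
    have h := hbij (u + v).toMul
    rw [e] at h
    have hrel := K1Relator.comp (W := fun x : FGProjEnd A => Function.Bijective x.f) A
      (LinearMap.toSpanSingleton A A (u.toMul : A))
      (LinearMap.toSpanSingleton A A (v.toMul : A)) (hbij u.toMul) (hbij v.toMul) h
    rw [K1Gen.cls, K1Gen.cls, K1Gen.cls, ← QuotientAddGroup.mk_add, ← sub_eq_zero,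
      ← QuotientAddGroup.mk_sub, QuotientAddGroup.eq_zero_iff]
    exact AddSubgroup.subset_closure hrel)

end KTheory

section Dieudonne

/-- The subgroup of `GL_n(D)` generated by the elementary matrices `1 + c e_{ij}`, `i ≠ j`. -/
def elementarySubgroup (n : ℕ) (D : Type*) [Ring D] : Subgroup (Matrix (Fin n) (Fin n) D)ˣ :=
  Subgroup.closure {E | ∃ (i j : Fin n) (c : D), i ≠ j ∧
    (E : Matrix (Fin n) (Fin n) D) = 1 + Matrix.single i j c}

/-- `c` is the Dieudonné determinant of the invertible matrix `M` over the skew field `D`: by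
elementary row operations `M` can be transformed into a diagonal matrix, and `c` is the class of
the product of its diagonal entries in the abelianized unit group of `D`. -/
def IsDieudonneDet {n : ℕ} {D : Type*} [Ring D] (M : (Matrix (Fin n) (Fin n) D)ˣ)
    (c : Abelianization Dˣ) : Prop :=
  ∃ E ∈ elementarySubgroup n D, ∃ d : Fin n → Dˣ,
    ((E * M : (Matrix (Fin n) (Fin n) D)ˣ) : Matrix (Fin n) (Fin n) D) =
      Matrix.diagonal (fun i => (d i : D)) ∧
    c = ∏ i, Abelianization.of (d i)

/-- The ring `D` is a skew field. -/
def IsSkewField (D : Type*) [Ring D] : Prop :=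
  Nontrivial D ∧ ∀ x : D, x ≠ 0 → IsUnit x

end Dieudonne

section GroupRings

variable (G : Type u) [Group G]

/-- The embedding `R[G] → 𝒰(G)`, for a subring `R` of `ℂ`. -/
noncomputable def groupRingMap (R : Subring ℂ) : MonoidAlgebra R G →+* UAlg G :=
  (toUAlg G).comp (MonoidAlgebra.mapRingHom G R.subtype)

/-- The division closure `𝒟(G;F)` of `F[G]` in `𝒰(G)`. -/
noncomputable def DAlg (F : Subfield ℂ) : Subring (UAlg G) :=
  divisionClosure (groupRingMap G F.toSubring).range

/-- The rational closure `ℛ(G;F)` of `F[G]` in `𝒰(G)`. -/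
noncomputable def RAlg (F : Subfield ℂ) : Subring (UAlg G) :=
  rationalClosure (groupRingMap G F.toSubring).range

/-- The inclusion `F[G] → ℛ(G;F)`. -/
noncomputable def toRAlg (F : Subfield ℂ) : MonoidAlgebra F.toSubring G →+* RAlg G F :=
  (groupRingMap G F.toSubring).codRestrict (RAlg G F)
    fun x => le_rationalClosure _ ⟨x, rfl⟩

/-- Property (ULA) with respect to `F`: the canonical map from the universal localization of
`F[G]` at the square matrices that become invertible over `ℛ(G;F)` to `ℛ(G;F)` is bijective, and
`𝒟(G;F)` is a skew field. -/
def PropertyULA (F : Subfield ℂ) : Prop :=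
  Function.Bijective (locMap (toRAlg G F)) ∧ IsSkewField (DAlg G F)

/-- The quotient field of the subring `R` of `ℂ`, as a subfield of `ℂ`. -/
noncomputable def quotField (R : Subring ℂ) : Subfield ℂ := Subfield.closure (R : Set ℂ)

/-- The inclusion `ω : R[G] → 𝒟(G;F)`, where `F` is the quotient field of `R`. -/
noncomputable def omega (R : Subring ℂ) : MonoidAlgebra R G →+* DAlg G (quotField R) :=
  (groupRingMap G R).codRestrict (DAlg G (quotField R)) fun x =>
    le_divisionClosure _ ⟨MonoidAlgebra.mapRingHom G
      (Subring.inclusion (S := R) (T := (quotField R).toSubring) Subfield.subset_closure) x, by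
        refine congrArg (toUAlg G) ?_
        ext g
        simp only [MonoidAlgebra.coeff_mapRingHom]
        rfl⟩

/-- The homomorphism `ℤ[G] → R[G]`. -/
noncomputable def fromInt (R : Subring ℂ) : MonoidAlgebra ℤ G →+* MonoidAlgebra R G :=
  MonoidAlgebra.mapRingHom G (Int.castRingHom R)

/-- The trivial units `± g` of `ℤ[G]`. -/
noncomputable def trivialUnits : ℤˣ × G →* (MonoidAlgebra ℤ G)ˣ :=
  MonoidHom.toHomUnits
    { toFun := fun x => MonoidAlgebra.single x.2 (x.1 : ℤ)
      map_one' := rfl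
      map_mul' := fun x y => by simp [MonoidAlgebra.single_mul_single] }

/-- The composite `{± 1} → K₁(ℤ) → K₁(ℤ[G])`. -/
noncomputable def signK1 : Additive ℤˣ →+ K1 (MonoidAlgebra ℤ G) :=
  (K1.map.{u, 0} (Int.castRingHom (MonoidAlgebra ℤ G))).comp (K1.ofUnit ℤ)

/-- The homomorphism from the group `{± g ∣ g ∈ G}` of trivial units to `K₁(ℤ[G])`. -/
noncomputable def trivialK1 : Additive (ℤˣ × G) →+ K1 (MonoidAlgebra ℤ G) :=
  (K1.ofUnit (MonoidAlgebra ℤ G)).comp (trivialUnits G).toAdditive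

variable (R : Subring ℂ)

/-- `K₁^w(R[G])`: generated by the endomorphisms `f` of finitely generated projective
`R[G]`-modules such that `ω_* f` is an isomorphism over `𝒟(G;F)`. -/
abbrev K1w : Type (u + 1) := K1Inv (omega G R)

/-- The homomorphism `K₁(ℤ[G]) → K₁^w(R[G])`. -/
noncomputable def intToK1w : K1 (MonoidAlgebra ℤ G) →+ K1w G R :=
  (K1.toInv (omega G R)).comp (K1.map.{u, u} (fromInt G R))

/-- The homomorphism `K₁(ℤ[G]) → K₁(𝒟(G;F))`. -/
noncomputable def intToK1D : K1 (MonoidAlgebra ℤ G) →+ K1 (DAlg G (quotField R)) :=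
  K1.map.{u, u} ((omega G R).comp (fromInt G R))

/-- The reduced group `K̃₁^w(R[G])`. -/
abbrev RedK1w : Type (u + 1) := K1w G R ⧸ ((intToK1w G R).comp (signK1 G)).range

/-- The reduced group `K̃₁(𝒟(G;F))`. -/
abbrev RedK1D : Type (u + 1) :=
  K1 (DAlg G (quotField R)) ⧸ ((intToK1D G R).comp (signK1 G)).range

/-- The Whitehead group `Wh^w(G;R)`. -/
abbrev Whw : Type (u + 1) := K1w G R ⧸ ((intToK1w G R).comp (trivialK1 G)).range

/-- The Whitehead group `Wh(𝒟(G;F))`. -/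
abbrev WhD : Type (u + 1) :=
  K1 (DAlg G (quotField R)) ⧸ ((intToK1D G R).comp (trivialK1 G)).range

/-- The canonical map `ω_* : K₁^w(R[G]) → K₁(𝒟(G;F))`, `[f] ↦ [ω_* f]`. -/
noncomputable def omegaK1 : K1w G R →+ K1 (DAlg G (quotField R)) :=
  K1Inv.toK1 (omega G R)

end GroupRings

end L2

set_option linter.unusedSimpArgs false
set_option linter.unusedSectionVars false

namespace L2

open Matrix

/-! Write `A = R[G]`, `D = 𝒟(G;F)` and `φ = ω`. The theorem rests on two facts: property (ULA) makes
`D` a universal target for ring homomorphisms on `A` that invert the matrices `φ` inverts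
(`exists_hom_of_propertyULA`), and every matrix over `D` has the form `f s⁻¹ x` with matrices over
`A` and `s` inverted by `φ` (`exists_triple_eval_eq`, `exists_eval_eq`).

The matrix `[[s, x], [-f, 0]]` over `A` has Schur complement `f s⁻¹ x`. Hence in `K₁(D)` the class
of an invertible `f s⁻¹ x` is the class of this block matrix minus the class of `s`, and both come
from `K₁^w`; this is surjectivity. It also suggests how to extend an additive invariant `χ` of the
inverted matrices over `A` to `GL_n(D)`: send `f s⁻¹ x` to `χ([[s, x], [-f, 0]]) - χ(s)`. The
difficulty is independence of the presentation.

Independence is forced by universality. Call two triples `(f, s, x)` equivalent if `χ` cannot tell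
them apart inside any larger block matrix. Since contexts can be nested, this is a congruence for
sums and products of triples, and the classes form a ring `LocRing χ Unit` over `A` in which every
matrix inverted by `φ` is invertible. Universality gives a homomorphism from `D` to this ring over
`A`, and it must send the value of a triple to its class. So triples with equal value are equivalent
(`equivalent_of_eval_eq`), and `χ` extends to a homomorphism on `GL_n(D)`
(`DetInvariant.exists_extension`).

For injectivity take the tautological `χ` with values in `K₁^w`. An element of `K₁^w` is a
difference `[a] - [b]` of matrices of one size. If it dies in `K₁(D)`, then `φ(a)` and `φ(b)` have
the same Dieudonné determinant. Over a skew field with `2 ≠ 0`, every homomorphism from `GL_n(D)`,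
`n ≥ 1`, to an abelian group factors through that determinant (`eq_of_dieudonneDet_eq`); applied to
the extension of `χ` this gives `[a] = [b]`.

The Dieudonné determinant is built by induction on the size, splitting off one row and column, and
the same factorization property identifies `K₁(D)` with the abelianized unit group. The reduced and
Whitehead versions follow by passing to cokernels of compatible maps. -/

theorem isUnit_of_two_sided {S : Type*} [Monoid S] {a : S} (b : S) (h : a * b = 1)
    (h' : b * a = 1) : IsUnit a := ⟨⟨a, b, h, h'⟩, rfl⟩

/-! ### Invertibility of block triangular matrices -/

section BlockUnits

variable {S : Type*} [Ring S] {m n : Type*} [Fintype m] [DecidableEq m] [Fintype n] [DecidableEq n]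

theorem isUnit_fromBlocks_one_lower (X : Matrix n m S) :
    IsUnit (fromBlocks (1 : Matrix m m S) 0 X (1 : Matrix n n S)) :=
  isUnit_of_two_sided (fromBlocks 1 0 (-X) 1)
    (by simp [fromBlocks_multiply]) (by simp [fromBlocks_multiply])

theorem isUnit_fromBlocks_one_upper (X : Matrix m n S) :
    IsUnit (fromBlocks (1 : Matrix m m S) X 0 (1 : Matrix n n S)) :=
  isUnit_of_two_sided (fromBlocks 1 (-X) 0 1)
    (by simp [fromBlocks_multiply]) (by simp [fromBlocks_multiply])

theorem isUnit_fromBlocks_one_diag {N : Matrix n n S} :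
    IsUnit (fromBlocks (1 : Matrix m m S) 0 0 N) ↔ IsUnit N := by
  constructor
  · rintro ⟨⟨_, v, h1, h2⟩, rfl⟩
    rw [← fromBlocks_toBlocks v, fromBlocks_multiply, ← fromBlocks_one, fromBlocks_inj] at h1 h2
    simp only [zero_add, add_zero, Matrix.zero_mul, Matrix.mul_zero] at h1 h2
    exact isUnit_of_two_sided _ h1.2.2.2 h2.2.2.2
  · rintro ⟨⟨N, v, h1, h2⟩, rfl⟩
    exact isUnit_of_two_sided (fromBlocks 1 0 0 v)
      (by simp [fromBlocks_multiply, h1]) (by simp [fromBlocks_multiply, h2])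

theorem isUnit_fromBlocks_diag_one {M : Matrix m m S} (hM : IsUnit M) :
    IsUnit (fromBlocks M 0 0 (1 : Matrix n n S)) := by
  obtain ⟨⟨M, v, h1, h2⟩, rfl⟩ := hM
  exact isUnit_of_two_sided (fromBlocks v 0 0 1)
      (by simp [fromBlocks_multiply, h1]) (by simp [fromBlocks_multiply, h2])

/-- An invertible corner clears its row by a column operation, so up to invertible factors only
`diag(1, N)` remains. -/
theorem isUnit_fromBlocks_upper {M : Matrix m m S} (hM : IsUnit M) (X : Matrix m n S)
    {N : Matrix n n S} : IsUnit (fromBlocks M X 0 N) ↔ IsUnit N := by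
  obtain ⟨u, rfl⟩ := hM
  have e : fromBlocks u.1 X 0 N = fromBlocks 1 0 0 N *
      (fromBlocks u.1 0 0 1 * fromBlocks 1 ((u⁻¹).1 * X) 0 1) := by
    simp [fromBlocks_multiply, ← Matrix.mul_assoc]
  have h : IsUnit (fromBlocks u.1 0 0 (1 : Matrix n n S) * fromBlocks 1 ((u⁻¹).1 * X) 0 1) :=
    (isUnit_fromBlocks_diag_one u.isUnit).mul (isUnit_fromBlocks_one_upper _)
  obtain ⟨w, hw⟩ := h
  rw [e, ← hw, Units.isUnit_mul_units, isUnit_fromBlocks_one_diag]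

theorem isUnit_fromBlocks_lower {M : Matrix m m S} (hM : IsUnit M) (X : Matrix n m S)
    {N : Matrix n n S} : IsUnit (fromBlocks M 0 X N) ↔ IsUnit N := by
  obtain ⟨u, rfl⟩ := hM
  have e : fromBlocks u.1 0 X N = (fromBlocks 1 0 (X * (u⁻¹).1) 1 * fromBlocks u.1 0 0 1) *
      fromBlocks 1 0 0 N := by
    simp [fromBlocks_multiply, Matrix.mul_assoc]
  have h : IsUnit (fromBlocks 1 0 (X * (u⁻¹).1) 1 * fromBlocks u.1 0 0 (1 : Matrix n n S)) :=
    (isUnit_fromBlocks_one_lower _).mul (isUnit_fromBlocks_diag_one u.isUnit)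
  obtain ⟨w, hw⟩ := h
  rw [e, ← hw, Units.isUnit_units_mul, isUnit_fromBlocks_one_diag]

theorem isUnit_submatrix_equiv_iff (e : m ≃ n) {M : Matrix n n S} :
    IsUnit (M.submatrix e e) ↔ IsUnit M := by
  constructor
  · rintro ⟨⟨_, v, h1, h2⟩, rfl⟩
    refine isUnit_of_two_sided (v.submatrix e.symm e.symm) ?_ ?_
    · have := congrArg (fun Z => Matrix.submatrix Z e.symm e.symm) h1
      simpa [← submatrix_mul_equiv _ _ _ e.symm] using this
    · have := congrArg (fun Z => Matrix.submatrix Z e.symm e.symm) h2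
      simpa [← submatrix_mul_equiv _ _ _ e.symm] using this
  · rintro ⟨⟨M, v, h1, h2⟩, rfl⟩
    refine isUnit_of_two_sided (v.submatrix e e) ?_ ?_
    · simp [submatrix_mul_equiv, h1]
    · simp [submatrix_mul_equiv, h2]

end BlockUnits

/-! ### Matrices over `A` inverted by `φ`, and their additive invariants -/

section Inverted

variable {A : Type*} [Ring A] {D : Type*} [Ring D] (φ : A →+* D)

/-- The square matrix `M` over `A` becomes invertible over `D`. -/
def Inverts {ι : Type*} [Fintype ι] [DecidableEq ι] (M : Matrix ι ι A) : Prop :=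
  IsUnit (φ.mapMatrix M)

variable {φ} {m n : Type*} [Fintype m] [DecidableEq m] [Fintype n] [DecidableEq n]

theorem Inverts.one : Inverts φ (1 : Matrix m m A) := by
  rw [Inverts, map_one]; exact isUnit_one

theorem Inverts.of_isUnit {M : Matrix m m A} (hM : IsUnit M) : Inverts φ M := hM.map _

theorem Inverts.mul_iff_left {M N : Matrix m m A} (hM : Inverts φ M) :
    Inverts φ (M * N) ↔ Inverts φ N := by
  obtain ⟨u, hu⟩ := hM
  rw [Inverts, map_mul, ← hu, Units.isUnit_units_mul, Inverts]

theorem Inverts.mul_iff_right {M N : Matrix m m A} (hN : Inverts φ N) :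
    Inverts φ (M * N) ↔ Inverts φ M := by
  obtain ⟨u, hu⟩ := hN
  rw [Inverts, map_mul, ← hu, Units.isUnit_mul_units, Inverts]

theorem Inverts.mul {M N : Matrix m m A} (hM : Inverts φ M) (hN : Inverts φ N) :
    Inverts φ (M * N) := hM.mul_iff_left.2 hN

theorem mapMatrix_fromBlocks (M : Matrix m m A) (X : Matrix m n A) (Y : Matrix n m A)
    (N : Matrix n n A) : φ.mapMatrix (fromBlocks M X Y N) =
      fromBlocks (φ.mapMatrix M) (X.map φ) (Y.map φ) (φ.mapMatrix N) := by
  simp [fromBlocks_map]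

theorem Inverts.upper_iff {M : Matrix m m A} (hM : Inverts φ M) (X : Matrix m n A)
    {N : Matrix n n A} : Inverts φ (fromBlocks M X 0 N) ↔ Inverts φ N := by
  rw [Inverts, mapMatrix_fromBlocks, Matrix.map_zero _ φ.map_zero, isUnit_fromBlocks_upper hM,
    Inverts]

theorem Inverts.lower_iff {M : Matrix m m A} (hM : Inverts φ M) (X : Matrix n m A)
    {N : Matrix n n A} : Inverts φ (fromBlocks M 0 X N) ↔ Inverts φ N := by
  rw [Inverts, mapMatrix_fromBlocks, Matrix.map_zero _ φ.map_zero, isUnit_fromBlocks_lower hM,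
    Inverts]

theorem inverts_submatrix_iff (e : m ≃ n) {M : Matrix n n A} :
    Inverts φ (M.submatrix e e) ↔ Inverts φ M := by
  rw [Inverts, Inverts, ← isUnit_submatrix_equiv_iff e (M := φ.mapMatrix M)]
  rfl

end Inverted

/-- An invariant with values in `K` of the square matrices over `A` that become invertible over
`D`, which is additive on products and on block triangular matrices. -/
structure DetInvariant {A : Type*} [Ring A] {D : Type*} [Ring D] (φ : A →+* D) (K : Type*)
    [AddCommGroup K] where
  /-- The value on a matrix; irrelevant outside the matrices inverted by `φ`. -/
  toFun : ∀ {ι : Type} [Fintype ι] [DecidableEq ι], Matrix ι ι A → K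
  map_mul : ∀ {ι : Type} [Fintype ι] [DecidableEq ι] {M N : Matrix ι ι A}, Inverts φ M →
    Inverts φ N → toFun (M * N) = toFun M + toFun N
  map_upper : ∀ {ι κ : Type} [Fintype ι] [DecidableEq ι] [Fintype κ] [DecidableEq κ]
    {M : Matrix ι ι A} (X : Matrix ι κ A) {N : Matrix κ κ A}, Inverts φ M → Inverts φ N →
    toFun (fromBlocks M X 0 N) = toFun M + toFun N
  map_submatrix : ∀ {ι κ : Type} [Fintype ι] [DecidableEq ι] [Fintype κ] [DecidableEq κ]
    (e : ι ≃ κ) {M : Matrix κ κ A}, Inverts φ M → toFun (M.submatrix e e) = toFun M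

namespace DetInvariant

variable {A : Type*} [Ring A] {D : Type*} [Ring D] {φ : A →+* D} {K : Type*} [AddCommGroup K]
  (χ : DetInvariant φ K) {ι κ : Type} [Fintype ι] [DecidableEq ι] [Fintype κ] [DecidableEq κ]

theorem map_one : χ.toFun (1 : Matrix ι ι A) = 0 := by
  have h := χ.map_mul (M := (1 : Matrix ι ι A)) (N := 1) .one .one
  rw [mul_one] at h
  exact left_eq_add.1 h

/-- Exchanging the two index blocks turns lower triangular into upper triangular; the order of the
summands is immaterial because `K` is commutative. -/
theorem map_lower {M : Matrix ι ι A} (X : Matrix κ ι A) {N : Matrix κ κ A} (hM : Inverts φ M)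
    (hN : Inverts φ N) : χ.toFun (fromBlocks M 0 X N) = χ.toFun M + χ.toFun N := by
  have h := χ.map_submatrix (Equiv.sumComm ι κ) ((hN.upper_iff X).2 hM)
  rw [χ.map_upper X hN hM, add_comm] at h
  rw [← h]
  congr 1
  ext (i | i) (j | j) <;> rfl

theorem map_one_lower (X : Matrix κ ι A) :
    χ.toFun (fromBlocks (1 : Matrix ι ι A) 0 X (1 : Matrix κ κ A)) = 0 := by
  rw [χ.map_lower X .one .one, χ.map_one, χ.map_one, add_zero]

theorem map_one_upper (X : Matrix ι κ A) :
    χ.toFun (fromBlocks (1 : Matrix ι ι A) X 0 (1 : Matrix κ κ A)) = 0 := by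
  rw [χ.map_upper X .one .one, χ.map_one, χ.map_one, add_zero]

open Classical in
/-- The invariant as a partial function, undefined on matrices that `φ` does not invert. -/
noncomputable def partialFun (M : Matrix ι ι A) : Option K :=
  if Inverts φ M then some (χ.toFun M) else none

variable {χ}

/-- Being undefined is treated as one more value. Invertibility and the value of the invariant can
thus be transported together, without a case distinction at every use. -/
theorem partialFun_eq {M : Matrix ι ι A} {N : Matrix κ κ A} {k : K}
    (h : Inverts φ M ↔ Inverts φ N) (h' : Inverts φ M → Inverts φ N →
      χ.toFun M = χ.toFun N + k) : χ.partialFun M = (χ.partialFun N).map (· + k) := by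
  classical
  rw [partialFun, partialFun]
  by_cases hM : Inverts φ M
  · rw [if_pos hM, if_pos (h.1 hM), h' hM (h.1 hM)]; rfl
  · rw [if_neg hM, if_neg (mt h.2 hM)]; rfl

theorem partialFun_lower {M : Matrix ι ι A} (X : Matrix κ ι A) {N : Matrix κ κ A}
    (hM : Inverts φ M) :
    χ.partialFun (fromBlocks M 0 X N) = (χ.partialFun N).map (· + χ.toFun M) :=
  partialFun_eq (hM.lower_iff X) fun _ h => by rw [χ.map_lower X hM h, add_comm]

theorem partialFun_upper {M : Matrix ι ι A} (X : Matrix ι κ A) {N : Matrix κ κ A}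
    (hM : Inverts φ M) :
    χ.partialFun (fromBlocks M X 0 N) = (χ.partialFun N).map (· + χ.toFun M) :=
  partialFun_eq (hM.upper_iff X) fun _ h => by rw [χ.map_upper X hM h, add_comm]

theorem partialFun_submatrix (e : ι ≃ κ) (M : Matrix κ κ A) :
    χ.partialFun (M.submatrix e e) = χ.partialFun M := by
  rw [partialFun_eq (k := 0) (inverts_submatrix_iff e) fun _ h => by
    rw [χ.map_submatrix e h, add_zero]]
  simp

theorem partialFun_one_lower_mul (X : Matrix κ ι A) (M : Matrix (ι ⊕ κ) (ι ⊕ κ) A) :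
    χ.partialFun (fromBlocks 1 0 X 1 * M) = χ.partialFun M := by
  have h : Inverts φ (fromBlocks (1 : Matrix ι ι A) 0 X (1 : Matrix κ κ A)) :=
    .of_isUnit (isUnit_fromBlocks_one_lower X)
  rw [partialFun_eq (k := 0) h.mul_iff_left fun _ h' => by
    rw [χ.map_mul h h', χ.map_one_lower, zero_add, add_zero]]
  simp

theorem partialFun_mul_one_lower (X : Matrix κ ι A) (M : Matrix (ι ⊕ κ) (ι ⊕ κ) A) :
    χ.partialFun (M * fromBlocks 1 0 X 1) = χ.partialFun M := by
  have h : Inverts φ (fromBlocks (1 : Matrix ι ι A) 0 X (1 : Matrix κ κ A)) :=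
    .of_isUnit (isUnit_fromBlocks_one_lower X)
  rw [partialFun_eq (k := 0) h.mul_iff_right fun _ h' => by
    rw [χ.map_mul h' h, χ.map_one_lower]]
  simp

end DetInvariant

end L2

/-! ### Formal fractions `f s⁻¹ x` and equivalence under all contexts -/

namespace L2

open Matrix

/-- A triple `(f, s, x)` of matrices over `A`, with `s` invertible over `D`, standing for the
matrix `f s⁻¹ x` over `D`. -/
structure Triple {A : Type*} [Ring A] {D : Type*} [Ring D] (φ : A →+* D) (κ κ' : Type) where
  /-- The index set of `s`. -/
  ι : Type
  [fintype : Fintype ι]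
  [decEq : DecidableEq ι]
  /-- The numerator on the left. -/
  f : Matrix κ ι A
  /-- The denominator. -/
  s : Matrix ι ι A
  /-- The numerator on the right. -/
  x : Matrix ι κ' A
  inverts : Inverts φ s

attribute [instance] Triple.fintype Triple.decEq

namespace Triple

variable {A : Type*} [Ring A] {D : Type*} [Ring D] {φ : A →+* D} {K : Type*} [AddCommGroup K]
  (χ : DetInvariant φ K) {κ κ' κ'' : Type} [Fintype κ] [Fintype κ'] [Fintype κ'']

/-- The matrix over `A` whose Schur complement is `M + r f s⁻¹ x c`. -/
abbrev ctx (α : Triple φ κ κ') {μ : Type} (M : Matrix μ μ A) (r : Matrix μ κ A)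
    (c : Matrix κ' μ A) : Matrix (α.ι ⊕ μ) (α.ι ⊕ μ) A :=
  fromBlocks α.s (α.x * c) (-(r * α.f)) M

/-- The invariant of the matrix `M + r f s⁻¹ x c`. -/
noncomputable def value (α : Triple φ κ κ') {μ : Type} [Fintype μ] [DecidableEq μ]
    (M : Matrix μ μ A) (r : Matrix μ κ A) (c : Matrix κ' μ A) : Option K :=
  (χ.partialFun (α.ctx M r c)).map (· - χ.toFun α.s)

/-- Two triples are equivalent if they cannot be distinguished by the invariant. -/
def Equivalent (α β : Triple φ κ κ') : Prop :=
  ∀ (μ : Type) [Fintype μ] [DecidableEq μ] (M : Matrix μ μ A) (r : Matrix μ κ A)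
    (c : Matrix κ' μ A), α.value χ M r c = β.value χ M r c

theorem _root_.Option.map_sub_eq_of_map_add_eq {K : Type*} [AddCommGroup K] {a b : Option K}
    {k l : K} (h : a.map (· + l) = b.map (· + k)) : a.map (· - k) = b.map (· - l) := by
  cases a <;> cases b <;> simp at h ⊢
  rw [sub_eq_sub_iff_add_eq_add, h]

variable {χ}

/-- A morphism of triples is an equivalence. -/
theorem equivalent_of_hom {α β : Triple φ κ κ'} (p q : Matrix α.ι β.ι A)
    (hs : α.s * p = q * β.s) (hf : α.f * p = β.f) (hx : q * β.x = α.x) :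
    α.Equivalent χ β := by
  intro μ _ _ M r c
  refine Option.map_sub_eq_of_map_add_eq ?_
  -- With `α = (f, s, x)` and `β = (f', t, y)`, this is `[[t, 0, yc], [0, s, xc], [0, -rf, M]]`.
  -- Read as block triangular it yields the context of `α` and `t`. Elementary operations with `p`
  -- and `q` will turn it into a matrix that yields the context of `β` and `s`.
  set W : Matrix (β.ι ⊕ (α.ι ⊕ μ)) (β.ι ⊕ (α.ι ⊕ μ)) A :=
    fromBlocks β.s (fromCols 0 (β.x * c)) 0 (α.ctx M r c) with hW
  have h1 : χ.partialFun W = (χ.partialFun (α.ctx M r c)).map (· + χ.toFun β.s) :=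
    DetInvariant.partialFun_upper _ β.inverts
  have h2 : χ.partialFun (fromBlocks 1 0 (fromRows (-q) 0) 1 *
      (W * fromBlocks 1 0 (fromRows p 0) 1)) = χ.partialFun W := by
    rw [DetInvariant.partialFun_one_lower_mul, DetInvariant.partialFun_mul_one_lower]
  -- The second block column times `p` is added to the first, and `q` times the first block row is
  -- subtracted from the second. The three morphism equations make the result `[[t, 0, yc], [0, s,
  -- 0], [-rf', -rf, M]]`, which is lower triangular once the first two blocks are exchanged.
  have h3 : fromBlocks 1 0 (fromRows (-q) 0) 1 * (W * fromBlocks 1 0 (fromRows p 0) 1) =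
      (fromBlocks α.s 0 (fromRows 0 (-(r * α.f))) (β.ctx M r c)).submatrix
        ((Equiv.sumAssoc β.ι α.ι μ).symm.trans
          (((Equiv.sumComm β.ι α.ι).sumCongr (Equiv.refl μ)).trans (Equiv.sumAssoc α.ι β.ι μ)))
        ((Equiv.sumAssoc β.ι α.ι μ).symm.trans
          (((Equiv.sumComm β.ι α.ι).sumCongr (Equiv.refl μ)).trans (Equiv.sumAssoc α.ι β.ι μ)))
      := by
    have e : fromBlocks 1 0 (fromRows (-q) 0) 1 * (W * fromBlocks 1 0 (fromRows p 0) 1) =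
      fromBlocks β.s (fromCols 0 (β.x * c)) (fromRows 0 (-(r * β.f)))
        (fromBlocks α.s 0 (-(r * α.f)) M) := by
      simp only [hW, fromBlocks_multiply, ctx, fromBlocks_mul_fromRows, fromCols_mul_fromRows,
        fromRows_mul]
      simp only [Matrix.one_mul, Matrix.mul_one, Matrix.zero_mul, Matrix.mul_zero, add_zero,
        zero_add, Matrix.neg_mul, Matrix.mul_assoc, hf, hs, ← hx]
      congr 1
      · ext (i | i) j <;> simp
      · ext (i | i) (j | j) <;> simp
    rw [e]
    ext (i | i | i) (j | j | j) <;> rfl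
  rw [← h1, ← h2, h3, DetInvariant.partialFun_submatrix,
    DetInvariant.partialFun_lower _ α.inverts]

variable (χ) in
theorem equivalence : Equivalence (Equivalent χ (κ := κ) (κ' := κ')) where
  refl _ _ _ _ _ _ _ := rfl
  symm h μ _ _ M r c := (h μ M r c).symm
  trans h h' μ _ _ M r c := (h μ M r c).trans (h' μ M r c)

/-- The triple for a sum. -/
abbrev add (α β : Triple φ κ κ') : Triple φ κ κ' where
  ι := α.ι ⊕ β.ι
  f := fromCols α.f β.f
  s := fromBlocks α.s 0 0 β.s
  x := fromRows α.x β.x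
  inverts := (α.inverts.upper_iff 0).2 β.inverts

/-- The triple for a product. -/
abbrev mul (α : Triple φ κ κ') (β : Triple φ κ' κ'') : Triple φ κ κ'' where
  ι := α.ι ⊕ β.ι
  f := fromCols α.f 0
  s := fromBlocks α.s (-(α.x * β.f)) 0 β.s
  x := fromRows 0 β.x
  inverts := (α.inverts.upper_iff _).2 β.inverts

/-- The triple for the negative. -/
abbrev neg (α : Triple φ κ κ') : Triple φ κ κ' where
  ι := α.ι
  f := -α.f
  s := α.s
  x := α.x
  inverts := α.inverts

variable (φ κ κ') in
/-- The triple for zero. -/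
abbrev zero : Triple φ κ κ' where
  ι := Empty
  f := 0
  s := 1
  x := 0
  inverts := .one

/-- The triple for a matrix over `A`. -/
abbrev ofMatrix [DecidableEq κ'] (a : Matrix κ κ' A) : Triple φ κ κ' where
  ι := κ'
  f := a
  s := 1
  x := 1
  inverts := .one

/-- The triple for `a f s⁻¹ x b`. -/
abbrev sandwich {ν ν' : Type} (a : Matrix ν κ A) (α : Triple φ κ κ')
    (b : Matrix κ' ν' A) : Triple φ ν ν' where
  ι := α.ι
  f := a * α.f
  s := α.s
  x := α.x * b
  inverts := α.inverts

theorem map_map_sub {K : Type*} [AddCommGroup K] (a : Option K) {k l m : K} (h : m = k + l) :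
    (a.map (· - k)).map (· - l) = a.map (· - m) := by
  cases a <;> simp [h, sub_sub]

/-- Reassociating the blocks absorbs `β` into the surrounding matrix: a context for the sum is a
context for `α` alone. This is why equivalence is defined by quantifying over all contexts. -/
theorem value_add (α β : Triple φ κ κ') {μ : Type} [Fintype μ] [DecidableEq μ]
    (M : Matrix μ μ A) (r : Matrix μ κ A) (c : Matrix κ' μ A) :
    (α.add β).value χ M r c = (α.value χ (β.ctx M r c) (fromRows 0 r) (fromCols 0 c)).map
      (· - χ.toFun β.s) := by
  rw [value, value, map_map_sub _ (χ.map_upper 0 α.inverts β.inverts),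
    ← DetInvariant.partialFun_submatrix (Equiv.sumAssoc α.ι β.ι μ)]
  congr 2
  dsimp only [ctx, add]
  simp only [fromRows_mul, mul_fromCols]
  ext ((i | i) | i) ((j | j) | j) <;> simp

/-- Here the right factor becomes part of the context. The companion `value_mul_right` absorbs the
left factor, and together they make the product respect equivalence in each argument. -/
theorem value_mul_left (α : Triple φ κ κ') (β : Triple φ κ' κ'') {μ : Type} [Fintype μ]
    [DecidableEq μ] (M : Matrix μ μ A) (r : Matrix μ κ A) (c : Matrix κ'' μ A) :
    (α.mul β).value χ M r c = (α.value χ (fromBlocks β.s (β.x * c) 0 M) (fromRows 0 r)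
      (fromCols (-β.f) 0)).map (· - χ.toFun β.s) := by
  rw [value, value, map_map_sub _ (χ.map_upper _ α.inverts β.inverts),
    ← DetInvariant.partialFun_submatrix (Equiv.sumAssoc α.ι β.ι μ)]
  congr 2
  dsimp only [ctx, mul]
  simp only [fromRows_mul, mul_fromCols]
  ext ((i | i) | i) ((j | j) | j) <;> simp

theorem value_mul_right (α : Triple φ κ κ') (β : Triple φ κ' κ'') {μ : Type} [Fintype μ]
    [DecidableEq μ] (M : Matrix μ μ A) (r : Matrix μ κ A) (c : Matrix κ'' μ A) :
    (α.mul β).value χ M r c = (β.value χ (fromBlocks α.s 0 (-(r * α.f)) M) (fromRows α.x 0)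
      (fromCols 0 c)).map (· - χ.toFun α.s) := by
  rw [value, value, map_map_sub _ ((χ.map_upper (-(α.x * β.f)) α.inverts β.inverts).trans (add_comm _ _)),
    ← DetInvariant.partialFun_submatrix ((Equiv.sumAssoc β.ι α.ι μ).symm.trans
          (((Equiv.sumComm β.ι α.ι).sumCongr (Equiv.refl μ))))]
  congr 2
  dsimp only [ctx, mul]
  simp only [fromRows_mul, mul_fromCols]
  ext (i | i | i) (j | j | j) <;> simp

theorem value_sandwich {ν ν' : Type} [Fintype ν] [Fintype ν'] (a : Matrix ν κ A)
    (α : Triple φ κ κ') (b : Matrix κ' ν' A) {μ : Type} [Fintype μ] [DecidableEq μ]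
    (M : Matrix μ μ A) (r : Matrix μ ν A) (c : Matrix ν' μ A) :
    (α.sandwich a b).value χ M r c = α.value χ M (r * a) (b * c) := by
  dsimp only [value, ctx, sandwich]
  rw [Matrix.mul_assoc α.x, ← Matrix.mul_assoc r]

theorem equivalent_mk_of_hom {ι ι' : Type} [Fintype ι] [DecidableEq ι] [Fintype ι']
    [DecidableEq ι'] {f : Matrix κ ι A} {s : Matrix ι ι A} {x : Matrix ι κ' A} {h : Inverts φ s}
    {f' : Matrix κ ι' A} {s' : Matrix ι' ι' A} {x' : Matrix ι' κ' A} {h' : Inverts φ s'}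
    (p q : Matrix ι ι' A) (hs : s * p = q * s') (hf : f * p = f') (hx : q * x' = x) :
    Equivalent χ ⟨ι, f, s, x, h⟩ ⟨ι', f', s', x', h'⟩ :=
  equivalent_of_hom (α := ⟨ι, f, s, x, h⟩) (β := ⟨ι', f', s', x', h'⟩) p q hs hf hx

theorem equivalent_mk_of_equiv {ι ι' : Type} [Fintype ι] [DecidableEq ι] [Fintype ι']
    [DecidableEq ι'] {f : Matrix κ ι A} {s : Matrix ι ι A} {x : Matrix ι κ' A} {h : Inverts φ s}
    {f' : Matrix κ ι' A} {s' : Matrix ι' ι' A} {x' : Matrix ι' κ' A} {h' : Inverts φ s'}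
    (e : ι ≃ ι') (hs : s = s'.submatrix e e) (hf : f = f'.submatrix _root_.id e)
    (hx : x = x'.submatrix e _root_.id) :
    Equivalent χ ⟨ι, f, s, x, h⟩ ⟨ι', f', s', x', h'⟩ := by
  refine equivalent_mk_of_hom ((1 : Matrix ι' ι' A).submatrix e _root_.id)
    ((1 : Matrix ι' ι' A).submatrix e _root_.id) ?_ ?_ ?_
  · rw [hs, ← submatrix_mul _ _ _ _ _ e.bijective, Matrix.mul_one,
      ← submatrix_id_id s', ← submatrix_mul _ _ _ _ _ Function.bijective_id]
    simp
  · rw [hf, ← submatrix_mul _ _ _ _ _ e.bijective, Matrix.mul_one, submatrix_id_id]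
  · rw [hx, ← submatrix_id_id x', ← submatrix_mul _ _ _ _ _ Function.bijective_id]
    simp

theorem add_congr {α α' β β' : Triple φ κ κ'} (h : α.Equivalent χ α') (h' : β.Equivalent χ β') :
    (α.add β).Equivalent χ (α'.add β') := by
  -- `value_add` varies only the first summand; commutativity transfers this to the second.
  have hc : ∀ a b : Triple φ κ κ', (a.add b).Equivalent χ (b.add a) := fun a b => by
    refine equivalent_mk_of_equiv (Equiv.sumComm _ _) ?_ ?_ ?_
    · ext (i | i) (j | j) <;> rfl
    · ext i (j | j) <;> rfl
    · ext (i | i) j <;> rfl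
  have key : ∀ {a a' b : Triple φ κ κ'}, a.Equivalent χ a' →
      (a.add b).Equivalent χ (a'.add b) := fun h μ _ _ M r c => by
    rw [value_add, value_add, h]
  exact (equivalence χ).trans (key h) ((equivalence χ).trans (hc _ _)
    ((equivalence χ).trans (key h') (hc _ _)))

theorem mul_congr {α α' : Triple φ κ κ'} {β β' : Triple φ κ' κ''} (h : α.Equivalent χ α')
    (h' : β.Equivalent χ β') : (α.mul β).Equivalent χ (α'.mul β') := by
  intro μ _ _ M r c
  rw [value_mul_left, h, ← value_mul_left, value_mul_right, h', ← value_mul_right]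

theorem sandwich_congr {ν ν' : Type} [Fintype ν] [Fintype ν'] (a : Matrix ν κ A)
    {α β : Triple φ κ κ'} (b : Matrix κ' ν' A) (h : α.Equivalent χ β) :
    (α.sandwich a b).Equivalent χ (β.sandwich a b) := by
  intro μ _ _ M r c
  rw [value_sandwich, value_sandwich, h]

theorem neg_congr {α β : Triple φ κ κ'} (h : α.Equivalent χ β) :
    α.neg.Equivalent χ β.neg := by
  intro μ _ _ M r c
  have key : ∀ a : Triple φ κ κ', a.neg.value χ M r c = a.value χ M (-r) c := fun a => by
    dsimp only [value, ctx, neg]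
    rw [Matrix.mul_neg, Matrix.neg_mul]
  rw [key, key, h]

section Axioms

variable (α : Triple φ κ κ')

theorem add_comm_equiv (β : Triple φ κ κ') : (α.add β).Equivalent χ (β.add α) := by
  refine equivalent_mk_of_equiv (Equiv.sumComm _ _) ?_ ?_ ?_
  · ext (i | i) (j | j) <;> rfl
  · ext i (j | j) <;> rfl
  · ext (i | i) j <;> rfl

theorem add_assoc_equiv (β γ : Triple φ κ κ') :
    ((α.add β).add γ).Equivalent χ (α.add (β.add γ)) := by
  refine equivalent_mk_of_equiv (Equiv.sumAssoc _ _ _) ?_ ?_ ?_ <;> dsimp only [add]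
  · ext ((i | i) | i) ((j | j) | j) <;> simp
  · ext i ((j | j) | j) <;> simp
  · ext ((i | i) | i) j <;> simp

theorem mul_assoc_equiv {κ''' : Type} [Fintype κ'''] (β : Triple φ κ' κ'')
    (γ : Triple φ κ'' κ''') : ((α.mul β).mul γ).Equivalent χ (α.mul (β.mul γ)) := by
  refine equivalent_mk_of_equiv (Equiv.sumAssoc _ _ _) ?_ ?_ ?_ <;> dsimp only [mul]
  · simp only [fromRows_mul, mul_fromCols]
    ext ((i | i) | i) ((j | j) | j) <;> simp
  · ext i ((j | j) | j) <;> simp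
  · ext ((i | i) | i) j <;> simp

theorem zero_add_equiv : ((zero φ κ κ').add α).Equivalent χ α := by
  refine equivalent_mk_of_equiv (Equiv.emptySum Empty _) ?_ ?_ ?_
  · ext (i | i) (j | j) <;> first | exact i.elim | exact j.elim | rfl
  · ext i (j | j) <;> first | exact j.elim | rfl
  · ext (i | i) j <;> first | exact i.elim | rfl

/-- The empty matrices form a morphism from the zero triple to `α`: every equation with rows indexed
by `Empty` is vacuous, and the one left says that `f` vanishes. -/
theorem equivalent_zero (h : α.f = 0) : α.Equivalent χ (zero φ κ κ') := by
  refine (equivalence χ).symm (equivalent_mk_of_hom 0 0 ?_ ?_ ?_)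
  · ext i; exact i.elim
  · rw [h, Matrix.mul_zero]
  · ext i; exact i.elim

/-- Both summands have the same `s` and `x`, so folding the two copies of the index set onto one is
a morphism that adds the left numerators to `-f + f`. -/
theorem neg_add_equiv : (α.neg.add α).Equivalent χ (zero φ κ κ') := by
  refine (equivalence χ).trans (y := ⟨α.ι, 0, α.s, α.x, α.inverts⟩)
    (equivalent_mk_of_hom (fromRows 1 1) (fromRows 1 1) ?_ ?_ ?_) (equivalent_zero _ rfl) <;>
    dsimp only [neg]
  · simp [fromBlocks_mul_fromRows, fromRows_mul]
  · simp [fromCols_mul_fromRows]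
  · simp [fromRows_mul]

/-- Additivity in the left numerator. -/
theorem mk_add_left_equiv {ι : Type} [Fintype ι] [DecidableEq ι] (f f' : Matrix κ ι A)
    (s : Matrix ι ι A) (x : Matrix ι κ' A) (h : Inverts φ s) :
    (Triple.add ⟨ι, f, s, x, h⟩ ⟨ι, f', s, x, h⟩).Equivalent χ ⟨ι, f + f', s, x, h⟩ := by
  refine equivalent_mk_of_hom (fromRows 1 1) (fromRows 1 1) ?_ ?_ ?_
  · simp [fromBlocks_mul_fromRows, fromRows_mul]
  · simp [fromCols_mul_fromRows]
  · simp [fromRows_mul]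

/-- Additivity in the right numerator. -/
theorem mk_add_right_equiv {ι : Type} [Fintype ι] [DecidableEq ι] (f : Matrix κ ι A)
    (s : Matrix ι ι A) (x x' : Matrix ι κ' A) (h : Inverts φ s) :
    (Triple.add ⟨ι, f, s, x, h⟩ ⟨ι, f, s, x', h⟩).Equivalent χ ⟨ι, f, s, x + x', h⟩ := by
  refine (equivalence χ).symm (equivalent_mk_of_hom (fromCols 1 1) (fromCols 1 1) ?_ ?_ ?_)
  · simp [fromCols_mul_fromBlocks, mul_fromCols]
  · simp [mul_fromCols]
  · simp [fromCols_mul_fromRows]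

/-- The morphism duplicates the block of `α`, which occurs once on the left and twice on the right,
and is the identity on the blocks of `β` and `γ`. -/
theorem mul_add_equiv (β γ : Triple φ κ' κ'') :
    (α.mul (β.add γ)).Equivalent χ ((α.mul β).add (α.mul γ)) := by
  refine equivalent_mk_of_hom
    (fromBlocks (fromCols 1 0) (fromCols 1 0) (fromBlocks 0 1 0 0) (fromBlocks 0 0 0 1))
    (fromBlocks (fromCols 1 0) (fromCols 1 0) (fromBlocks 0 1 0 0) (fromBlocks 0 0 0 1))
    ?_ ?_ ?_ <;> dsimp only [mul, add]
  · simp only [fromBlocks_multiply, mul_fromCols, fromCols_mul_fromBlocks, fromBlocks_mul_fromRows,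
      fromCols_mul_fromRows, fromRows_mul]
    ext (i | i | i) ((j | j) | (j | j)) <;> simp [fromBlocks_mul_fromRows, fromCols_mul_fromBlocks]
  · simp only [fromBlocks_multiply, mul_fromCols, fromCols_mul_fromBlocks, fromBlocks_mul_fromRows,
      fromCols_mul_fromRows, fromRows_mul]
    ext i ((j | j) | (j | j)) <;> simp [fromBlocks_mul_fromRows, fromCols_mul_fromBlocks]
  · simp only [fromBlocks_multiply, mul_fromCols, fromCols_mul_fromBlocks, fromBlocks_mul_fromRows,
      fromCols_mul_fromRows, fromRows_mul]
    ext (i | i | i) j <;> simp [fromBlocks_mul_fromRows, fromCols_mul_fromBlocks]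

/-- Dual to `mul_add_equiv`: the two copies of the block of `γ` are folded onto one. -/
theorem add_mul_equiv (β : Triple φ κ κ') (γ : Triple φ κ' κ'') :
    ((α.mul γ).add (β.mul γ)).Equivalent χ ((α.add β).mul γ) := by
  refine equivalent_mk_of_hom
    (fromBlocks (fromBlocks 1 0 0 0) (fromRows 0 1) (fromBlocks 0 1 0 0) (fromRows 0 1))
    (fromBlocks (fromBlocks 1 0 0 0) (fromRows 0 1) (fromBlocks 0 1 0 0) (fromRows 0 1))
    ?_ ?_ ?_ <;> dsimp only [mul, add]
  · simp only [fromBlocks_multiply, mul_fromCols, fromCols_mul_fromBlocks, fromBlocks_mul_fromRows,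
      fromCols_mul_fromRows, fromRows_mul]
    ext ((i | i) | (i | i)) ((j | j) | j) <;> simp [fromBlocks_mul_fromRows, fromCols_mul_fromBlocks]
  · simp only [fromBlocks_multiply, mul_fromCols, fromCols_mul_fromBlocks, fromBlocks_mul_fromRows,
      fromCols_mul_fromRows, fromRows_mul]
    ext i ((j | j) | j) <;> simp [fromBlocks_mul_fromRows, fromCols_mul_fromBlocks]
  · simp only [fromBlocks_multiply, mul_fromCols, fromCols_mul_fromBlocks, fromBlocks_mul_fromRows,
      fromCols_mul_fromRows, fromRows_mul]
    ext ((i | i) | (i | i)) j <;> simp [fromBlocks_mul_fromRows, fromCols_mul_fromBlocks]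

theorem ofMatrix_mul_equiv {ν : Type} [Fintype ν] [DecidableEq κ] (a : Matrix ν κ A) :
    ((ofMatrix a).mul α).Equivalent χ ⟨α.ι, a * α.f, α.s, α.x, α.inverts⟩ := by
  refine equivalent_mk_of_hom (fromRows α.f 1) (fromRows 0 1) ?_ ?_ ?_ <;> dsimp only [ofMatrix]
  · simp [fromBlocks_mul_fromRows, fromRows_mul]
  · simp [fromCols_mul_fromRows]
  · simp [fromRows_mul]

theorem mul_ofMatrix_equiv {ν : Type} [Fintype ν] [DecidableEq ν] (a : Matrix κ' ν A) :
    (α.mul (ofMatrix a)).Equivalent χ ⟨α.ι, α.f, α.s, α.x * a, α.inverts⟩ := by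
  refine (equivalence χ).symm (equivalent_mk_of_hom (fromCols 1 0) (fromCols 1 (α.x * a))
    ?_ ?_ ?_) <;> dsimp only [ofMatrix]
  · simp [fromCols_mul_fromBlocks, mul_fromCols]
  · simp [mul_fromCols]
  · simp [fromCols_mul_fromRows]

/-- Cancellation of the denominator on the left. -/
theorem mk_cancel_left_equiv [DecidableEq κ'] {ι : Type} [Fintype ι] [DecidableEq ι]
    (f : Matrix κ ι A) (s : Matrix ι ι A) (x : Matrix ι κ' A) (h : Inverts φ s) :
    Equivalent χ ⟨ι, f * s, s, x, h⟩ (ofMatrix (f * x)) := by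
  -- The fraction `f 1⁻¹ x` mediates. The denominator `s` gives a morphism from it to `(fs) s⁻¹ x`,
  -- and `x` gives one from it to `(fx) 1⁻¹ 1`.
  refine (equivalence χ).trans (y := ⟨ι, f, 1, x, .one⟩)
    ((equivalence χ).symm (equivalent_mk_of_hom s 1 ?_ ?_ ?_)) (equivalent_mk_of_hom x x ?_ ?_ ?_)
    <;> simp

/-- Cancellation of the denominator on the right. -/
theorem mk_cancel_right_equiv [DecidableEq κ'] {ι : Type} [Fintype ι] [DecidableEq ι]
    (f : Matrix κ ι A) (s : Matrix ι ι A) (x : Matrix ι κ' A) (h : Inverts φ s) :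
    Equivalent χ ⟨ι, f, s, s * x, h⟩ (ofMatrix (f * x)) := by
  refine (equivalence χ).trans (y := ⟨ι, f, 1, x, .one⟩)
    (equivalent_mk_of_hom 1 s ?_ ?_ ?_) (equivalent_mk_of_hom x x ?_ ?_ ?_)
    <;> simp

theorem ofMatrix_add_equiv [DecidableEq κ'] (a b : Matrix κ κ' A) :
    ((ofMatrix (φ := φ) a).add (ofMatrix b)).Equivalent χ (ofMatrix (a + b)) :=
  mk_add_left_equiv a b 1 1 .one

end Axioms

end Triple

end L2

/-! ### The ring of classes of triples -/

namespace L2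

open Matrix

section LocRing

variable {A : Type*} [Ring A] {D : Type*} [Ring D] {φ : A →+* D} {K : Type*} [AddCommGroup K]

/-- The triples up to equivalence. -/
def LocRing (χ : DetInvariant φ K) (κ : Type) [Fintype κ] : Type _ :=
  Quotient (⟨Triple.Equivalent χ (κ := κ) (κ' := κ), Triple.equivalence χ⟩ : Setoid _)

namespace LocRing

variable (χ : DetInvariant φ K) {κ : Type} [Fintype κ]

/-- The class of a triple. -/
def mk (α : Triple φ κ κ) : LocRing χ κ := Quotient.mk _ α

variable {χ}

theorem mk_eq_iff {α β : Triple φ κ κ} : mk χ α = mk χ β ↔ α.Equivalent χ β :=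
  ⟨fun h => Quotient.exact h, fun h => Quotient.sound h⟩

theorem ind {p : LocRing χ κ → Prop} (h : ∀ α, p (mk χ α)) (a : LocRing χ κ) : p a :=
  Quotient.ind h a

instance : Add (LocRing χ κ) := ⟨Quotient.map₂ Triple.add fun _ _ h _ _ h' => Triple.add_congr h h'⟩
instance : Mul (LocRing χ κ) := ⟨Quotient.map₂ Triple.mul fun _ _ h _ _ h' => Triple.mul_congr h h'⟩
instance : Neg (LocRing χ κ) := ⟨Quotient.map Triple.neg fun _ _ h => Triple.neg_congr h⟩
instance : Zero (LocRing χ κ) := ⟨mk χ (Triple.zero φ κ κ)⟩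
instance [DecidableEq κ] : One (LocRing χ κ) := ⟨mk χ (Triple.ofMatrix 1)⟩

theorem mk_add (α β : Triple φ κ κ) : mk χ (α.add β) = mk χ α + mk χ β := rfl
theorem mk_one [DecidableEq κ] : mk χ (Triple.ofMatrix (1 : Matrix κ κ A)) = 1 := rfl

instance : AddCommGroup (LocRing χ κ) where
  add_assoc a b c := by
    induction a using ind; induction b using ind; induction c using ind
    exact mk_eq_iff.2 (Triple.add_assoc_equiv _ _ _)
  add_comm a b := by
    induction a using ind; induction b using ind
    exact mk_eq_iff.2 (Triple.add_comm_equiv _ _)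
  zero_add a := by
    induction a using ind
    exact mk_eq_iff.2 (Triple.zero_add_equiv _)
  add_zero a := by
    induction a using ind
    exact mk_eq_iff.2 ((Triple.equivalence χ).trans (Triple.add_comm_equiv _ _)
      (Triple.zero_add_equiv _))
  neg_add_cancel a := by
    induction a using ind
    exact mk_eq_iff.2 (Triple.neg_add_equiv _)
  nsmul := nsmulRec
  zsmul := zsmulRec

theorem ofMatrix_mul_mk [DecidableEq κ] (a : Matrix κ κ A) (α : Triple φ κ κ) :
    mk χ (Triple.ofMatrix a) * mk χ α = mk χ ⟨α.ι, a * α.f, α.s, α.x, α.inverts⟩ :=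
  mk_eq_iff.2 (Triple.ofMatrix_mul_equiv α a)

theorem mk_mul_ofMatrix [DecidableEq κ] (α : Triple φ κ κ) (a : Matrix κ κ A) :
    mk χ α * mk χ (Triple.ofMatrix a) = mk χ ⟨α.ι, α.f, α.s, α.x * a, α.inverts⟩ :=
  mk_eq_iff.2 (Triple.mul_ofMatrix_equiv α a)

instance [DecidableEq κ] : Ring (LocRing χ κ) where
  __ := (inferInstance : AddCommGroup (LocRing χ κ))
  mul_assoc a b c := by
    induction a using ind; induction b using ind; induction c using ind
    exact mk_eq_iff.2 (Triple.mul_assoc_equiv _ _ _)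
  one_mul a := by
    induction a using ind with | h α
    rw [← mk_one, ofMatrix_mul_mk]; simp only [Matrix.one_mul]
  mul_one a := by
    induction a using ind with | h α
    rw [← mk_one, mk_mul_ofMatrix]; simp only [Matrix.mul_one]
  left_distrib a b c := by
    induction a using ind; induction b using ind; induction c using ind
    exact mk_eq_iff.2 (Triple.mul_add_equiv _ _ _)
  right_distrib a b c := by
    induction a using ind; induction b using ind; induction c using ind
    exact mk_eq_iff.2 ((Triple.equivalence χ).symm (Triple.add_mul_equiv _ _ _))
  zero_mul a := by
    induction a using ind with | h α
    refine mk_eq_iff.2 (Triple.equivalent_zero _ ?_)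
    ext i (j | j)
    · exact j.elim
    · rfl
  mul_zero a := by
    induction a using ind with | h α
    -- The empty block of the zero triple is dropped first, leaving `(f, s, 0)`. Additivity in the
    -- right numerator makes the class of this triple equal to its own double, hence zero.
    refine mk_eq_iff.2 ((Triple.equivalence χ).trans (y := ⟨α.ι, α.f, α.s, 0, α.inverts⟩)
      ((Triple.equivalence χ).symm ?_) ?_)
    · exact Triple.equivalent_of_hom (α := ⟨α.ι, α.f, α.s, 0, α.inverts⟩)
        (β := α.mul (Triple.zero φ κ κ)) (fromCols 1 0) (fromCols 1 0)
        (by simp [fromCols_mul_fromBlocks, mul_fromCols]) (by simp [mul_fromCols])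
        (by simp [fromCols_mul_fromRows])
    · have h := Triple.mk_add_right_equiv (χ := χ) α.f α.s (0 : Matrix α.ι κ A) 0 α.inverts
      rw [add_zero, ← mk_eq_iff, mk_add] at h
      exact mk_eq_iff.1 ((add_eq_left (a := mk χ (⟨α.ι, α.f, α.s, 0, α.inverts⟩ : Triple φ κ κ))).1 h)

/-- The class of `(f, s, x)` as an additive map of `f`. -/
def mkLeft {ι : Type} [Fintype ι] [DecidableEq ι] {s : Matrix ι ι A} (h : Inverts φ s)
    (x : Matrix ι κ A) : Matrix κ ι A →+ LocRing χ κ :=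
  AddMonoidHom.mk' (fun f => mk χ ⟨ι, f, s, x, h⟩) fun f f' =>
    (mk_eq_iff.2 (Triple.mk_add_left_equiv f f' s x h)).symm

/-- The class of `(f, s, x)` as an additive map of `x`. -/
def mkRight {ι : Type} [Fintype ι] [DecidableEq ι] {s : Matrix ι ι A} (h : Inverts φ s)
    (f : Matrix κ ι A) : Matrix ι κ A →+ LocRing χ κ :=
  AddMonoidHom.mk' (fun x => mk χ ⟨ι, f, s, x, h⟩) fun x x' =>
    (mk_eq_iff.2 (Triple.mk_add_right_equiv f s x x' h)).symm

variable (χ) in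
/-- The ring homomorphism from matrices over `A`. -/
def ofMatrixHom [DecidableEq κ] : Matrix κ κ A →+* LocRing χ κ where
  toFun a := mk χ (Triple.ofMatrix a)
  map_one' := rfl
  map_mul' a b := (ofMatrix_mul_mk a (Triple.ofMatrix b)).symm
  map_zero' := mk_eq_iff.2 (Triple.equivalent_zero _ rfl)
  map_add' a b := (mk_eq_iff.2 (Triple.ofMatrix_add_equiv a b)).symm

variable (χ) in
/-- The ring homomorphism from `A`. -/
def of : A →+* LocRing χ Unit := (ofMatrixHom χ).comp (Matrix.scalar Unit)

theorem of_mul_mk (a : A) (α : Triple φ Unit Unit) :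
    of χ a * mk χ α = mk χ ⟨α.ι, Matrix.scalar Unit a * α.f, α.s, α.x, α.inverts⟩ :=
  ofMatrix_mul_mk _ α

theorem mk_mul_of (a : A) (α : Triple φ Unit Unit) :
    mk χ α * of χ a = mk χ ⟨α.ι, α.f, α.s, α.x * Matrix.scalar Unit a, α.inverts⟩ :=
  mk_mul_ofMatrix α _

variable (χ) in
/-- The inverse of the image of `s`. -/
def invMatrix {ι : Type} [Fintype ι] [DecidableEq ι] {s : Matrix ι ι A} (h : Inverts φ s) :
    Matrix ι ι (LocRing χ Unit) :=
  fun i j => mk χ ⟨ι, Matrix.single () i (1 : A), s, Matrix.single j () (1 : A), h⟩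

theorem ofMatrix_single_mul_single {ι : Type} [Fintype ι] [DecidableEq ι] (i k : ι) :
    mk χ (Triple.ofMatrix (Matrix.single () i (1 : A) * Matrix.single k () (1 : A))) =
      (1 : Matrix ι ι (LocRing χ Unit)) i k := by
  rw [Matrix.one_apply]
  split_ifs with h
  · subst h
    rw [Matrix.single_mul_single_same, ← mk_one]
    congr 2
    ext; simp
  · rw [Matrix.single_mul_single_of_ne (h := h)]
    exact (ofMatrixHom χ).map_zero

/-- The entry is a sum of triples with the same `f` and `s`, so additivity collects it into one
triple with right numerator `s e_k`. There the denominator cancels and `e_i e_k` remains. -/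
theorem invMatrix_mul {ι : Type} [Fintype ι] [DecidableEq ι] {s : Matrix ι ι A}
    (h : Inverts φ s) : invMatrix χ h * (of χ).mapMatrix s = 1 := by
  ext i k
  rw [Matrix.mul_apply]
  have h2 : ∀ j, invMatrix χ h i j * (of χ).mapMatrix s j k =
      mkRight h (Matrix.single () i (1 : A)) (Matrix.single j () (1 : A) * Matrix.scalar Unit (s j k)) :=
    fun j => mk_mul_of (s j k) ⟨ι, Matrix.single () i 1, s, Matrix.single j () 1, h⟩
  simp only [h2]
  rw [← map_sum]
  have h3 : ∑ j, Matrix.single j () (1 : A) * Matrix.scalar Unit (s j k) = s * Matrix.single k () (1 : A) := by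
    ext j
    simp [Matrix.sum_apply, Matrix.mul_apply, Matrix.single_apply]
  rw [h3]
  exact (mk_eq_iff.2 (Triple.mk_cancel_right_equiv _ s _ h)).trans (ofMatrix_single_mul_single i k)

theorem mul_invMatrix {ι : Type} [Fintype ι] [DecidableEq ι] {s : Matrix ι ι A}
    (h : Inverts φ s) : (of χ).mapMatrix s * invMatrix χ h = 1 := by
  ext i k
  rw [Matrix.mul_apply]
  have h2 : ∀ j, (of χ).mapMatrix s i j * invMatrix χ h j k =
      mkLeft h (Matrix.single k () (1 : A)) (Matrix.scalar Unit (s i j) * Matrix.single () j (1 : A)) :=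
    fun j => of_mul_mk (s i j) ⟨ι, Matrix.single () j 1, s, Matrix.single k () 1, h⟩
  simp only [h2]
  rw [← map_sum]
  have h3 : ∑ j, Matrix.scalar Unit (s i j) * Matrix.single () j (1 : A) = Matrix.single () i (1 : A) * s := by
    ext _ j
    simp [Matrix.sum_apply, Matrix.mul_apply, Matrix.single_apply]
  rw [h3]
  exact (mk_eq_iff.2 (Triple.mk_cancel_left_equiv _ s _ h)).trans (ofMatrix_single_mul_single i k)

theorem inverts_of {ι : Type} [Fintype ι] [DecidableEq ι] {s : Matrix ι ι A}
    (h : Inverts φ s) : Inverts (of χ) s :=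
  isUnit_of_two_sided _ (mul_invMatrix h) (invMatrix_mul h)

/-- Together with uniqueness of inverses, this formula determines the image of `f s⁻¹ x` under any
ring homomorphism from `D` that extends `of χ`. -/
theorem mk_eq_sum {ι : Type} [Fintype ι] [DecidableEq ι] {s : Matrix ι ι A}
    (h : Inverts φ s) (f : Matrix Unit ι A) (x : Matrix ι Unit A) :
    mk χ ⟨ι, f, s, x, h⟩ = ∑ j, (∑ i, of χ (f () i) * invMatrix χ h i j) * of χ (x j ()) := by
  have h1 : ∀ j, ∑ i, of χ (f () i) * invMatrix χ h i j =
      mk χ ⟨ι, f, s, Matrix.single j () (1 : A), h⟩ := by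
    intro j
    have h2 : ∀ i, of χ (f () i) * invMatrix χ h i j =
        mkLeft h (Matrix.single j () (1 : A)) (Matrix.scalar Unit (f () i) * Matrix.single () i (1 : A)) :=
      fun i => of_mul_mk (f () i) ⟨ι, Matrix.single () i 1, s, Matrix.single j () 1, h⟩
    simp only [h2]
    rw [← map_sum]
    have h3 : ∑ i, Matrix.scalar Unit (f () i) * Matrix.single () i (1 : A) = f := by
      ext _ j
      simp [Matrix.sum_apply, Matrix.mul_apply, Matrix.single_apply]
    rw [h3]; rfl
  simp only [h1]
  have h2 : ∀ j, mk χ ⟨ι, f, s, Matrix.single j () (1 : A), h⟩ * of χ (x j ()) =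
      mkRight h f (Matrix.single j () (1 : A) * Matrix.scalar Unit (x j ())) :=
    fun j => mk_mul_of (x j ()) ⟨ι, f, s, Matrix.single j () 1, h⟩
  simp only [h2]
  rw [← map_sum]
  have h3 : ∑ j, Matrix.single j () (1 : A) * Matrix.scalar Unit (x j ()) = x := by
    ext j
    simp [Matrix.sum_apply, Matrix.mul_apply, Matrix.single_apply]
  rw [h3]; rfl

/-- A matrix triple is determined by its entries. -/
theorem mk_eq_sum_sandwich [DecidableEq κ] (α : Triple φ κ κ) :
    mk χ α = ∑ i, ∑ j, mk χ ((α.sandwich (Matrix.single () i (1 : A)) (Matrix.single j () (1 : A))).sandwich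
      (Matrix.single i () (1 : A)) (Matrix.single () j (1 : A))) := by
  have h1 : ∀ i, ∑ j, mk χ ((α.sandwich (Matrix.single () i (1 : A)) (Matrix.single j () (1 : A))).sandwich
      (Matrix.single i () (1 : A)) (Matrix.single () j (1 : A))) =
      mkLeft α.inverts α.x (Matrix.single i () (1 : A) * (Matrix.single () i (1 : A) * α.f)) := by
    intro i
    have h2 : ∀ j, mk χ ((α.sandwich (Matrix.single () i (1 : A)) (Matrix.single j () (1 : A))).sandwich
      (Matrix.single i () (1 : A)) (Matrix.single () j (1 : A))) =
      mkRight α.inverts (Matrix.single i () (1 : A) * (Matrix.single () i (1 : A) * α.f))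
        (α.x * Matrix.single j () (1 : A) * Matrix.single () j (1 : A)) := fun j => rfl
    simp only [h2]
    rw [← map_sum]
    have h3 : ∑ j : κ, α.x * (Matrix.single j () (1 : A) : Matrix κ Unit A) * Matrix.single () j (1 : A) = α.x := by
      simp only [Matrix.mul_assoc, Matrix.single_mul_single_same, mul_one]
      rw [← Matrix.mul_sum]
      simp [Matrix.sum_single_one]
    rw [h3]; rfl
  simp only [h1]
  rw [← map_sum]
  have h3 : ∑ i : κ, Matrix.single i () (1 : A) * ((Matrix.single () i (1 : A) : Matrix Unit κ A) * α.f) = α.f := by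
    simp only [← Matrix.mul_assoc, Matrix.single_mul_single_same, mul_one]
    rw [← Matrix.sum_mul]
    simp [Matrix.sum_single_one]
  rw [h3]; rfl

end LocRing

end LocRing

end L2

/-! ### Values of triples over `D`, and extension of invariants to `GL_n(D)` -/

namespace L2

open Matrix

namespace Triple

variable {A : Type*} [Ring A] {D : Type*} [Ring D] {φ : A →+* D} {K : Type*} [AddCommGroup K]
  {κ κ' κ'' : Type} [Fintype κ] [Fintype κ'] [Fintype κ'']

/-- The solution `s⁻¹ x` of the linear system `s z = x` over `D`. -/
noncomputable def sol (α : Triple φ κ κ') : Matrix α.ι κ' D :=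
  Ring.inverse (φ.mapMatrix α.s) * α.x.map φ

/-- The matrix `f s⁻¹ x` over `D`. -/
noncomputable def eval (α : Triple φ κ κ') : Matrix κ κ' D := α.f.map φ * α.sol

theorem map_s_mul_sol (α : Triple φ κ κ') : α.s.map φ * α.sol = α.x.map φ := by
  have h : α.s.map φ * Ring.inverse (φ.mapMatrix α.s) = 1 :=
    Ring.mul_inverse_cancel _ α.inverts
  rw [sol, ← Matrix.mul_assoc, h, Matrix.one_mul]

theorem sol_eq {α : Triple φ κ κ'} {z : Matrix α.ι κ' D} (h : α.s.map φ * z = α.x.map φ) :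
    α.sol = z := by
  have h' : Ring.inverse (φ.mapMatrix α.s) * α.s.map φ = 1 :=
    Ring.inverse_mul_cancel _ α.inverts
  rw [sol, ← h, ← Matrix.mul_assoc, h', Matrix.one_mul]

theorem eval_eq {α : Triple φ κ κ'} (z : Matrix α.ι κ' D) (h : α.s.map φ * z = α.x.map φ) :
    α.eval = α.f.map φ * z := by
  rw [eval, sol_eq h]

theorem eval_add (α β : Triple φ κ κ') : (α.add β).eval = α.eval + β.eval := by
  rw [eval_eq (α := α.add β) (fromRows α.sol β.sol), eval, eval]
  · simp [fromCols_map, fromCols_mul_fromRows]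
  · simp [fromBlocks_map, fromRows_map, fromBlocks_mul_fromRows, map_s_mul_sol]

theorem eval_mul (α : Triple φ κ κ') (β : Triple φ κ' κ'') :
    (α.mul β).eval = α.eval * β.eval := by
  rw [eval_eq (α := α.mul β) (fromRows (α.sol * β.eval) β.sol)]
  · simp [fromCols_map, fromCols_mul_fromRows, eval, Matrix.mul_assoc]
  · simp only [fromBlocks_map, fromRows_map, fromBlocks_mul_fromRows, map_s_mul_sol,
      ← Matrix.mul_assoc]
    simp [Matrix.map_neg, Matrix.map_mul, eval, Matrix.mul_assoc]

theorem eval_sandwich {ν ν' : Type} [Fintype ν] [Fintype ν'] (a : Matrix ν κ A) (α : Triple φ κ κ')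
    (b : Matrix κ' ν' A) : (α.sandwich a b).eval = a.map φ * α.eval * b.map φ := by
  rw [eval_eq (α := α.sandwich a b) (α.sol * b.map φ)]
  · simp [eval, Matrix.mul_assoc, Matrix.map_mul]
  · simp [Matrix.map_mul, ← Matrix.mul_assoc, map_s_mul_sol]

theorem eval_ofMatrix [DecidableEq κ'] (a : Matrix κ κ' A) :
    (ofMatrix (φ := φ) a).eval = a.map φ := by
  rw [eval_eq (α := ofMatrix (φ := φ) a) 1]
  · simp
  · simp

/-- Block elimination over `D`: the value of the triple is the Schur complement of `s` in `[[s, x],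
[-f, 0]]`. Invertibility of the value, the formula for inverses and surjectivity on `K₁` all come
from this factorization. -/
theorem mapMatrix_ctx [DecidableEq κ] (α : Triple φ κ κ) :
    φ.mapMatrix (α.ctx (0 : Matrix κ κ A) 1 1) =
      fromBlocks (φ.mapMatrix α.s) 0 (-(α.f.map φ)) α.eval * fromBlocks 1 α.sol 0 1 := by
  rw [mapMatrix_fromBlocks]
  simp [fromBlocks_multiply, map_s_mul_sol, eval, Matrix.map_neg]

theorem inverts_ctx_iff [DecidableEq κ] (α : Triple φ κ κ) :
    Inverts φ (α.ctx (0 : Matrix κ κ A) 1 1) ↔ IsUnit α.eval := by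
  obtain ⟨u, hu⟩ := isUnit_fromBlocks_one_upper α.sol
  rw [Inverts, mapMatrix_ctx, ← hu, Units.isUnit_mul_units, isUnit_fromBlocks_lower α.inverts]

/-- The triple for the inverse of an invertible matrix. -/
abbrev inv [DecidableEq κ] (α : Triple φ κ κ) (h : IsUnit α.eval) : Triple φ κ κ where
  ι := α.ι ⊕ κ
  f := fromCols 0 1
  s := α.ctx (0 : Matrix κ κ A) 1 1
  x := fromRows 0 1
  inverts := α.inverts_ctx_iff.2 h

theorem eval_inv [DecidableEq κ] (α : Triple φ κ κ) (h : IsUnit α.eval) :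
    (α.inv h).eval = Ring.inverse α.eval := by
  have h1 := Ring.mul_inverse_cancel _ h
  -- The system to solve is `s z₁ + x z₂ = 0`, `-f z₁ = 1`. Its solution is `z₁ = -s⁻¹ x z₂` with
  -- `z₂ = (f s⁻¹ x)⁻¹`, and the left numerator `(0, 1)` reads off `z₂`.
  rw [eval_eq (α := α.inv h) (fromRows (-(α.sol * Ring.inverse α.eval)) (Ring.inverse α.eval))]
  · simp [fromCols_map, fromCols_mul_fromRows]
  · simp [fromBlocks_map, fromRows_map, fromBlocks_mul_fromRows, ← Matrix.mul_assoc,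
      map_s_mul_sol, Matrix.map_neg]
    rw [← eval, h1]

/-- The value of the invariant on `f s⁻¹ x`. -/
def detVal (χ : DetInvariant φ K) [DecidableEq κ] (α : Triple φ κ κ) : K :=
  χ.toFun (α.ctx (0 : Matrix κ κ A) 1 1) - χ.toFun α.s

variable {χ : DetInvariant φ K}

theorem detVal_eq_of_equivalent [DecidableEq κ] {α β : Triple φ κ κ} (h : α.Equivalent χ β)
    (hα : IsUnit α.eval) : α.detVal χ = β.detVal χ := by
  classical
  -- In this context the Schur complement is the value of the triple itself. Equivalence then also
  -- gives invertibility of the second context matrix, since one side is defined.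
  have h1 := h κ 0 1 1
  rw [value, value, DetInvariant.partialFun, if_pos (α.inverts_ctx_iff.2 hα),
    DetInvariant.partialFun] at h1
  split_ifs at h1 with h2
  · simpa [detVal] using h1
  · simp at h1

theorem detVal_ofMatrix [DecidableEq κ] {a : Matrix κ κ A} (ha : Inverts φ a) :
    (ofMatrix (φ := φ) a).detVal χ = χ.toFun a := by
  have e : (ofMatrix (φ := φ) a).ctx (0 : Matrix κ κ A) 1 1 = fromBlocks 1 0 (-a) 1 * fromBlocks 1 1 0 a := by
    simp [fromBlocks_multiply]
  rw [detVal, e, χ.map_mul (.of_isUnit (isUnit_fromBlocks_one_lower _))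
    ((Inverts.one.upper_iff _).2 ha), χ.map_one_lower, χ.map_upper _ .one ha, χ.map_one]
  simp

/-- For `α = (f, s, x)` and `β = (f', s', x')`, the context matrix `[[s, -xf', 0], [0, s', x'], [-f,
0, 0]]` of the product factors over `A` as `[[s, 0, x], [0, 1, 0], [-f, 0, 0]]` times `[[1, 0, 0],
[0, s', x'], [0, -f', 0]]`. Each factor is a context matrix enlarged by an identity block. -/
theorem detVal_mul [DecidableEq κ] {α β : Triple φ κ κ} (hα : IsUnit α.eval)
    (hβ : IsUnit β.eval) : (α.mul β).detVal χ = α.detVal χ + β.detVal χ := by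
  have iα := α.inverts_ctx_iff.2 hα
  have iβ := β.inverts_ctx_iff.2 hβ
  let e : (α.ι ⊕ β.ι) ⊕ κ ≃ β.ι ⊕ (α.ι ⊕ κ) :=
    ((Equiv.sumComm α.ι β.ι).sumCongr (Equiv.refl κ)).trans (Equiv.sumAssoc β.ι α.ι κ)
  set Z : Matrix (β.ι ⊕ (α.ι ⊕ κ)) (β.ι ⊕ (α.ι ⊕ κ)) A :=
    fromBlocks 1 0 0 (α.ctx (0 : Matrix κ κ A) 1 1) with hZ
  set W : Matrix (α.ι ⊕ (β.ι ⊕ κ)) (α.ι ⊕ (β.ι ⊕ κ)) A :=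
    fromBlocks 1 0 0 (β.ctx (0 : Matrix κ κ A) 1 1) with hW
  have hZi : Inverts φ Z := (Inverts.one.upper_iff _).2 iα
  have hWi : Inverts φ W := (Inverts.one.upper_iff _).2 iβ
  have h1 : (α.mul β).ctx (0 : Matrix κ κ A) 1 1 = Z.submatrix e e *
      W.submatrix (Equiv.sumAssoc α.ι β.ι κ) (Equiv.sumAssoc α.ι β.ι κ) := by
    have e1 : Z.submatrix e e = fromBlocks (fromBlocks α.s 0 0 1) (fromRows α.x 0)
        (fromCols (-α.f) 0) 0 := by
      ext ((i | i) | i) ((j | j) | j) <;> simp [hZ, e, Matrix.one_apply]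
    have e2 : W.submatrix (Equiv.sumAssoc α.ι β.ι κ) (Equiv.sumAssoc α.ι β.ι κ) =
        fromBlocks (fromBlocks 1 0 0 β.s) (fromRows 0 β.x) (fromCols 0 (-β.f)) 0 := by
      ext ((i | i) | i) ((j | j) | j) <;> simp [hW, Matrix.one_apply]
    rw [e1, e2]
    simp only [fromBlocks_multiply, fromBlocks_mul_fromRows, fromCols_mul_fromBlocks,
      fromRows_mul_fromCols, fromCols_mul_fromRows]
    ext ((i | i) | i) ((j | j) | j) <;> simp
  rw [detVal, h1, χ.map_mul ((inverts_submatrix_iff _).2 hZi) ((inverts_submatrix_iff _).2 hWi),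
    χ.map_submatrix _ hZi, χ.map_submatrix _ hWi, χ.map_upper _ .one iα, χ.map_upper _ .one iβ,
    χ.map_one, χ.map_one, χ.map_upper _ α.inverts β.inverts, detVal, detVal]
  abel

end Triple

section Universal

variable {A : Type*} [Ring A] {D : Type*} [Ring D] {φ : A →+* D} {K : Type*} [AddCommGroup K]
  {χ : DetInvariant φ K} {Ψ : D →+* LocRing χ Unit}
  {κ : Type} [Fintype κ] [DecidableEq κ]

theorem map_inverse_eq_invMatrix (hΨ : ∀ a, Ψ (φ a) = LocRing.of χ a) {ι : Type} [Fintype ι] [DecidableEq ι] {s : Matrix ι ι A}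
    (h : Inverts φ s) : Ψ.mapMatrix (Ring.inverse (φ.mapMatrix s)) = LocRing.invMatrix χ h := by
  have h1 : (LocRing.of χ).mapMatrix s * Ψ.mapMatrix (Ring.inverse (φ.mapMatrix s)) = 1 := by
    rw [← map_one Ψ.mapMatrix, ← Ring.mul_inverse_cancel _ h, map_mul]
    congr 1
    ext i j
    exact (hΨ _).symm
  rw [← one_mul (Ψ.mapMatrix _), ← LocRing.invMatrix_mul h, mul_assoc, h1, mul_one]

/-- The homomorphism `Ψ` preserves inverses of matrices, so it carries the expansion of `f s⁻¹ x`
over `D` to the expansion of the class in `mk_eq_sum`. -/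
theorem map_eval_eq_mk (hΨ : ∀ a, Ψ (φ a) = LocRing.of χ a)
    (α : Triple φ Unit Unit) : Ψ (α.eval () ()) = LocRing.mk χ α := by
  have h1 : ∀ i j, Ψ (Ring.inverse (φ.mapMatrix α.s) i j) = LocRing.invMatrix χ α.inverts i j :=
    fun i j => congrFun (congrFun (map_inverse_eq_invMatrix hΨ α.inverts) i) j
  rw [LocRing.mk_eq_sum, Triple.eval, Triple.sol, ← Matrix.mul_assoc, Matrix.mul_apply, map_sum]
  refine Finset.sum_congr rfl fun j _ => ?_
  rw [map_mul, Matrix.mul_apply, map_sum, Matrix.map_apply, hΨ]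
  congr 1
  refine Finset.sum_congr rfl fun i _ => ?_
  rw [map_mul, h1, Matrix.map_apply, hΨ]

/-- If `D` maps to the ring of triples, then triples with the same value are equivalent. -/
theorem equivalent_of_eval_eq (hΨ : ∀ a, Ψ (φ a) = LocRing.of χ a) {α β : Triple φ κ κ} (h : α.eval = β.eval) :
    α.Equivalent χ β := by
  rw [← LocRing.mk_eq_iff, LocRing.mk_eq_sum_sandwich α, LocRing.mk_eq_sum_sandwich β]
  refine Finset.sum_congr rfl fun i _ => Finset.sum_congr rfl fun j _ => ?_
  rw [LocRing.mk_eq_iff]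
  refine Triple.sandwich_congr _ _ ?_
  rw [← LocRing.mk_eq_iff, ← map_eval_eq_mk hΨ, ← map_eval_eq_mk hΨ, Triple.eval_sandwich,
    Triple.eval_sandwich, h]

end Universal

section Extension

variable {A : Type*} [Ring A] {D : Type*} [Ring D] {φ : A →+* D} {K : Type*} [AddCommGroup K]

theorem exists_eval_eq (hrep : ∀ d : D, ∃ α : Triple φ Unit Unit, α.eval () () = d)
    {κ : Type} [Fintype κ] [DecidableEq κ] (X : Matrix κ κ D) :
    ∃ α : Triple φ κ κ, α.eval = X := by
  rw [Matrix.matrix_eq_sum_single X]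
  refine Finset.sum_induction _ (fun X => ∃ α : Triple φ κ κ, α.eval = X) ?_ ?_ ?_
  · rintro _ _ ⟨α, rfl⟩ ⟨β, rfl⟩
    exact ⟨α.add β, Triple.eval_add α β⟩
  · exact ⟨Triple.ofMatrix 0, by rw [Triple.eval_ofMatrix]; simp⟩
  · intro i _
    refine Finset.sum_induction _ (fun X => ∃ α : Triple φ κ κ, α.eval = X) ?_ ?_ ?_
    · rintro _ _ ⟨α, rfl⟩ ⟨β, rfl⟩
      exact ⟨α.add β, Triple.eval_add α β⟩
    · exact ⟨Triple.ofMatrix 0, by rw [Triple.eval_ofMatrix]; simp⟩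
    · intro j _
      obtain ⟨α, hα⟩ := hrep (X i j)
      refine ⟨α.sandwich (Matrix.single i () 1) (Matrix.single () j 1), ?_⟩
      rw [Triple.eval_sandwich, ← hα]
      have : α.eval = Matrix.single () () (α.eval () ()) := by ext; simp
      rw [this]
      simp [Matrix.map_single]

/-- An invariant of the matrices over `A` extends to the invertible matrices over `D`. -/
theorem DetInvariant.exists_extension (χ : DetInvariant φ K)
    (hrep : ∀ d : D, ∃ α : Triple φ Unit Unit, α.eval () () = d)
    {Ψ : D →+* LocRing χ Unit} (hΨ : ∀ a, Ψ (φ a) = LocRing.of χ a)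
    (κ : Type) [Fintype κ] [DecidableEq κ] :
    ∃ V : (Matrix κ κ D)ˣ →* Multiplicative K, ∀ (a : Matrix κ κ A) (u : (Matrix κ κ D)ˣ),
      φ.mapMatrix a = u → V u = Multiplicative.ofAdd (χ.toFun a) := by
  -- A presentation is chosen for each unit. The choice does not matter, since
  -- `equivalent_of_eval_eq` makes any two presentations of the same matrix equivalent and `detVal`
  -- depends only on the class.
  choose τ hτ using fun u : (Matrix κ κ D)ˣ => exists_eval_eq hrep u.1
  have hu : ∀ u, IsUnit (τ u).eval := fun u => by rw [hτ]; exact u.isUnit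
  refine ⟨MonoidHom.mk' (fun u => Multiplicative.ofAdd ((τ u).detVal χ)) fun u v => ?_,
    fun a u h => ?_⟩
  · rw [← ofAdd_add, ← Triple.detVal_mul (hu u) (hu v), Triple.detVal_eq_of_equivalent
      (equivalent_of_eval_eq hΨ _) (hu (u * v))]
    rw [Triple.eval_mul, hτ, hτ, hτ, Units.val_mul]
  · have ha : Inverts φ a := by rw [Inverts, h]; exact u.isUnit
    rw [MonoidHom.mk'_apply, ← Triple.detVal_ofMatrix ha, Triple.detVal_eq_of_equivalent
      (equivalent_of_eval_eq hΨ _) (hu u)]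
    rw [hτ, Triple.eval_ofMatrix, ← h]; rfl

end Extension

end L2

/-! ### Base change of free modules, and `K₁` by generators and relations -/

namespace L2

open Matrix

namespace BaseChange

section Free

variable {A : Type*} [Ring A] {B : Type*} [Ring B] (φ : A →+* B) (ι : Type*) [Fintype ι]
  [DecidableEq ι]

/-- The map of row vectors induced by a ring homomorphism. -/
def rowMap : (ι → A) →ₛₗ[φ] (ι → B) where
  toFun v := φ ∘ v
  map_add' v w := by ext; simp
  map_smul' a v := by ext; simp

/-- The base change of the free module `Aⁿ` is `Bⁿ`. -/
noncomputable def piEquiv : BaseChange φ (ι → A) ≃ₗ[B] (ι → B) where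
  __ := lift φ (rowMap φ ι)
  invFun w := ∑ i, w i • tmul φ 1 (Pi.single i 1 : ι → A)
  left_inv := by
    let g : (ι → B) →ₗ[B] BaseChange φ (ι → A) :=
      { toFun := fun w => ∑ i, w i • tmul φ 1 (Pi.single i 1 : ι → A)
        map_add' := fun w w' => by simp [add_smul, Finset.sum_add_distrib]
        map_smul' := fun b w => by simp [mul_smul, Finset.smul_sum] }
    have h : g ∘ₗ lift φ (rowMap φ ι) = LinearMap.id := hom_ext φ fun v => by
      rw [LinearMap.comp_apply, lift_tmul, one_smul, LinearMap.id_apply]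
      change ∑ i, φ (v i) • tmul φ 1 (Pi.single i 1 : ι → A) = tmul φ 1 v
      have h1 : ∀ i, φ (v i) • tmul φ 1 (Pi.single i 1 : ι → A) = incl φ (v i • Pi.single i 1) :=
        fun i => ((incl φ).map_smulₛₗ (v i) (Pi.single i 1 : ι → A)).symm
      simp only [h1]
      rw [← map_sum]
      refine congrArg (incl φ) (funext fun j => ?_)
      simp [Pi.single_apply]
    exact fun z => LinearMap.congr_fun h z
  right_inv w := by
    change lift φ (rowMap φ ι) (∑ i, w i • tmul φ 1 (Pi.single i 1 : ι → A)) = w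
    simp only [map_sum, map_smul, lift_tmul, one_smul]
    ext j
    simp [rowMap, Pi.single_apply, apply_ite φ]

variable {ι}

theorem piEquiv_tmul (v : ι → A) : piEquiv φ ι (tmul φ 1 v) = φ ∘ v :=
  (lift_tmul φ (rowMap φ ι) 1 v).trans (one_smul _ _)

theorem piEquiv_map {κ : Type*} [Fintype κ] [DecidableEq κ] (M : Matrix ι κ A) :
    (piEquiv φ κ).toLinearMap ∘ₗ map φ M.vecMulLinear =
      (M.map φ).vecMulLinear ∘ₗ (piEquiv φ ι).toLinearMap := by
  refine hom_ext φ fun v => ?_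
  rw [LinearMap.comp_apply, map_tmul, LinearMap.comp_apply]
  change piEquiv φ κ _ = (M.map φ).vecMulLinear (piEquiv φ ι _)
  rw [piEquiv_tmul, piEquiv_tmul]
  ext j
  simp [Matrix.vecMul, dotProduct, map_sum]

theorem bijective_vecMulLinear_iff {M : Matrix ι ι A} :
    Function.Bijective M.vecMulLinear ↔ IsUnit M := by
  constructor
  · intro h
    let e := LinearEquiv.ofBijective M.vecMulLinear h
    obtain ⟨N, hN⟩ : ∃ N : Matrix ι ι A, N.vecMulLinear = (e.symm : (ι → A) →ₗ[A] (ι → A)) :=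
      ⟨LinearMap.toMatrixRight' (e.symm : (ι → A) →ₗ[A] (ι → A)),
        LinearMap.toMatrixRight'.symm_apply_apply _⟩
    have hinj : ∀ X Y : Matrix ι ι A, X.vecMulLinear = Y.vecMulLinear → X = Y := fun X Y h =>
      LinearMap.toMatrixRight'.symm.injective h
    refine isUnit_of_two_sided N (hinj _ _ ?_) (hinj _ _ ?_)
    · refine LinearMap.ext fun v => ?_
      have h1 : N.vecMulLinear (M.vecMulLinear v) = v := by
        rw [hN]; exact e.symm_apply_apply v
      simpa [Matrix.vecMul_vecMul] using h1
    · refine LinearMap.ext fun v => ?_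
      have h1 : M.vecMulLinear (N.vecMulLinear v) = v := by
        rw [hN]; exact e.apply_symm_apply v
      simpa [Matrix.vecMul_vecMul] using h1
  · rintro ⟨u, rfl⟩
    refine Function.bijective_iff_has_inverse.2
      ⟨Matrix.vecMulLinear (u⁻¹).1, fun x => ?_, fun x => ?_⟩
    · simp [Matrix.vecMul_vecMul]
    · simp [Matrix.vecMul_vecMul]

theorem bijective_map_vecMulLinear_iff {M : Matrix ι ι A} :
    Function.Bijective (map φ M.vecMulLinear) ↔ Inverts φ M := by
  have h := piEquiv_map φ M
  have h1 : Function.Bijective ((piEquiv φ ι).toLinearMap ∘ₗ map φ M.vecMulLinear) ↔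
      Function.Bijective (map φ M.vecMulLinear) := by
    rw [LinearMap.coe_comp]
    exact Function.Bijective.of_comp_iff' (piEquiv φ ι).bijective _
  have h2 : Function.Bijective ((M.map φ).vecMulLinear ∘ₗ (piEquiv φ ι).toLinearMap) ↔
      Function.Bijective (M.map φ).vecMulLinear := by
    rw [LinearMap.coe_comp]
    exact Function.Bijective.of_comp_iff _ (piEquiv φ ι).bijective
  rw [← h1, h, h2, bijective_vecMulLinear_iff]; rfl

end Free

end BaseChange

namespace K1Gen

variable {A : Type u} [Ring A] {W : FGProjEnd A → Prop}

theorem cls_comp {P : Type u} [AddCommGroup P] [Module A P] [Module.Finite A P]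
    [Module.Projective A P] {f g : P →ₗ[A] P} (hf : W ⟨P, f⟩) (hg : W ⟨P, g⟩)
    (hgf : W ⟨P, g ∘ₗ f⟩) : cls ⟨P, g ∘ₗ f⟩ hgf = cls ⟨P, g⟩ hg + cls ⟨P, f⟩ hf := by
  rw [cls, cls, cls, ← QuotientAddGroup.mk_add, ← sub_eq_zero, ← QuotientAddGroup.mk_sub,
    QuotientAddGroup.eq_zero_iff]
  exact AddSubgroup.subset_closure (K1Relator.comp P f g hf hg hgf)

theorem cls_exact {P₀ P₁ P₂ : Type u}
    [AddCommGroup P₀] [Module A P₀] [Module.Finite A P₀] [Module.Projective A P₀]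
    [AddCommGroup P₁] [Module A P₁] [Module.Finite A P₁] [Module.Projective A P₁]
    [AddCommGroup P₂] [Module A P₂] [Module.Finite A P₂] [Module.Projective A P₂]
    (i : P₀ →ₗ[A] P₁) (p : P₁ →ₗ[A] P₂) {f₀ : P₀ →ₗ[A] P₀} {f₁ : P₁ →ₗ[A] P₁}
    {f₂ : P₂ →ₗ[A] P₂} (hi : Function.Injective i) (hip : Function.Exact i p)
    (hp : Function.Surjective p) (h₀₁ : f₁ ∘ₗ i = i ∘ₗ f₀) (h₁₂ : f₂ ∘ₗ p = p ∘ₗ f₁)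
    (h₀ : W ⟨P₀, f₀⟩) (h₁ : W ⟨P₁, f₁⟩) (h₂ : W ⟨P₂, f₂⟩) :
    cls ⟨P₁, f₁⟩ h₁ = cls ⟨P₀, f₀⟩ h₀ + cls ⟨P₂, f₂⟩ h₂ := by
  rw [cls, cls, cls, ← QuotientAddGroup.mk_add, ← sub_eq_zero, ← QuotientAddGroup.mk_sub,
    QuotientAddGroup.eq_zero_iff]
  exact AddSubgroup.subset_closure
    (K1Relator.exact P₀ P₁ P₂ i p f₀ f₁ f₂ hi hip hp h₀₁ h₁₂ h₀ h₁ h₂)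

theorem cls_id {P : Type u} [AddCommGroup P] [Module A P] [Module.Finite A P]
    [Module.Projective A P] (h : W ⟨P, LinearMap.id⟩) : cls ⟨P, LinearMap.id⟩ h = 0 :=
  left_eq_add.1 (cls_comp h h h)

/-- An isomorphism is a short exact sequence with zero kernel, so invariance under conjugation is an
instance of the exactness relation. The condition on `PUnit` admits the zero module as first term.
-/
theorem cls_congr {P Q : Type u} [AddCommGroup P] [Module A P] [Module.Finite A P]
    [Module.Projective A P] [AddCommGroup Q] [Module A Q] [Module.Finite A Q]
    [Module.Projective A Q] (h0 : W ⟨PUnit, LinearMap.id⟩) (e : P ≃ₗ[A] Q) {f : P →ₗ[A] P}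
    {g : Q →ₗ[A] Q} (h : ∀ x, e (f x) = g (e x)) (hf : W ⟨P, f⟩) (hg : W ⟨Q, g⟩) :
    cls ⟨P, f⟩ hf = cls ⟨Q, g⟩ hg := by
  have := cls_exact (W := W) (0 : PUnit.{u + 1} →ₗ[A] P) (e : P →ₗ[A] Q) (f₀ := LinearMap.id)
    (Function.injective_of_subsingleton _)
    (fun x => by
      constructor
      · intro hx; exact ⟨0, (e.map_eq_zero_iff.1 hx).symm⟩
      · rintro ⟨_, rfl⟩; simp) e.surjective
    (LinearMap.ext fun x => by simp) (LinearMap.ext fun x => (h x).symm) h0 hf hg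
  rw [this, cls_id, zero_add]

theorem ind {p : K1Gen W → Prop} (hadd : ∀ x y, p x → p y → p (x + y)) (hneg : ∀ x, p x → p (-x))
    (h0 : p 0) (h : ∀ x hx, p (cls x hx)) (z : K1Gen W) : p z := by
  induction z using QuotientAddGroup.induction_on with | H z
  induction z using FreeAbelianGroup.induction_on with
  | zero => exact h0
  | of x => exact h x.1 x.2
  | neg x hx => exact hneg _ hx
  | add x y hx hy => exact hadd _ _ hx hy

/-- The homomorphism out of `K1Gen W` given by its values on the generators. -/
def lift {K : Type*} [AddCommGroup K] (v : ∀ x, W x → K)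
    (hcomp : ∀ (P : Type u) [AddCommGroup P] [Module A P] [Module.Finite A P]
      [Module.Projective A P] (f g : P →ₗ[A] P) (hf : W ⟨P, f⟩) (hg : W ⟨P, g⟩)
      (hgf : W ⟨P, g ∘ₗ f⟩), v ⟨P, g ∘ₗ f⟩ hgf = v ⟨P, g⟩ hg + v ⟨P, f⟩ hf)
    (hexact : ∀ (P₀ P₁ P₂ : Type u)
      [AddCommGroup P₀] [Module A P₀] [Module.Finite A P₀] [Module.Projective A P₀]
      [AddCommGroup P₁] [Module A P₁] [Module.Finite A P₁] [Module.Projective A P₁]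
      [AddCommGroup P₂] [Module A P₂] [Module.Finite A P₂] [Module.Projective A P₂]
      (i : P₀ →ₗ[A] P₁) (p : P₁ →ₗ[A] P₂) (f₀ : P₀ →ₗ[A] P₀) (f₁ : P₁ →ₗ[A] P₁)
      (f₂ : P₂ →ₗ[A] P₂) (_ : Function.Injective i) (_ : Function.Exact i p)
      (_ : Function.Surjective p) (_ : f₁ ∘ₗ i = i ∘ₗ f₀) (_ : f₂ ∘ₗ p = p ∘ₗ f₁)
      (h₀ : W ⟨P₀, f₀⟩) (h₁ : W ⟨P₁, f₁⟩) (h₂ : W ⟨P₂, f₂⟩),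
      v ⟨P₁, f₁⟩ h₁ = v ⟨P₀, f₀⟩ h₀ + v ⟨P₂, f₂⟩ h₂) : K1Gen W →+ K :=
  QuotientAddGroup.lift _ (FreeAbelianGroup.lift fun x : {x : FGProjEnd A // W x} => v x.1 x.2) (by
    rw [AddSubgroup.closure_le]
    intro z hz
    change FreeAbelianGroup.lift (fun x : {x : FGProjEnd A // W x} => v x.1 x.2) z = 0
    induction hz with
    | comp P f g hf hg hgf =>
      rw [map_sub, map_add, FreeAbelianGroup.lift_apply_of, FreeAbelianGroup.lift_apply_of,
        FreeAbelianGroup.lift_apply_of]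
      rw [hcomp P f g hf hg hgf, sub_self]
    | exact P₀ P₁ P₂ i p f₀ f₁ f₂ hi hip hp h₀₁ h₁₂ h₀ h₁ h₂ =>
      rw [map_sub, map_add, FreeAbelianGroup.lift_apply_of, FreeAbelianGroup.lift_apply_of,
        FreeAbelianGroup.lift_apply_of]
      rw [hexact P₀ P₁ P₂ i p f₀ f₁ f₂ hi hip hp h₀₁ h₁₂ h₀ h₁ h₂, sub_self])

section Matrices

variable {D : Type*} [Ring D] {φ : A →+* D}

open Classical in
/-- The classes of the square matrices in `K1Gen W`, as an invariant. -/
noncomputable def detInvariant (h0 : W ⟨PUnit, LinearMap.id⟩)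
    (hW : ∀ {ι : Type} [Fintype ι] [DecidableEq ι] (M : Matrix ι ι A), Inverts φ M →
      W ⟨ι → A, M.vecMulLinear⟩) : DetInvariant φ (K1Gen W) where
  toFun M := if h : Inverts φ M then cls ⟨_, M.vecMulLinear⟩ (hW M h) else 0
  map_mul {ι _ _ M N} hM hN := by
    rw [dif_pos hM, dif_pos hN, dif_pos (hM.mul hN)]
    -- Row vectors are multiplied from the right, so the order of composition is reversed; this is
    -- harmless in a commutative group.
    have e : (M * N).vecMulLinear = N.vecMulLinear ∘ₗ M.vecMulLinear := by
      exact LinearMap.ext fun v => by simp [Matrix.vecMul_vecMul]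
    have h := hW _ (hM.mul hN)
    rw [e] at h
    rw [add_comm, ← cls_comp (hW M hM) (hW N hN) h]
    simp only [e]
  map_upper {ι κ _ _ _ _ M} X {N} hM hN := by
    rw [dif_pos hM, dif_pos hN, dif_pos ((hM.upper_iff X).2 hN), add_comm]
    -- For row vectors `(v, w) ↦ (vM, vX + wN)`. The invariant submodule is therefore the second
    -- block, with `N` acting, and `M` acts on the quotient.
    let i : (κ → A) →ₗ[A] ((ι ⊕ κ) → A) :=
      { toFun := fun w => (Sum.elim (fun _ => (0 : A)) w : ι ⊕ κ → A)
        map_add' := fun v w => by ext (j | j) <;> simp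
        map_smul' := fun a w => by ext (j | j) <;> simp }
    refine cls_exact i (LinearMap.funLeft A A Sum.inl) ?_ ?_ ?_ ?_ ?_ _ _ _
    · exact fun v w h => funext fun j => congrFun h (Sum.inr j)
    · intro v
      constructor
      · intro hv
        refine ⟨v ∘ Sum.inr, funext ?_⟩
        rintro (j | j)
        · exact (congrFun hv j).symm
        · rfl
      · rintro ⟨w, rfl⟩; rfl
    · exact fun v => ⟨Sum.elim v 0, rfl⟩
    · refine LinearMap.ext fun w => ?_
      change Matrix.vecMul (Sum.elim (0 : ι → A) w) _ = Sum.elim (0 : ι → A) (Matrix.vecMul w N)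
      rw [Matrix.vecMul_fromBlocks]
      simp
    · refine LinearMap.ext fun w => ?_
      change Matrix.vecMul (w ∘ Sum.inl) M = (Matrix.vecMul w _) ∘ Sum.inl
      rw [Matrix.vecMul_fromBlocks]
      simp
  map_submatrix {ι κ _ _ _ _} e {M} hM := by
    rw [dif_pos hM, dif_pos ((inverts_submatrix_iff e).2 hM)]
    refine cls_congr h0 (LinearEquiv.funCongrLeft A A e.symm) (fun v => ?_) _ _
    ext j
    simp only [LinearEquiv.funCongrLeft_apply, LinearMap.funLeft_apply, Matrix.vecMulLinear_apply,
      Matrix.vecMul, dotProduct, Matrix.submatrix_apply, Equiv.apply_symm_apply]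
    exact (e.symm.sum_comp _).symm.trans (by simp)

variable {h0 : W ⟨PUnit, LinearMap.id⟩} {hW : ∀ {ι : Type} [Fintype ι] [DecidableEq ι]
  (M : Matrix ι ι A), Inverts φ M → W ⟨ι → A, M.vecMulLinear⟩}

theorem detInvariant_apply {ι : Type} [Fintype ι] [DecidableEq ι] {M : Matrix ι ι A}
    (hM : Inverts φ M) : (detInvariant (φ := φ) h0 hW).toFun M = cls ⟨_, M.vecMulLinear⟩ (hW M hM) :=
  dif_pos hM

end Matrices

end K1Gen

end L2

/-! ### Identities between block units -/

namespace L2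

open Matrix

section BlockGroup

variable {D : Type*} [Ring D] {κ ι : Type*} [Fintype κ] [DecidableEq κ] [Fintype ι] [DecidableEq ι]

/-- The unit `[[1, μ], [0, 1]]`. -/
def upperUnit (μ : Matrix κ ι D) : (Matrix (κ ⊕ ι) (κ ⊕ ι) D)ˣ where
  val := fromBlocks 1 μ 0 1
  inv := fromBlocks 1 (-μ) 0 1
  val_inv := by simp [fromBlocks_multiply]
  inv_val := by simp [fromBlocks_multiply]

/-- The unit `[[1, 0], [γ, 1]]`. -/
def lowerUnit (γ : Matrix ι κ D) : (Matrix (κ ⊕ ι) (κ ⊕ ι) D)ˣ where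
  val := fromBlocks 1 0 γ 1
  inv := fromBlocks 1 0 (-γ) 1
  val_inv := by simp [fromBlocks_multiply]
  inv_val := by simp [fromBlocks_multiply]

/-- The unit `[[b, 0], [0, s]]`. -/
def diagUnit (b : (Matrix κ κ D)ˣ) (s : (Matrix ι ι D)ˣ) : (Matrix (κ ⊕ ι) (κ ⊕ ι) D)ˣ where
  val := fromBlocks b 0 0 s
  inv := fromBlocks (b⁻¹).1 0 0 (s⁻¹).1
  val_inv := by simp [fromBlocks_multiply]
  inv_val := by simp [fromBlocks_multiply]

theorem upperUnit_mul (μ ν : Matrix κ ι D) :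
    upperUnit μ * upperUnit ν = upperUnit (μ + ν) :=
  Units.ext (by simp [upperUnit, fromBlocks_multiply, add_comm])

theorem lowerUnit_mul (μ ν : Matrix ι κ D) :
    lowerUnit μ * lowerUnit ν = lowerUnit (μ + ν) :=
  Units.ext (by simp [lowerUnit, fromBlocks_multiply])

theorem diagUnit_mul (b b' : (Matrix κ κ D)ˣ) (s s' : (Matrix ι ι D)ˣ) :
    diagUnit b s * diagUnit b' s' = diagUnit (b * b') (s * s') :=
  Units.ext (by simp [diagUnit, fromBlocks_multiply])

theorem upperUnit_zero : upperUnit (0 : Matrix κ ι D) = 1 :=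
  Units.ext (by simp [upperUnit])

theorem lowerUnit_zero : lowerUnit (0 : Matrix ι κ D) = 1 :=
  Units.ext (by simp [lowerUnit])

theorem diagUnit_one : diagUnit (1 : (Matrix κ κ D)ˣ) (1 : (Matrix ι ι D)ˣ) = 1 :=
  Units.ext (by simp [diagUnit])

theorem diagUnit_mul_upperUnit (b : (Matrix κ κ D)ˣ) (s : (Matrix ι ι D)ˣ) (μ : Matrix κ ι D) :
    diagUnit b s * upperUnit μ = upperUnit (b.1 * μ * (s⁻¹).1) * diagUnit b s :=
  Units.ext (by simp [diagUnit, upperUnit, fromBlocks_multiply, Matrix.mul_assoc])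

theorem diagUnit_mul_lowerUnit (b : (Matrix κ κ D)ˣ) (s : (Matrix ι ι D)ˣ) (γ : Matrix ι κ D) :
    diagUnit b s * lowerUnit γ = lowerUnit (s.1 * γ * (b⁻¹).1) * diagUnit b s :=
  Units.ext (by simp [diagUnit, lowerUnit, fromBlocks_multiply, Matrix.mul_assoc])

/-- If `1 - λ γ` is invertible, then so is `1 - γ λ`. -/
def swapUnit (γ : Matrix ι κ D) (l : Matrix κ ι D) (u : (Matrix κ κ D)ˣ) (hu : u.1 = 1 - l * γ) :
    (Matrix ι ι D)ˣ where
  val := 1 - γ * l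
  inv := 1 + γ * (u⁻¹).1 * l
  val_inv := by
    have h : γ * (u.1 * (u⁻¹).1) * l = γ * l := by rw [Units.mul_inv, Matrix.mul_one]
    rw [hu] at h
    rw [Matrix.mul_add, Matrix.mul_one, ← sub_eq_zero, ← sub_eq_zero.2 h]
    simp only [Matrix.sub_mul, Matrix.mul_sub, Matrix.one_mul, Matrix.mul_assoc]
    abel
  inv_val := by
    have h : γ * ((u⁻¹).1 * u.1) * l = γ * l := by rw [Units.inv_mul, Matrix.mul_one]
    rw [hu] at h
    rw [Matrix.add_mul, Matrix.one_mul, ← sub_eq_zero, ← sub_eq_zero.2 h]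
    simp only [Matrix.sub_mul, Matrix.mul_sub, Matrix.mul_one, Matrix.mul_assoc]
    abel

/-- This moves a lower unit past an upper one at the price of the diagonal factor `diag(u⁻¹, w)`
with `u = 1 - lγ` and `w = 1 - γl`. A block determinant invariant under both kinds of unit must
therefore take equal values on `u` and `w`. -/
theorem lowerUnit_mul_upperUnit (γ : Matrix ι κ D) (l : Matrix κ ι D) (u : (Matrix κ κ D)ˣ)
    (hu : u.1 = 1 - l * γ) : lowerUnit γ * upperUnit (-l) =
      upperUnit (-(l * ((swapUnit γ l u hu)⁻¹).1)) * lowerUnit (γ * u.1) *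
        diagUnit u⁻¹ (swapUnit γ l u hu) := by
  set w := swapUnit γ l u hu
  have hw : w.1 = 1 - γ * l := rfl
  have hwi : (w⁻¹).1 = 1 + γ * (u⁻¹).1 * l := rfl
  -- This is what the upper left corner requires, since the product on the right has `u⁻¹ - l w⁻¹ γ`
  -- there and the product on the left has `1`.
  have h1 : l * (w⁻¹).1 * γ = (u⁻¹).1 - 1 := by
    have e : (u⁻¹).1 * (l * γ) = (u⁻¹).1 - 1 := by
      rw [← u.inv_mul, hu]
      simp only [Matrix.mul_sub, Matrix.mul_one]
      abel_nf
    have e' : l * γ * (u⁻¹).1 = (u⁻¹).1 - 1 := by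
      have : l * γ = 1 - u.1 := by rw [hu]; abel
      rw [this, Matrix.sub_mul, Matrix.one_mul, u.mul_inv]
    calc l * (w⁻¹).1 * γ = l * γ + l * γ * (u⁻¹).1 * (l * γ) := by
          rw [hwi, Matrix.mul_add, Matrix.add_mul, Matrix.mul_one]
          simp only [Matrix.mul_assoc]
      _ = l * γ + ((u⁻¹).1 - 1) * (l * γ) := by rw [e']
      _ = (u⁻¹).1 - 1 := by rw [Matrix.sub_mul, e, Matrix.one_mul]; abel
  apply Units.ext
  simp only [Units.val_mul, lowerUnit, upperUnit, diagUnit, fromBlocks_multiply]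
  rw [fromBlocks_inj]
  refine ⟨?_, ?_, ?_, ?_⟩
  · simp only [Matrix.one_mul, Matrix.mul_zero, Matrix.zero_mul, Matrix.mul_one, add_zero,
      Matrix.neg_mul, Matrix.add_mul, zero_add, Matrix.mul_assoc, u.mul_inv]
    rw [← Matrix.mul_assoc, h1]
    abel
  · simp [Matrix.mul_assoc]
  · simp [Matrix.mul_assoc]
  · simp [hw, sub_eq_add_neg, add_comm]

end BlockGroup

end L2

/-! ### Gluing determinants of two blocks -/

namespace L2

open Matrix

section BlockDet

variable {D : Type*} [Ring D] {κ ι : Type*} [Fintype κ] [DecidableEq κ] [Fintype ι] [DecidableEq ι]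
  {Γ : Type*} [CommGroup Γ]

/-- Two factorizations of one matrix have diagonal parts that differ by some `1 - νγ` in the first
block and the matching `1 - γν` in the second, up to inversion. The exchange property makes the two
changes cancel, so a value can be read off any factorization. -/
theorem blockDet_unique {δ : (Matrix κ κ D)ˣ →* Γ} {det : (Matrix ι ι D)ˣ →* Γ}
    (hswap : ∀ (γ : Matrix ι κ D) (l : Matrix κ ι D) (u : (Matrix κ κ D)ˣ)
      (hu : u.1 = 1 - l * γ), det (swapUnit γ l u hu) = δ u)
    {μ μ' : Matrix κ ι D} {y y' : Matrix ι κ D} {b b' : (Matrix κ κ D)ˣ} {s s' : (Matrix ι ι D)ˣ}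
    {z z' : Matrix κ ι D}
    (h : upperUnit μ * lowerUnit y * diagUnit b s * upperUnit z =
      upperUnit μ' * lowerUnit y' * diagUnit b' s' * upperUnit z') :
    δ b * det s = δ b' * det s' := by
  -- Only the differences of the outer upper factors matter, so the second factorization may be
  -- taken without them.
  have h1 : upperUnit (μ - μ') * lowerUnit y * diagUnit b s * upperUnit (z - z') =
      lowerUnit y' * diagUnit b' s' := by
    have e1 : upperUnit (μ - μ') = (upperUnit μ')⁻¹ * upperUnit μ := by
      rw [eq_inv_mul_iff_mul_eq, upperUnit_mul, add_sub_cancel]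
    have e2 : upperUnit (z - z') = upperUnit z * (upperUnit z')⁻¹ := by
      rw [eq_mul_inv_iff_mul_eq, upperUnit_mul, sub_add_cancel]
    rw [e1, e2, ← mul_assoc, mul_inv_eq_iff_eq_mul, mul_assoc, mul_assoc, mul_assoc,
      inv_mul_eq_iff_eq_mul]
    simpa only [mul_assoc] using h
  generalize μ - μ' = ν at h1
  generalize z - z' = ζ at h1
  have h2 := congrArg Units.val h1
  simp only [Units.val_mul, lowerUnit, upperUnit, diagUnit, fromBlocks_multiply, Matrix.one_mul,
    Matrix.mul_one, Matrix.mul_zero, Matrix.zero_mul, add_zero, zero_add] at h2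
  rw [fromBlocks_inj] at h2
  obtain ⟨h11, h12, -, h22⟩ := h2
  have hu : (b' * b⁻¹).1 = 1 + ν * y := by
    rw [Units.val_mul, ← h11, mul_assoc, b.mul_inv, mul_one]
  have hu' : ((b' * b⁻¹)⁻¹).1 = 1 - ν * (y * ((b' * b⁻¹)⁻¹).1) := by
    have := (b' * b⁻¹).mul_inv
    rw [hu, add_mul, one_mul, Matrix.mul_assoc] at this
    exact eq_sub_of_add_eq this
  -- With `u = (b' b⁻¹)⁻¹ = 1 - ν(yu)`, comparing the right block columns gives `s' = (1 - (yu)ν)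
  -- s`.
  have hs : s' = swapUnit _ _ _ hu' * s := by
    apply Units.ext
    have h3 : b.1 * ζ = -(((b' * b⁻¹)⁻¹).1 * (ν * s.1)) := by
      have h4 : b'.1 * ζ = -(ν * s.1) := by
        rw [← h11]; exact eq_neg_of_add_eq_zero_left h12
      rw [← Matrix.mul_neg, ← h4, _root_.mul_inv_rev, inv_inv, Units.val_mul, ← Matrix.mul_assoc,
        mul_assoc b.1, b'.inv_mul, mul_one]
    rw [Units.val_mul, ← h22, Matrix.mul_assoc y, h3]
    change _ = (1 - y * ((b' * b⁻¹)⁻¹).1 * ν) * s.1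
    rw [Matrix.sub_mul, Matrix.one_mul, Matrix.mul_neg]
    simp only [Matrix.mul_assoc]
    abel
  rw [hs, map_mul, hswap, map_inv, map_mul, map_inv]
  rw [mul_inv, inv_inv]
  have : δ b' * ((δ b')⁻¹ * δ b * det s) = δ b * det s := by
    rw [mul_assoc, mul_inv_cancel_left]
  exact this.symm

/-- A determinant for the block `κ` and one for the block `ι` combine to a determinant for
`κ ⊕ ι`, if they are compatible with the exchange of `1 - λ γ` and `1 - γ λ`. -/
theorem exists_blockDet {δ : (Matrix κ κ D)ˣ →* Γ} {det : (Matrix ι ι D)ˣ →* Γ}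
    (hswap : ∀ (γ : Matrix ι κ D) (l : Matrix κ ι D) (u : (Matrix κ κ D)ˣ)
      (hu : u.1 = 1 - l * γ), det (swapUnit γ l u hu) = δ u)
    (hdec : ∀ (M : (Matrix (κ ⊕ ι) (κ ⊕ ι) D)ˣ) (γ : Matrix ι κ D), ∃ l : Matrix κ ι D,
      IsUnit (1 - l * γ) ∧ ∃ y b s z, M = upperUnit (-l) * lowerUnit y * diagUnit b s * upperUnit z) :
    ∃ det' : (Matrix (κ ⊕ ι) (κ ⊕ ι) D)ˣ →* Γ, (∀ μ, det' (upperUnit μ) = 1) ∧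
      (∀ γ, det' (lowerUnit γ) = 1) ∧ ∀ b s, det' (diagUnit b s) = δ b * det s := by
  -- For defining the value any factorization will do, so `γ = 0` is used; the freedom in `γ` is
  -- needed only for invariance under lower units below.
  choose l _hl y b s z hM using fun M => hdec M 0
  set v : (Matrix (κ ⊕ ι) (κ ⊕ ι) D)ˣ → Γ := fun M => δ (b M) * det (s M) with hv
  have key : ∀ (μ : Matrix κ ι D) (y : Matrix ι κ D) (b : (Matrix κ κ D)ˣ) (s : (Matrix ι ι D)ˣ)
      (z : Matrix κ ι D), v (upperUnit μ * lowerUnit y * diagUnit b s * upperUnit z) =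
        δ b * det s := fun _ _ _ _ _ => (blockDet_unique hswap (hM _)).symm
  have hU : ∀ μ M, v (upperUnit μ * M) = v M := by
    intro μ M
    conv_lhs => rw [hM M]
    rw [← mul_assoc, ← mul_assoc, ← mul_assoc, upperUnit_mul, key]
  have hΔ : ∀ b s M, v (diagUnit b s * M) = δ b * det s * v M := by
    intro b s M
    conv_lhs => rw [hM M]
    rw [← mul_assoc, ← mul_assoc, ← mul_assoc, diagUnit_mul_upperUnit, mul_assoc (upperUnit _),
      diagUnit_mul_lowerUnit, mul_assoc (upperUnit _), mul_assoc (lowerUnit _), diagUnit_mul,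
      ← mul_assoc, key, hv]
    simp only [map_mul]
    rw [mul_mul_mul_comm]
  -- The factorization of `M` is adapted to `γ`, so that `1 - lγ` is invertible and the lower unit
  -- can be moved past the leading upper factor. The diagonal factor that appears contributes
  -- `δ(u)⁻¹ δ(u) = 1`.
  have hL : ∀ γ M, v (lowerUnit γ * M) = v M := by
    intro γ M
    obtain ⟨l, ⟨u, hu⟩, y, b, s, z, rfl⟩ := hdec M γ
    rw [← mul_assoc, ← mul_assoc, ← mul_assoc, lowerUnit_mul_upperUnit γ l u hu,
      mul_assoc _ (diagUnit u⁻¹ _) (lowerUnit y), diagUnit_mul_lowerUnit, ← mul_assoc,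
      mul_assoc (upperUnit _), lowerUnit_mul, mul_assoc _ (diagUnit _ _) (diagUnit _ _),
      diagUnit_mul, key, key, map_mul, map_mul, hswap,
      map_inv, mul_mul_mul_comm, inv_mul_cancel, one_mul]
  -- Multiplicativity follows from the behaviour under left multiplication by each factor of `M`.
  have hmul : ∀ M N, v (M * N) = v M * v N := by
    intro M N
    conv_lhs => rw [hM M]
    rw [mul_assoc, mul_assoc, mul_assoc, hU, hL, hΔ, hU]
  refine ⟨MonoidHom.mk' v hmul, fun μ => ?_, fun γ => ?_, fun b s => ?_⟩
  · have := key μ 0 1 1 0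
    simpa [lowerUnit_zero, upperUnit_zero, diagUnit_one] using this
  · have := key 0 γ 1 1 0
    simpa [lowerUnit_zero, upperUnit_zero, diagUnit_one] using this
  · have := key 0 0 b s 0
    simpa [lowerUnit_zero, upperUnit_zero, diagUnit_one] using this

/-- The decomposition of a block matrix whose upper left entry becomes invertible after adding
multiples of the lower rows. -/
theorem exists_block_decomposition (M : (Matrix (κ ⊕ ι) (κ ⊕ ι) D)ˣ) (l : Matrix κ ι D)
    (h : IsUnit (M.1.toBlocks₁₁ + l * M.1.toBlocks₂₁)) :
    ∃ y b s z, M = upperUnit (-l) * lowerUnit y * diagUnit b s * upperUnit z := by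
  obtain ⟨b, hb⟩ := h
  set y := M.1.toBlocks₂₁ * (b⁻¹).1 with hy
  set z := (b⁻¹).1 * (M.1.toBlocks₁₂ + l * M.1.toBlocks₂₂) with hz
  set S := M.1.toBlocks₂₂ - y * b.1 * z with hS
  have e : M.1 = (upperUnit (-l) * lowerUnit y).1 * (fromBlocks b.1 0 0 S * (upperUnit z).1) := by
    conv_lhs => rw [← fromBlocks_toBlocks M.1]
    have h1 : y * b.1 = M.1.toBlocks₂₁ := by rw [hy, Matrix.mul_assoc, Units.inv_mul, Matrix.mul_one]
    have h2 : b.1 * z = M.1.toBlocks₁₂ + l * M.1.toBlocks₂₂ := by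
      rw [hz, ← Matrix.mul_assoc, Units.mul_inv, Matrix.one_mul]
    have h4 : y * (b.1 * z) + S = M.1.toBlocks₂₂ := by
      rw [hS, ← Matrix.mul_assoc, add_sub_cancel]
    simp only [Units.val_mul, lowerUnit, upperUnit, fromBlocks_multiply, Matrix.one_mul,
      Matrix.mul_one, Matrix.mul_zero, Matrix.zero_mul, add_zero, zero_add]
    rw [fromBlocks_inj]
    refine ⟨?_, ?_, h1.symm, h4.symm⟩
    · rw [Matrix.add_mul, Matrix.one_mul, Matrix.mul_assoc, h1, hb, Matrix.neg_mul]; abel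
    · rw [Matrix.add_mul, Matrix.one_mul, add_assoc, Matrix.mul_assoc, ← Matrix.mul_add, h4, h2,
        Matrix.neg_mul]; abel
  have hSu : IsUnit S := by
    have h1 : IsUnit (fromBlocks b.1 0 0 S) := by
      have := M.isUnit
      rwa [e, Units.isUnit_units_mul, Units.isUnit_mul_units] at this
    exact (isUnit_fromBlocks_lower b.isUnit 0).1 h1
  obtain ⟨s, hs⟩ := hSu
  refine ⟨y, b, s, z, Units.ext ?_⟩
  rw [e, ← hs]; simp only [Units.val_mul, mul_assoc]; rfl

end BlockDet

end L2

/-! ### Elementary matrices and the Dieudonné determinant -/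

namespace L2

open Matrix

section Elementary

variable {D : Type*} [Ring D] {ι : Type} [Fintype ι] [DecidableEq ι]

/-- The subgroup generated by the elementary matrices, for an arbitrary finite index set. -/
def elemSubgroup (ι : Type) [Fintype ι] [DecidableEq ι] (D : Type*) [Ring D] :
    Subgroup (Matrix ι ι D)ˣ :=
  Subgroup.closure {E | ∃ (i j : ι) (c : D), i ≠ j ∧ E.1 = 1 + single i j c}

/-- The invertible diagonal matrices. -/
def diagonalHom (ι : Type) [Fintype ι] [DecidableEq ι] (D : Type*) [Ring D] :
    (ι → Dˣ) →* (Matrix ι ι D)ˣ where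
  toFun d :=
    { val := diagonal fun i => (d i : D)
      inv := diagonal fun i => ((d i)⁻¹ : Dˣ)
      val_inv := by simp [← Matrix.diagonal_one]
      inv_val := by simp [← Matrix.diagonal_one] }
  map_one' := Units.ext (by simp)
  map_mul' d d' := Units.ext (by simp)

theorem diagonalHom_val (d : ι → Dˣ) : (diagonalHom ι D d).1 = diagonal fun i => (d i : D) := rfl

/-- The elementary matrix `1 + c e_{ij}`. -/
def elemUnit {i j : ι} (h : i ≠ j) (c : D) : (Matrix ι ι D)ˣ where
  val := 1 + single i j c
  inv := 1 - single i j c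
  val_inv := by
    rw [mul_sub, add_mul (1 : Matrix ι ι D) _ (single i j c), single_mul_single_of_ne _ _ _ _ h.symm]; simp
  inv_val := by
    rw [mul_add, sub_mul (1 : Matrix ι ι D) _ (single i j c), single_mul_single_of_ne _ _ _ _ h.symm]; simp

theorem elemUnit_mem {i j : ι} (h : i ≠ j) (c : D) : elemUnit h c ∈ elemSubgroup ι D :=
  Subgroup.subset_closure ⟨i, j, c, h, rfl⟩

/-- Off-diagonal entries in a single column can be peeled off one at a time, because `e_{ji} e_{ki}
= 0` for `k ≠ i`. -/
theorem mem_elemSubgroup_of_eq_sum {i : ι} (x : ι → D) (s : Finset ι) (hs : i ∉ s)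
    (E : (Matrix ι ι D)ˣ) (hE : E.1 = 1 + ∑ j ∈ s, single j i (x j)) :
    E ∈ elemSubgroup ι D := by
  induction s using Finset.induction_on generalizing E with
  | empty =>
    have : E = 1 := Units.ext (by simpa using hE)
    rw [this]; exact one_mem _
  | insert j s hj ih =>
    have hji : j ≠ i := fun h => hs (h ▸ Finset.mem_insert_self _ _)
    have hi : i ∉ s := fun h => hs (Finset.mem_insert_of_mem h)
    have : E = elemUnit hji (x j) * ((elemUnit hji (x j))⁻¹ * E) := by rw [mul_inv_cancel_left]
    rw [this]
    refine mul_mem (elemUnit_mem _ _) (ih hi _ ?_)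
    have hz : ∀ k ∈ insert j s, single j i (x j) * single k i (x k) = 0 := fun k hk =>
      single_mul_single_of_ne _ _ _ _ (fun h : i = k => hs (h ▸ hk)) _
    change (1 - single j i (x j)) * E.1 = _
    rw [hE, mul_add, sub_mul _ _ (∑ k ∈ insert j s, single k i (x k)), Finset.mul_sum _ _ (single j i (x j)), Finset.sum_eq_zero hz, Finset.sum_insert hj]
    simp only [mul_one, one_mul, sub_zero]
    abel

theorem upperUnit_mem_elemSubgroup {κ : Type} [Fintype κ] [DecidableEq κ] (μ : Matrix κ ι D) :
    upperUnit μ ∈ elemSubgroup (κ ⊕ ι) D := by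
  induction μ using Matrix.induction_on' with
  | h_zero => rw [upperUnit_zero]; exact one_mem _
  | h_add p q hp hq => rw [← upperUnit_mul]; exact mul_mem hp hq
  | h_std_basis i j c =>
    refine Subgroup.subset_closure ⟨Sum.inl i, Sum.inr j, c, Sum.inl_ne_inr, ?_⟩
    ext (a | a) (b | b) <;> simp [upperUnit, Matrix.one_apply, single_apply]

theorem lowerUnit_mem_elemSubgroup {κ : Type} [Fintype κ] [DecidableEq κ] (μ : Matrix ι κ D) :
    lowerUnit μ ∈ elemSubgroup (κ ⊕ ι) D := by
  induction μ using Matrix.induction_on' with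
  | h_zero => rw [lowerUnit_zero]; exact one_mem _
  | h_add p q hp hq => rw [← lowerUnit_mul]; exact mul_mem hp hq
  | h_std_basis i j c =>
    refine Subgroup.subset_closure ⟨Sum.inr i, Sum.inl j, c, Sum.inr_ne_inl, ?_⟩
    ext (a | a) (b | b) <;> simp [lowerUnit, Matrix.one_apply, single_apply]

theorem diagUnit_one_mem_elemSubgroup {κ : Type} [Fintype κ] [DecidableEq κ]
    {E : (Matrix ι ι D)ˣ} (hE : E ∈ elemSubgroup ι D) :
    diagUnit (1 : (Matrix κ κ D)ˣ) E ∈ elemSubgroup (κ ⊕ ι) D := by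
  let h : (Matrix ι ι D)ˣ →* (Matrix (κ ⊕ ι) (κ ⊕ ι) D)ˣ :=
    MonoidHom.mk' (diagUnit 1) fun a b => by rw [diagUnit_mul, one_mul]
  have : elemSubgroup ι D ≤ (elemSubgroup (κ ⊕ ι) D).comap h := by
    refine (Subgroup.closure_le _).2 ?_
    rintro E ⟨i, j, c, hij, hE⟩
    refine Subgroup.subset_closure ⟨Sum.inr i, Sum.inr j, c, fun h => hij (Sum.inr_injective h), ?_⟩
    change (diagUnit 1 E).1 = _
    ext (a | a) (b | b) <;> simp [diagUnit, hE, Matrix.one_apply, single_apply]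
  exact this hE

/-- Renumbering of the index set. -/
def reindexUnits {κ : Type} [Fintype κ] [DecidableEq κ] (e : κ ≃ ι) :
    (Matrix κ κ D)ˣ ≃* (Matrix ι ι D)ˣ :=
  Units.mapEquiv (reindexRingEquiv D e).toMulEquiv

theorem reindexUnits_val {κ : Type} [Fintype κ] [DecidableEq κ] (e : κ ≃ ι)
    (M : (Matrix κ κ D)ˣ) : (reindexUnits e M).1 = M.1.submatrix e.symm e.symm := rfl

theorem reindexUnits_mem_elemSubgroup {κ : Type} [Fintype κ] [DecidableEq κ] (e : κ ≃ ι)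
    {E : (Matrix κ κ D)ˣ} (hE : E ∈ elemSubgroup κ D) : reindexUnits e E ∈ elemSubgroup ι D := by
  have : elemSubgroup κ D ≤ (elemSubgroup ι D).comap (reindexUnits e).toMonoidHom := by
    refine (Subgroup.closure_le _).2 ?_
    rintro E ⟨i, j, c, hij, hE⟩
    refine Subgroup.subset_closure ⟨e i, e j, c, e.injective.ne hij, ?_⟩
    change (reindexUnits e E).1 = _
    ext a b
    simp [reindexUnits_val, hE, Matrix.one_apply, single_apply, Equiv.eq_symm_apply]
  exact this hE

theorem reindexUnits_diagonalHom {κ : Type} [Fintype κ] [DecidableEq κ] (e : κ ≃ ι)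
    (d : κ → Dˣ) : reindexUnits e (diagonalHom κ D d) = diagonalHom ι D (d ∘ e.symm) :=
  Units.ext (by
    ext a b
    simp [reindexUnits_val, diagonalHom_val, diagonal_apply])

/-- `det` is the Dieudonné determinant: it is trivial on elementary matrices and maps an invertible
diagonal matrix to the product of its entries. -/
structure IsDet (det : (Matrix ι ι D)ˣ →* Abelianization Dˣ) : Prop where
  elem : ∀ E ∈ elemSubgroup ι D, det E = 1
  diagonal : ∀ d : ι → Dˣ, det (diagonalHom ι D d) = ∏ i, Abelianization.of (d i)

end Elementary

section Det

variable {D : Type*} [DivisionRing D] {ι : Type} [Fintype ι] [DecidableEq ι]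

theorem isUnit_matrix_unit {X : Matrix Unit Unit D} (h : X () () ≠ 0) : IsUnit X :=
  (isUnit_map_iff (uniqueRingEquiv : Matrix Unit Unit D ≃+* D) X).1 (isUnit_iff_ne_zero.2 h)

/-- The determinant of a `1 × 1`-matrix. -/
noncomputable def unitDet (D : Type*) [DivisionRing D] :
    (Matrix Unit Unit D)ˣ →* Abelianization Dˣ :=
  Abelianization.of.comp (Units.map (uniqueRingEquiv : Matrix Unit Unit D ≃+* D).toMonoidHom)

/-- A determinant is invariant under conjugation, and `1 - γl` is conjugate to a matrix that differs
from the identity in one column only. Such a matrix is elementary up to a diagonal one with the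
single nontrivial entry `1 - lγ`. -/
theorem IsDet.swapUnit {det : (Matrix ι ι D)ˣ →* Abelianization Dˣ} (hdet : IsDet det)
    (γ : Matrix ι Unit D) (l : Matrix Unit ι D) (u : (Matrix Unit Unit D)ˣ)
    (hu : u.1 = 1 - l * γ) : det (L2.swapUnit γ l u hu) = unitDet D u := by
  by_cases hl : l = 0
  · subst hl
    have h1 : u = 1 := Units.ext (by simpa using hu)
    have h2 : L2.swapUnit γ 0 u hu = 1 := Units.ext (by simp [L2.swapUnit])
    rw [h2, h1, map_one, map_one]
  · obtain ⟨i, hi⟩ : ∃ i, l () i ≠ 0 := by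
      by_contra! h
      exact hl (by ext a b; exact h b)
    -- conjugate to a matrix that differs from the identity in the column `i` only
    set c : Matrix ι Unit D := single i () 1 with hc
    set r : Matrix Unit ι D := single () i 1 with hr
    have hrc : r * c = 1 := by
      rw [hr, hc, single_mul_single_same]; ext; simp
    -- The conjugating matrix is `P = 1 + c(l - r)`, which satisfies `rP = l`. By the exchange of
    -- factors it is invertible as soon as `1 + (l - r)c = lc` is, and this is the nonzero entry
    -- `l_i`.
    obtain ⟨w, hw⟩ : IsUnit (1 - (l - r) * (-c)) := by
      apply isUnit_matrix_unit
      have : 1 - (l - r) * (-c) = l * c := by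
        rw [Matrix.mul_neg, Matrix.sub_mul, hrc]; abel
      rw [this, hc]
      simpa using hi
    set P := L2.swapUnit (-c) (l - r) w hw with hP
    have hrP : r * P.1 = l := by
      change r * (1 - -c * (l - r)) = l
      rw [Matrix.neg_mul, sub_neg_eq_add, Matrix.mul_add, Matrix.mul_one, ← Matrix.mul_assoc, hrc,
        Matrix.one_mul]; abel
    set γ' := P.1 * γ with hγ'
    have hrγ' : r * γ' = l * γ := by rw [hγ', ← Matrix.mul_assoc, hrP]
    set W := P * L2.swapUnit γ l u hu * P⁻¹ with hW
    have hWv : W.1 = 1 - γ' * r := by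
      have h1 : W.1 = P.1 * (1 - γ * l) * (P⁻¹).1 := rfl
      rw [h1, mul_sub, sub_mul, mul_one, P.mul_inv, ← hrP]
      congr 1
      rw [hγ', ← Matrix.mul_assoc, ← Matrix.mul_assoc, Matrix.mul_assoc _ P.1, P.mul_inv,
        Matrix.mul_one]
    have hdetW : det (L2.swapUnit γ l u hu) = det W := by
      rw [hW, map_mul, map_mul, map_inv, mul_comm (det P), mul_inv_cancel_right]
    set u0 : Dˣ := Units.map (uniqueRingEquiv : Matrix Unit Unit D ≃+* D).toMonoidHom u with hu0
    have hu0v : (u0 : D) = 1 - γ' i () := by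
      have h1 : (u0 : D) = u.1 () () := rfl
      rw [h1, hu, ← hrγ', hr]
      simp
    set d : ι → Dˣ := Pi.mulSingle i u0 with hd
    -- Dividing column `i` by its diagonal entry `u0` leaves a unipotent column with the entries
    -- `-γ'_j u0⁻¹` for `j ≠ i`.
    have hE : W * (diagonalHom ι D d)⁻¹ ∈ elemSubgroup ι D := by
      refine mem_elemSubgroup_of_eq_sum (i := i) (fun j => -γ' j () * (u0⁻¹ : Dˣ))
        (Finset.univ.erase i) (by simp) _ ?_
      rw [← map_inv, Units.val_mul, hWv]
      ext j k
      rw [diagonalHom_val, mul_diagonal, Matrix.add_apply, Matrix.sum_apply, Matrix.sub_apply]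
      by_cases hk : k = i
      · subst hk
        by_cases hj : j = k
        · subst hj
          have : ∀ x ∈ Finset.univ.erase j, (single x j (-γ' x () * ((u0⁻¹ : Dˣ) : D))) j j = 0 := by
            intro x hx
            rw [single_apply, if_neg]
            exact fun h => (Finset.ne_of_mem_erase hx) h.1
          rw [Finset.sum_eq_zero this]
          simp [hd, hr, Matrix.mul_apply, single_apply, ← hu0v]
        · rw [Finset.sum_eq_single_of_mem j (by simp [hj])
            (fun b _ hb => by rw [single_apply, if_neg (fun h => hb h.1)])]
          simp [hd, hr, Matrix.mul_apply, single_apply, hj]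
      · have : ∀ x ∈ Finset.univ.erase i, (single x i (-γ' x () * ((u0⁻¹ : Dˣ) : D))) j k = 0 := by
          intro x hx
          rw [single_apply, if_neg]
          exact fun h => hk h.2.symm
        rw [Finset.sum_eq_zero this]
        simp [hd, hr, Matrix.mul_apply, single_apply, hk, Ne.symm hk]
    have h1 := hdet.elem _ hE
    rw [map_mul, map_inv, mul_inv_eq_one, hdet.diagonal] at h1
    rw [hdetW, h1, Finset.prod_eq_single i]
    · rw [hd, Pi.mulSingle_eq_same]; rfl
    · intro j _ hj
      rw [hd, Pi.mulSingle_eq_of_ne hj, map_one]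
    · simp

/-- Adding a multiple of a lower row can make the upper left entry nonzero. The multiple must also
keep `1 - lγ` nonzero, and the two candidates `1` and `2` for the new entry suffice for this. -/
theorem exists_row_decomposition (h2 : (2 : D) ≠ 0)
    (M : (Matrix (Unit ⊕ ι) (Unit ⊕ ι) D)ˣ) (γ : Matrix ι Unit D) :
    ∃ l : Matrix Unit ι D, IsUnit (1 - l * γ) ∧
      ∃ y b s z, M = upperUnit (-l) * lowerUnit y * diagUnit b s * upperUnit z := by
  by_cases ha : M.1 (Sum.inl ()) (Sum.inl ()) = 0
  · obtain ⟨j, hj⟩ : ∃ j, M.1 (Sum.inr j) (Sum.inl ()) ≠ 0 := by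
      by_contra! h
      have h1 := congrFun (congrFun M.inv_mul (Sum.inl ())) (Sum.inl ())
      rw [Matrix.mul_apply, Finset.sum_eq_zero] at h1
      · simp at h1
      · rintro (⟨⟩ | k) -
        · rw [ha, mul_zero]
        · rw [h, mul_zero]
    set c := M.1 (Sum.inr j) (Sum.inl ())
    -- The new upper left entry will be `t`. If `t = 1` fails, then `c⁻¹ γ_j = 1`, and `t = 2` gives
    -- `1 - 2 = -1`.
    obtain ⟨t, ht, ht'⟩ : ∃ t : D, t ≠ 0 ∧ 1 - t * (c⁻¹ * γ j ()) ≠ 0 := by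
      by_cases h : 1 - 1 * (c⁻¹ * γ j ()) = 0
      · refine ⟨2, h2, ?_⟩
        rw [one_mul, sub_eq_zero] at h
        rw [← h]; norm_num
      · exact ⟨1, one_ne_zero, h⟩
    refine ⟨single () j (t * c⁻¹), isUnit_matrix_unit ?_,
      exists_block_decomposition M _ (isUnit_matrix_unit ?_)⟩
    · rw [Matrix.sub_apply, single_mul_apply_same, mul_assoc]; exact ht'
    · rw [Matrix.add_apply, single_mul_apply_same]
      change M.1 (Sum.inl ()) (Sum.inl ()) + t * c⁻¹ * c ≠ 0
      rw [ha, zero_add, inv_mul_cancel_right₀ hj]; exact ht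
  · refine ⟨0, by simp, exists_block_decomposition M _ (isUnit_matrix_unit ?_)⟩
    rw [Matrix.zero_mul, add_zero]; exact ha

theorem exists_isDet_sum (h2 : (2 : D) ≠ 0) {det : (Matrix ι ι D)ˣ →* Abelianization Dˣ}
    (hdet : IsDet det) : ∃ det' : (Matrix (Unit ⊕ ι) (Unit ⊕ ι) D)ˣ →* Abelianization Dˣ,
      IsDet det' := by
  obtain ⟨det', hU, hL, hΔ⟩ := exists_blockDet (fun γ l u hu => hdet.swapUnit γ l u hu)
    (exists_row_decomposition h2)
  refine ⟨det', ⟨?_, fun d => ?_⟩⟩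
  · have : elemSubgroup (Unit ⊕ ι) D ≤ det'.ker := by
      refine (Subgroup.closure_le _).2 ?_
      rintro E ⟨i, j, c, hij, hE⟩
      change det' E = 1
      rcases i with ⟨⟩ | i <;> rcases j with ⟨⟩ | j
      · exact absurd rfl hij
      · have : E = upperUnit (single () j c) := Units.ext (by
          rw [hE]
          ext (a | a) (b | b) <;> simp [upperUnit, Matrix.one_apply, single_apply])
        rw [this, hU]
      · have : E = lowerUnit (single i () c) := Units.ext (by
          rw [hE]
          ext (a | a) (b | b) <;> simp [lowerUnit, Matrix.one_apply, single_apply])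
        rw [this, hL]
      · have hij' : i ≠ j := fun h => hij (congrArg _ h)
        have : E = diagUnit 1 (elemUnit hij' c) := Units.ext (by
          rw [hE]
          ext (a | a) (b | b) <;> simp [diagUnit, elemUnit, Matrix.one_apply, single_apply])
        rw [this, hΔ, map_one, one_mul, hdet.elem _ (elemUnit_mem _ _)]
    exact this
  · have : diagonalHom (Unit ⊕ ι) D d =
        diagUnit (diagonalHom Unit D (d ∘ Sum.inl)) (diagonalHom ι D (d ∘ Sum.inr)) := Units.ext (by
          ext (a | a) (b | b) <;> simp [diagUnit, diagonalHom_val, diagonal_apply])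
    rw [this, hΔ, hdet.diagonal, Fintype.prod_sum_type]
    congr 1
    rw [Fintype.prod_unique]
    rw [unitDet, MonoidHom.comp_apply]
    exact congrArg _ (Units.ext (by simp [diagonalHom_val]))

theorem exists_isDet (h2 : (2 : D) ≠ 0) (ι : Type) [Fintype ι] [DecidableEq ι] :
    ∃ det : (Matrix ι ι D)ˣ →* Abelianization Dˣ, IsDet det := by
  obtain ⟨n, hn⟩ : ∃ n, Fintype.card ι = n := ⟨_, rfl⟩
  induction n generalizing ι with
  | zero =>
    have : IsEmpty ι := Fintype.card_eq_zero_iff.1 hn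
    exact ⟨1, ⟨fun _ _ => rfl, fun d => by simp⟩⟩
  | succ n ih =>
    obtain ⟨det, hdet⟩ := ih (Fin n) (by simp)
    obtain ⟨det', hdet'⟩ := exists_isDet_sum h2 hdet
    let e : ι ≃ Unit ⊕ Fin n := Fintype.equivOfCardEq (by simp [hn, add_comm])
    refine ⟨det'.comp (reindexUnits e).toMonoidHom, ⟨fun E hE => ?_, fun d => ?_⟩⟩
    · exact hdet'.elem _ (reindexUnits_mem_elemSubgroup e hE)
    · change det' (reindexUnits e _) = _
      rw [reindexUnits_diagonalHom, hdet'.diagonal]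
      exact Equiv.prod_comp e.symm fun i => Abelianization.of (d i)

theorem exists_elem_mul_eq_diagonal (h2 : (2 : D) ≠ 0) (ι : Type) [Fintype ι] [DecidableEq ι]
    (M : (Matrix ι ι D)ˣ) : ∃ E ∈ elemSubgroup ι D, ∃ d, E * M = diagonalHom ι D d := by
  obtain ⟨n, hn⟩ : ∃ n, Fintype.card ι = n := ⟨_, rfl⟩
  induction n generalizing ι with
  | zero =>
    have : IsEmpty ι := Fintype.card_eq_zero_iff.1 hn
    exact ⟨1, one_mem _, 1, Subsingleton.elim _ _⟩
  | succ n ih =>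
    let e : ι ≃ Unit ⊕ Fin n := Fintype.equivOfCardEq (by simp [hn, add_comm])
    obtain ⟨l, -, y, b, s, z, hM⟩ := exists_row_decomposition h2 (reindexUnits e M) 0
    obtain ⟨E, hE, d, hd⟩ := ih (Fin n) s (by simp)
    have hM' : reindexUnits e M = upperUnit (-l) * lowerUnit y *
        upperUnit (b.1 * z * (s⁻¹).1) * diagUnit b s := by
      rw [hM, mul_assoc _ (diagUnit b s), diagUnit_mul_upperUnit, ← mul_assoc]
    set A := upperUnit (-l) * lowerUnit y * upperUnit (b.1 * z * (s⁻¹).1)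
    have hA : A ∈ elemSubgroup _ D := mul_mem (mul_mem (upperUnit_mem_elemSubgroup _)
      (lowerUnit_mem_elemSubgroup _)) (upperUnit_mem_elemSubgroup _)
    set E' := diagUnit (1 : (Matrix Unit Unit D)ˣ) E * A⁻¹
    have hE' : E' ∈ elemSubgroup _ D := mul_mem (diagUnit_one_mem_elemSubgroup hE) (inv_mem hA)
    refine ⟨reindexUnits e.symm E', reindexUnits_mem_elemSubgroup _ hE',
      (Sum.elim (fun _ => Units.map (uniqueRingEquiv : Matrix Unit Unit D ≃+* D).toMonoidHom b) d)
        ∘ e.symm.symm, ?_⟩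
    rw [← reindexUnits_diagonalHom]
    have h3 : M = reindexUnits e.symm (reindexUnits e M) :=
      Units.ext (by rw [reindexUnits_val, reindexUnits_val]; simp)
    conv_lhs => rw [h3]
    rw [← map_mul, hM', mul_assoc, inv_mul_cancel_left, diagUnit_mul, one_mul, hd]
    congr 1
    exact Units.ext (by
      ext (a | a) (a' | a') <;> simp [diagUnit, diagonalHom_val, diagonal_apply])

/-- The Dieudonné determinant. -/
noncomputable def dieudonneDet (h2 : (2 : D) ≠ 0) (ι : Type) [Fintype ι] [DecidableEq ι] :
    (Matrix ι ι D)ˣ →* Abelianization Dˣ := (exists_isDet h2 ι).choose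

theorem isDet_dieudonneDet (h2 : (2 : D) ≠ 0) : IsDet (dieudonneDet h2 ι) :=
  (exists_isDet h2 ι).choose_spec

theorem isDieudonneDet_iff (h2 : (2 : D) ≠ 0) {n : ℕ} (M : (Matrix (Fin n) (Fin n) D)ˣ)
    (c : Abelianization Dˣ) : IsDieudonneDet M c ↔ dieudonneDet h2 (Fin n) M = c := by
  have key : ∀ E ∈ elemSubgroup (Fin n) D, ∀ d, E * M = diagonalHom _ D d →
      dieudonneDet h2 (Fin n) M = ∏ i, Abelianization.of (d i) := by
    intro E hE d h
    rw [← (isDet_dieudonneDet h2).diagonal, ← h, map_mul, (isDet_dieudonneDet h2).elem E hE,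
      one_mul]
  constructor
  · rintro ⟨E, hE, d, h, rfl⟩
    exact key E hE d (Units.ext h)
  · rintro rfl
    obtain ⟨E, hE, d, h⟩ := exists_elem_mul_eq_diagonal h2 (Fin n) M
    exact ⟨E, hE, d, congrArg Units.val h, key E hE d h⟩

variable {Γ : Type*} [CommGroup Γ]

/-- Conjugating `E = 1 + c e_{ij}` by the diagonal matrix with `2` in place `i` gives `1 + 2c e_{ij}
= E²`. In an abelian target this forces `V(E) = V(E)²`. The argument works in every size, including
`2 × 2`. -/
theorem map_elemSubgroup_eq_one (h2 : (2 : D) ≠ 0) (V : (Matrix ι ι D)ˣ →* Γ)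
    {E : (Matrix ι ι D)ˣ} (hE : E ∈ elemSubgroup ι D) : V E = 1 := by
  have : elemSubgroup ι D ≤ V.ker := by
    refine (Subgroup.closure_le _).2 ?_
    rintro E ⟨i, j, c, hij, hE⟩
    set Δ := diagonalHom ι D (Pi.mulSingle i (Units.mk0 2 h2)) with hΔ
    have h : Δ * E = E * E * Δ := Units.ext (by
      simp only [Units.val_mul, hE, hΔ, diagonalHom_val]
      have h0 : (1 + single i j c) * (1 + single i j c) = 1 + (single i j c + single i j c) := by
        rw [add_mul, mul_add (single i j c), single_mul_single_of_ne _ _ _ _ hij.symm, one_mul,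
          mul_one, add_zero, add_assoc]
      rw [h0, mul_add, mul_one, add_mul, one_mul]
      congr 1
      ext a b
      rw [diagonal_mul, mul_diagonal, Matrix.add_apply]
      by_cases ha : a = i
      · subst ha
        by_cases hb : b = j
        · subst hb
          simp [Pi.mulSingle_eq_of_ne hij.symm, two_mul]
        · simp [single_apply, Ne.symm hb]
      · simp [single_apply, Ne.symm ha])
    have h' := congrArg V h
    rw [map_mul, map_mul, map_mul, mul_comm, mul_left_inj] at h'
    exact (left_eq_mul.1 h')
  exact this hE

/-- The two diagonal matrices are conjugate by a transposition matrix, and conjugation is invisible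
in an abelian group. -/
theorem map_mulSingle_eq (V : (Matrix ι ι D)ˣ →* Γ) (i j : ι) (x : Dˣ) :
    V (diagonalHom ι D (Pi.mulSingle i x)) = V (diagonalHom ι D (Pi.mulSingle j x)) := by
  set σ := Equiv.swap i j with hσ
  let P : (Matrix ι ι D)ˣ :=
    { val := (1 : Matrix ι ι D).submatrix σ (Equiv.refl ι)
      inv := (1 : Matrix ι ι D).submatrix (Equiv.refl ι) σ
      val_inv := by rw [submatrix_mul_equiv, mul_one, submatrix_one_equiv]
      inv_val := by rw [submatrix_mul_equiv, mul_one, submatrix_one_equiv] }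
  have h : P * diagonalHom ι D (Pi.mulSingle i x) = diagonalHom ι D (Pi.mulSingle j x) * P :=
    Units.ext (by
      ext a b
      simp only [Units.val_mul, diagonalHom_val]
      rw [diagonal_mul, mul_diagonal]
      change (1 : Matrix ι ι D) (σ a) b * _ = _ * (1 : Matrix ι ι D) (σ a) b
      by_cases hab : σ a = b
      · have h1 : b = i ↔ a = j := by
          rw [← hab, ← Equiv.eq_symm_apply, hσ, Equiv.symm_swap, Equiv.swap_apply_left]
        rw [Matrix.one_apply, if_pos hab, one_mul, mul_one, Pi.mulSingle_apply, Pi.mulSingle_apply]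
        simp only [h1]
      · rw [Matrix.one_apply, if_neg hab, zero_mul, mul_zero])
  have h' := congrArg V h
  rwa [map_mul, map_mul, mul_comm, mul_left_inj] at h'

/-- Every homomorphism from `GL_n(D)` to an abelian group factors through the determinant. -/
theorem eq_of_dieudonneDet_eq (h2 : (2 : D) ≠ 0) [Nonempty ι] (V : (Matrix ι ι D)ˣ →* Γ)
    {X Y : (Matrix ι ι D)ˣ} (h : dieudonneDet h2 ι X = dieudonneDet h2 ι Y) : V X = V Y := by
  obtain ⟨i₀⟩ := ‹Nonempty ι›
  let V₀ : Dˣ →* Γ := (V.comp (diagonalHom ι D)).comp (MonoidHom.mulSingle (fun _ => Dˣ) i₀)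
  -- On diagonal matrices it suffices to treat those with one nontrivial entry, which can be moved
  -- to the fixed place `i₀`. There both sides are the homomorphism `V₀` on units, which factors
  -- through the abelianization.
  have key : V.comp (diagonalHom ι D) =
      (Abelianization.lift V₀).comp ((dieudonneDet h2 ι).comp (diagonalHom ι D)) := by
    refine MonoidHom.pi_ext fun i x => ?_
    simp only [MonoidHom.comp_apply]
    rw [map_mulSingle_eq V i i₀, map_mulSingle_eq (dieudonneDet h2 ι) i i₀,
      (isDet_dieudonneDet h2).diagonal, Finset.prod_eq_single i₀ (fun j _ hj => by
        rw [Pi.mulSingle_eq_of_ne hj, map_one]) (by simp), Pi.mulSingle_eq_same,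
      Abelianization.lift_apply_of]
    rfl
  have : ∀ M, V M = Abelianization.lift V₀ (dieudonneDet h2 ι M) := by
    intro M
    obtain ⟨E, hE, d, hd⟩ := exists_elem_mul_eq_diagonal h2 ι M
    have hM : M = E⁻¹ * diagonalHom ι D d := by rw [← hd, inv_mul_cancel_left]
    have h1 := DFunLike.congr_fun key d
    simp only [MonoidHom.comp_apply] at h1
    rw [hM, map_mul, map_mul, map_elemSubgroup_eq_one h2 V (inv_mem hE),
      (isDet_dieudonneDet h2).elem _ (inv_mem hE), one_mul, one_mul, h1]
  rw [this, this, h]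

end Det

end L2

/-! ### Matrices generate `K₁`; stability of the Dieudonné determinant -/

namespace L2

open Matrix

section MatrixGenerators

variable {A : Type u} [Ring A]

/-- The map `F` is `f` on the direct summand `g(P)` and the identity on the complement `ker p`, so
the same recipe with `f⁻¹` inverts it. -/
theorem bijective_sandwich {P Q : Type*} [AddCommGroup P] [Module A P] [AddCommGroup Q]
    [Module A Q] {f : P →ₗ[A] P} (hf : Function.Bijective f) {g : P →ₗ[A] Q} {p : Q →ₗ[A] P}
    (h : p ∘ₗ g = LinearMap.id) {F : Q →ₗ[A] Q}
    (hF : F + g ∘ₗ p = g ∘ₗ f ∘ₗ p + LinearMap.id) : Function.Bijective F := by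
  let e := LinearEquiv.ofBijective f hf
  have hpg : ∀ x, p (g x) = x := fun x => LinearMap.congr_fun h x
  have hF' : ∀ v, F v = g (f (p v)) + v - g (p v) := fun v =>
    eq_sub_of_add_eq (LinearMap.congr_fun hF v)
  have he : ∀ x, f (e.symm x) = x := fun x => e.apply_symm_apply x
  have he' : ∀ x, e.symm (f x) = x := fun x => e.symm_apply_apply x
  refine Function.bijective_iff_has_inverse.2
    ⟨fun v => g (e.symm (p v)) + v - g (p v), fun v => ?_, fun v => ?_⟩
  · simp only [hF', map_add, map_sub, hpg, he, he', add_sub_cancel_right]; abel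
  · simp only [hF', map_add, map_sub, hpg, he, he', add_sub_cancel_right]; abel

namespace K1Gen

variable {W : FGProjEnd A → Prop} {D : Type*} [Ring D] {φ : A →+* D}

/-- The class of an endomorphism of a projective module is the class of a matrix. -/
theorem exists_cls_eq_matrix
    (hid : ∀ (P : Type u) [AddCommGroup P] [Module A P] [Module.Finite A P]
      [Module.Projective A P], W ⟨P, LinearMap.id⟩)
    (hsplit : ∀ (P Q : Type u) [AddCommGroup P] [Module A P] [Module.Finite A P]
      [Module.Projective A P] [AddCommGroup Q] [Module A Q] [Module.Finite A Q]
      [Module.Projective A Q] (f : P →ₗ[A] P) (g : P →ₗ[A] Q) (p : Q →ₗ[A] P) (F : Q →ₗ[A] Q),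
      W ⟨P, f⟩ → p ∘ₗ g = LinearMap.id → F + g ∘ₗ p = g ∘ₗ f ∘ₗ p + LinearMap.id → W ⟨Q, F⟩)
    (x : FGProjEnd A) (hx : W x) :
    ∃ (n : ℕ) (M : Matrix (Fin n) (Fin n) A) (hM : W ⟨Fin n → A, M.vecMulLinear⟩),
      cls x hx = cls _ hM := by
  obtain ⟨P, f⟩ := x
  obtain ⟨n, p, g, -, hg, hpg⟩ := Module.Finite.exists_comp_eq_id_of_projective A P
  have hpg' : ∀ x, p (g x) = x := fun x => LinearMap.congr_fun hpg x
  -- The module `P` is a summand of a free module, and `f` is extended by the identity on the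
  -- complement `ker p`, whose class vanishes.
  set F : (Fin n → A) →ₗ[A] (Fin n → A) := g ∘ₗ f ∘ₗ p + LinearMap.id - g ∘ₗ p with hFdef
  have hF : F + g ∘ₗ p = g ∘ₗ f ∘ₗ p + LinearMap.id := by rw [hFdef, sub_add_cancel]
  have hF' : ∀ v, F v = g (f (p v)) + v - g (p v) := fun v => rfl
  obtain ⟨M, hM⟩ : ∃ M : Matrix (Fin n) (Fin n) A, M.vecMulLinear = F :=
    ⟨LinearMap.toMatrixRight' F, LinearMap.toMatrixRight'.symm_apply_apply _⟩
  have hW : W ⟨Fin n → A, M.vecMulLinear⟩ := by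
    rw [hM]; exact hsplit P _ f g p F hx hpg hF
  refine ⟨n, M, hW, ?_⟩
  let q : (Fin n → A) →ₗ[A] LinearMap.ker p :=
    (LinearMap.id - g ∘ₗ p).codRestrict _ fun v => by simp [hpg']
  have hq : ∀ v, (q v : Fin n → A) = v - g (p v) := fun v => rfl
  have hqs : q ∘ₗ (LinearMap.ker p).subtype = LinearMap.id := LinearMap.ext fun v => by
    apply Subtype.ext
    have := v.2
    rw [LinearMap.mem_ker] at this
    simp [hq, this]
  have hqsurj : Function.Surjective q := fun v => ⟨v, LinearMap.congr_fun hqs v⟩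
  have : Module.Finite A (LinearMap.ker p) := Module.Finite.of_surjective q hqsurj
  have : Module.Projective A (LinearMap.ker p) :=
    Module.Projective.of_split (LinearMap.ker p).subtype q hqs
  have h := cls_exact (W := W) g q (f₀ := f) (f₁ := M.vecMulLinear) (f₂ := LinearMap.id) hg
    (fun v => by
      constructor
      · intro hv
        have := congrArg Subtype.val hv
        rw [hq] at this
        exact ⟨p v, (sub_eq_zero.1 this).symm⟩
      · rintro ⟨w, rfl⟩
        apply Subtype.ext
        rw [hq, hpg', sub_self]; rfl) hqsurj
    (LinearMap.ext fun v => by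
      rw [hM, LinearMap.comp_apply, hF', hpg', add_sub_cancel_right]; rfl)
    (LinearMap.ext fun v => by
      apply Subtype.ext
      rw [hM, LinearMap.comp_apply, LinearMap.comp_apply, hq, LinearMap.id_apply, hq, hF']
      simp only [map_add, map_sub, hpg']
      abel) hx hW (hid _)
  rw [h, cls_id, add_zero]

/-- Every element is the difference of the classes of two matrices of the same size. -/
theorem exists_eq_sub
    (hid : ∀ (P : Type u) [AddCommGroup P] [Module A P] [Module.Finite A P]
      [Module.Projective A P], W ⟨P, LinearMap.id⟩)
    (hsplit : ∀ (P Q : Type u) [AddCommGroup P] [Module A P] [Module.Finite A P]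
      [Module.Projective A P] [AddCommGroup Q] [Module A Q] [Module.Finite A Q]
      [Module.Projective A Q] (f : P →ₗ[A] P) (g : P →ₗ[A] Q) (p : Q →ₗ[A] P) (F : Q →ₗ[A] Q),
      W ⟨P, f⟩ → p ∘ₗ g = LinearMap.id → F + g ∘ₗ p = g ∘ₗ f ∘ₗ p + LinearMap.id → W ⟨Q, F⟩)
    (hW' : ∀ {ι : Type} [Fintype ι] [DecidableEq ι] (M : Matrix ι ι A),
      W ⟨ι → A, M.vecMulLinear⟩ → Inverts φ M)
    (h0 : W ⟨PUnit, LinearMap.id⟩)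
    (hW : ∀ {ι : Type} [Fintype ι] [DecidableEq ι] (M : Matrix ι ι A), Inverts φ M →
      W ⟨ι → A, M.vecMulLinear⟩) (z : K1Gen W) :
    ∃ (ι : Type) (_ : Fintype ι) (_ : DecidableEq ι) (_ : Nonempty ι) (a b : Matrix ι ι A),
      Inverts φ a ∧ Inverts φ b ∧
        z = (detInvariant h0 hW).toFun a - (detInvariant h0 hW).toFun b := by
  induction z using K1Gen.ind with
  | hadd x y hx hy =>
    obtain ⟨ι, _, _, _, a, b, ha, hb, rfl⟩ := hx
    obtain ⟨κ, _, _, _, a', b', ha', hb', rfl⟩ := hy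
    refine ⟨ι ⊕ κ, inferInstance, inferInstance, inferInstance, fromBlocks a 0 0 a',
      fromBlocks b 0 0 b', (ha.upper_iff 0).2 ha', (hb.upper_iff 0).2 hb', ?_⟩
    rw [DetInvariant.map_upper _ _ ha ha', DetInvariant.map_upper _ _ hb hb']
    abel
  | hneg x hx =>
    obtain ⟨ι, _, _, _, a, b, ha, hb, rfl⟩ := hx
    exact ⟨ι, inferInstance, inferInstance, inferInstance, b, a, hb, ha, neg_sub _ _⟩
  | h0 => exact ⟨Unit, inferInstance, inferInstance, inferInstance, 1, 1, .one, .one,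
      (sub_self _).symm⟩
  | h x hx =>
    obtain ⟨n, M, hM, h⟩ := exists_cls_eq_matrix hid hsplit x hx
    have hM' := hW' M hM
    -- The extra `1 × 1` block keeps the index set nonempty when `n = 0`, as the factorization
    -- through the determinant requires.
    refine ⟨Fin n ⊕ Unit, inferInstance, inferInstance, inferInstance, fromBlocks M 0 0 1, 1,
      (hM'.upper_iff 0).2 .one, .one, ?_⟩
    rw [DetInvariant.map_upper _ _ hM' .one, DetInvariant.map_one, DetInvariant.map_one, add_zero,
      sub_zero, h, detInvariant_apply hM']

end K1Gen

end MatrixGenerators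

section Dieudonne

variable {D : Type*} [DivisionRing D] (h2 : (2 : D) ≠ 0) {ι κ : Type} [Fintype ι] [DecidableEq ι]
  [Fintype κ] [DecidableEq κ]

theorem dieudonneDet_eq_one_of_mem {E : (Matrix ι ι D)ˣ} (hE : E ∈ elemSubgroup ι D) :
    dieudonneDet h2 ι E = 1 := (isDet_dieudonneDet h2).elem E hE

/-- The determinants for different index types are chosen independently of each other. Compatibility
comes from the diagonal form, on which their values are prescribed. -/
theorem dieudonneDet_reindexUnits (e : κ ≃ ι) (M : (Matrix κ κ D)ˣ) :
    dieudonneDet h2 ι (reindexUnits e M) = dieudonneDet h2 κ M := by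
  obtain ⟨E, hE, d, hd⟩ := exists_elem_mul_eq_diagonal h2 κ M
  have hM : M = E⁻¹ * diagonalHom κ D d := by rw [← hd, inv_mul_cancel_left]
  rw [hM, map_mul, map_mul, map_mul,
    dieudonneDet_eq_one_of_mem h2 (reindexUnits_mem_elemSubgroup e (inv_mem hE)),
    dieudonneDet_eq_one_of_mem h2 (inv_mem hE), reindexUnits_diagonalHom,
    (isDet_dieudonneDet h2).diagonal, (isDet_dieudonneDet h2).diagonal, one_mul, one_mul]
  exact Equiv.prod_comp e.symm fun i => Abelianization.of (d i)

theorem dieudonneDet_diagUnit_one (M : (Matrix ι ι D)ˣ) :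
    dieudonneDet h2 (κ ⊕ ι) (diagUnit 1 M) = dieudonneDet h2 ι M := by
  obtain ⟨E, hE, d, hd⟩ := exists_elem_mul_eq_diagonal h2 ι M
  have hM : M = E⁻¹ * diagonalHom ι D d := by rw [← hd, inv_mul_cancel_left]
  have h1 : diagUnit (1 : (Matrix κ κ D)ˣ) M =
      diagUnit 1 E⁻¹ * diagonalHom (κ ⊕ ι) D (Sum.elim 1 d) := by
    rw [hM, ← one_mul (1 : (Matrix κ κ D)ˣ), ← diagUnit_mul, one_mul]
    congr 1
    exact Units.ext (by
      ext (a | a) (a' | a') <;> simp [diagUnit, diagonalHom_val, diagonal_apply, Matrix.one_apply])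
  rw [h1, map_mul, dieudonneDet_eq_one_of_mem h2 (diagUnit_one_mem_elemSubgroup (inv_mem hE)), hM,
    map_mul, dieudonneDet_eq_one_of_mem h2 (inv_mem hE), (isDet_dieudonneDet h2).diagonal,
    (isDet_dieudonneDet h2).diagonal, Fintype.prod_sum_type]
  simp

theorem dieudonneDet_diagUnit (M : (Matrix κ κ D)ˣ) (N : (Matrix ι ι D)ˣ) :
    dieudonneDet h2 (κ ⊕ ι) (diagUnit M N) = dieudonneDet h2 κ M * dieudonneDet h2 ι N := by
  have h1 : diagUnit M N = reindexUnits (Equiv.sumComm ι κ) (diagUnit (1 : (Matrix ι ι D)ˣ) M) *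
      diagUnit 1 N := by
    have : reindexUnits (Equiv.sumComm ι κ) (diagUnit (1 : (Matrix ι ι D)ˣ) M) =
        diagUnit M 1 := Units.ext (by ext (a | a) (a' | a') <;> rfl)
    rw [this, diagUnit_mul, mul_one, one_mul]
  rw [h1, map_mul, dieudonneDet_reindexUnits, dieudonneDet_diagUnit_one, dieudonneDet_diagUnit_one]

theorem Inverts.isUnit {M : Matrix ι ι D} (h : Inverts (RingHom.id D) M) : IsUnit M := h

open Classical in
/-- The Dieudonné determinant as an additive invariant of matrices. -/
noncomputable def detD : DetInvariant (RingHom.id D) (Additive (Abelianization Dˣ)) where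
  toFun {ι _ _} M := if h : IsUnit M then Additive.ofMul (dieudonneDet h2 ι h.unit) else 0
  map_mul hM hN := by
    rw [dif_pos hM.isUnit, dif_pos hN.isUnit, dif_pos (hM.isUnit.mul hN.isUnit), ← ofMul_mul,
      ← map_mul]
    congr 2
    exact Units.ext rfl
  map_upper {ι κ _ _ _ _ M} X N hM hN := by
    have hu : IsUnit (fromBlocks M X 0 N) := (isUnit_fromBlocks_upper hM.isUnit X).2 hN.isUnit
    rw [dif_pos hM.isUnit, dif_pos hN.isUnit, dif_pos hu, ← ofMul_mul, ← dieudonneDet_diagUnit]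
    have h1 : hu.unit = diagUnit hM.isUnit.unit hN.isUnit.unit *
        upperUnit ((hM.isUnit.unit⁻¹).1 * X) := Units.ext (by
      have : M * ((hM.isUnit.unit⁻¹).1 * X) = X := by
        rw [← Matrix.mul_assoc, IsUnit.mul_val_inv, Matrix.one_mul]
      simp [diagUnit, upperUnit, fromBlocks_multiply, this])
    rw [h1, map_mul, dieudonneDet_eq_one_of_mem h2 (upperUnit_mem_elemSubgroup _), mul_one]
  map_submatrix {ι κ _ _ _ _} e {M} hM := by
    have hu : IsUnit (M.submatrix e e) := (isUnit_submatrix_equiv_iff e).2 hM.isUnit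
    rw [dif_pos hM.isUnit, dif_pos hu]
    congr 1
    rw [← dieudonneDet_reindexUnits h2 e.symm]
    congr 1
    exact Units.ext rfl

theorem detD_apply (M : (Matrix ι ι D)ˣ) :
    (detD h2).toFun M.1 = Additive.ofMul (dieudonneDet h2 ι M) := by
  rw [detD]
  simp only [Units.isUnit, dif_pos]
  congr 2
  exact Units.ext rfl

end Dieudonne

end L2

/-! ### Determinants of automorphisms, and `K₁` of a skew field -/

namespace L2

open Matrix

section ModuleDet

variable {D : Type u} [DivisionRing D] (h2 : (2 : D) ≠ 0) {P : Type u} [AddCommGroup P]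
  [Module D P] {ι κ : Type} [Fintype ι] [DecidableEq ι] [Fintype κ] [DecidableEq κ]

theorem exists_vecMulLinear_eq (F : (ι → D) →ₗ[D] (κ → D)) :
    ∃ M : Matrix ι κ D, ∀ v, v ᵥ* M = F v :=
  ⟨LinearMap.toMatrixRight' F, fun v =>
    LinearMap.congr_fun (LinearMap.toMatrixRight'.symm_apply_apply F) v⟩

theorem ext_vecMul {M N : Matrix ι κ D} (h : ∀ v, v ᵥ* M = v ᵥ* N) : M = N :=
  (LinearMap.toMatrixRight' (R := D)).symm.injective (LinearMap.ext h)

theorem inverts_of_coordinates {f : P →ₗ[D] P} (hf : Function.Bijective f) (e : P ≃ₗ[D] (ι → D))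
    {M : Matrix ι ι D} (h : ∀ x, e (f x) = e x ᵥ* M) : Inverts (RingHom.id D) M := by
  change IsUnit M
  rw [← BaseChange.bijective_vecMulLinear_iff]
  have : ⇑M.vecMulLinear = e ∘ f ∘ e.symm := by
    ext1 v
    rw [Function.comp_apply, Function.comp_apply, h, e.apply_symm_apply]; rfl
  rw [this]
  exact e.bijective.comp (hf.comp e.symm.bijective)

/-- The index sets have equal cardinality by invariance of dimension. After renumbering, the two
matrices are conjugate by the change of coordinates, which an abelian-valued invariant does not see.
-/
theorem detD_eq_of_coordinates {f : P →ₗ[D] P} (hf : Function.Bijective f)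
    (e : P ≃ₗ[D] (ι → D)) (e' : P ≃ₗ[D] (κ → D)) {M : Matrix ι ι D} {N : Matrix κ κ D}
    (hM : ∀ x, e (f x) = e x ᵥ* M) (hN : ∀ x, e' (f x) = e' x ᵥ* N) :
    (detD h2).toFun M = (detD h2).toFun N := by
  have uM := inverts_of_coordinates hf e hM
  have uN := inverts_of_coordinates hf e' hN
  let σ : ι ≃ κ := Fintype.equivOfCardEq (card_eq_of_linearEquiv D (e.symm ≪≫ₗ e'))
  let e₁ : P ≃ₗ[D] (ι → D) := e' ≪≫ₗ LinearEquiv.funCongrLeft D D σ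
  have he₁ : ∀ x, e₁ x = e' x ∘ σ := fun x => rfl
  have hN₁ : ∀ x, e₁ (f x) = e₁ x ᵥ* N.submatrix σ σ := by
    intro x
    rw [he₁, hN, he₁]
    ext j
    simp only [Function.comp_apply, Matrix.vecMul, dotProduct, Matrix.submatrix_apply]
    exact (σ.sum_comp fun i => e' x i * N i (σ j)).symm
  obtain ⟨Q, hQ⟩ := exists_vecMulLinear_eq (e.symm ≪≫ₗ e₁).toLinearMap
  have hQ' : ∀ v, v ᵥ* Q = e₁ (e.symm v) := hQ
  have uQ : Inverts (RingHom.id D) Q := by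
    change IsUnit Q
    rw [← BaseChange.bijective_vecMulLinear_iff]
    have : ⇑Q.vecMulLinear = e.symm ≪≫ₗ e₁ := funext hQ
    rw [this]
    exact (e.symm ≪≫ₗ e₁).bijective
  have hMQ : M * Q = Q * N.submatrix σ σ := ext_vecMul fun v => by
    have h1 : v ᵥ* M = e (f (e.symm v)) := by rw [hM, e.apply_symm_apply]
    rw [← Matrix.vecMul_vecMul, ← Matrix.vecMul_vecMul, hQ', h1, e.symm_apply_apply, hN₁, hQ']
  have h := congrArg (detD h2).toFun hMQ
  rw [DetInvariant.map_mul _ uM uQ,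
    DetInvariant.map_mul _ uQ ((inverts_submatrix_iff σ).2 uN),
    DetInvariant.map_submatrix _ _ uN, add_comm, add_left_cancel_iff] at h
  exact h

variable [Module.Finite D P]

/-- The determinant of an automorphism of a finitely generated module over a skew field. -/
noncomputable def detEnd (f : P →ₗ[D] P) : Additive (Abelianization Dˣ) :=
  (detD h2).toFun (LinearMap.toMatrixRight'
    ((Module.finBasis D P).equivFun.toLinearMap ∘ₗ f ∘ₗ (Module.finBasis D P).equivFun.symm))

theorem detEnd_eq {f : P →ₗ[D] P} (hf : Function.Bijective f) (e : P ≃ₗ[D] (ι → D))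
    {M : Matrix ι ι D} (h : ∀ x, e (f x) = e x ᵥ* M) : detEnd h2 f = (detD h2).toFun M := by
  refine detD_eq_of_coordinates h2 hf (Module.finBasis D P).equivFun e (fun x => ?_) h
  have := LinearMap.congr_fun (LinearMap.toMatrixRight'.symm_apply_apply
    ((Module.finBasis D P).equivFun.toLinearMap ∘ₗ f ∘ₗ (Module.finBasis D P).equivFun.symm))
    ((Module.finBasis D P).equivFun x)
  refine Eq.trans ?_ this.symm
  simp

theorem exists_coordinates (f : P →ₗ[D] P) :
    ∃ (n : ℕ) (e : P ≃ₗ[D] (Fin n → D)) (M : Matrix (Fin n) (Fin n) D),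
      ∀ x, e (f x) = e x ᵥ* M := by
  let e := (Module.finBasis D P).equivFun
  obtain ⟨M, hM⟩ := exists_vecMulLinear_eq (e.toLinearMap ∘ₗ f ∘ₗ e.symm.toLinearMap)
  refine ⟨_, e, M, fun x => ?_⟩
  rw [hM]
  simp

theorem detEnd_comp {f g : P →ₗ[D] P} (hf : Function.Bijective f) (hg : Function.Bijective g) :
    detEnd h2 (g ∘ₗ f) = detEnd h2 g + detEnd h2 f := by
  let e := (Module.finBasis D P).equivFun
  obtain ⟨M, hM⟩ := exists_vecMulLinear_eq (e.toLinearMap ∘ₗ f ∘ₗ e.symm.toLinearMap)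
  obtain ⟨N, hN⟩ := exists_vecMulLinear_eq (e.toLinearMap ∘ₗ g ∘ₗ e.symm.toLinearMap)
  have hM' : ∀ x, e (f x) = e x ᵥ* M := fun x => by rw [hM]; simp
  have hN' : ∀ x, e (g x) = e x ᵥ* N := fun x => by rw [hN]; simp
  rw [detEnd_eq h2 hf e hM', detEnd_eq h2 hg e hN', detEnd_eq h2 (f := g ∘ₗ f) (hg.comp hf) e (M := M * N)
    (fun x => by rw [LinearMap.comp_apply, hN', hM', Matrix.vecMul_vecMul]),
    DetInvariant.map_mul _ (inverts_of_coordinates hf e hM') (inverts_of_coordinates hg e hN'),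
    add_comm]

theorem detEnd_exact {P₀ P₂ : Type u} [AddCommGroup P₀] [Module D P₀] [Module.Finite D P₀]
    [AddCommGroup P₂] [Module D P₂] [Module.Finite D P₂] {i : P₀ →ₗ[D] P} {p : P →ₗ[D] P₂}
    {f₀ : P₀ →ₗ[D] P₀} {f₁ : P →ₗ[D] P} {f₂ : P₂ →ₗ[D] P₂} (hi : Function.Injective i)
    (hip : Function.Exact i p) (hp : Function.Surjective p) (h₀₁ : f₁ ∘ₗ i = i ∘ₗ f₀)
    (h₁₂ : f₂ ∘ₗ p = p ∘ₗ f₁) (h₀ : Function.Bijective f₀) (h₁ : Function.Bijective f₁)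
    (h₂ : Function.Bijective f₂) : detEnd h2 f₁ = detEnd h2 f₀ + detEnd h2 f₂ := by
  obtain ⟨s, hs⟩ := Module.projective_lifting_property p LinearMap.id hp
  -- In coordinates adapted to the splitting, the submodule `P₀` is the first block. For row vectors
  -- invariance of `P₀` makes the matrix of `f₁` lower triangular, with a corner `X` recording the
  -- component of `f₁` from `P₂` to `P₀`.
  obtain ⟨E, hE, hE'⟩ := hip.splitSurjectiveEquiv hi ⟨s, hs⟩
  obtain ⟨n, e₀, M, hM⟩ := exists_coordinates f₀
  obtain ⟨m, e₂, N, hN⟩ := exists_coordinates f₂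
  have hEi : ∀ a, E (i a) = (a, 0) := fun a => by rw [hE]; simp
  have hEp : ∀ x, (E x).2 = p x := fun x => by rw [hE']; simp
  let L : P₂ →ₗ[D] P₀ := LinearMap.fst D P₀ P₂ ∘ₗ E.toLinearMap ∘ₗ f₁ ∘ₗ E.symm.toLinearMap ∘ₗ
    LinearMap.inr D P₀ P₂
  obtain ⟨X, hX⟩ := exists_vecMulLinear_eq (e₀.toLinearMap ∘ₗ L ∘ₗ e₂.symm.toLinearMap)
  have hX' : ∀ y, e₂ y ᵥ* X = e₀ (E (f₁ (E.symm (0, y)))).1 := fun y => by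
    rw [hX]; simp [L]
  let e₁ : P ≃ₗ[D] (Fin n ⊕ Fin m → D) := E ≪≫ₗ (e₀.prodCongr e₂) ≪≫ₗ
    (LinearEquiv.sumArrowLequivProdArrow (Fin n) (Fin m) D D).symm
  have he₁ : ∀ x, e₁ x = Sum.elim (e₀ (E x).1) (e₂ (E x).2) := fun x => by
    ext (j | j) <;> simp [e₁]
  rw [detEnd_eq h2 h₀ e₀ hM, detEnd_eq h2 h₂ e₂ hN,
    ← DetInvariant.map_lower _ X (inverts_of_coordinates h₀ e₀ hM) (inverts_of_coordinates h₂ e₂ hN)]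
  refine detEnd_eq h2 h₁ e₁ fun x => ?_
  have hx : x = i (E x).1 + E.symm (0, (E x).2) := E.injective (by
    rw [map_add, hEi, E.apply_symm_apply]; simp)
  have hfst : (E (f₁ x)).1 = f₀ (E x).1 + (E (f₁ (E.symm (0, (E x).2)))).1 := by
    conv_lhs => rw [hx]
    rw [map_add, map_add, Prod.fst_add, ← LinearMap.comp_apply, h₀₁, LinearMap.comp_apply, hEi]
  have hsnd : (E (f₁ x)).2 = f₂ (E x).2 := by
    rw [hEp, hEp, ← LinearMap.comp_apply, ← h₁₂, LinearMap.comp_apply]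
  rw [he₁, he₁, hfst, hsnd, Matrix.vecMul_fromBlocks, map_add, hM, hN, Sum.elim_comp_inl,
    Sum.elim_comp_inr, hX', Matrix.vecMul_zero, zero_add]

end ModuleDet

section K1Det

variable {D : Type u} [DivisionRing D] (h2 : (2 : D) ≠ 0)

/-- The homomorphism `K₁(D) → Dˣ/[Dˣ, Dˣ]` induced by the Dieudonné determinant. -/
noncomputable def detK1 : K1 D →+ Additive (Abelianization Dˣ) :=
  K1Gen.lift (fun x _ => detEnd h2 x.f) (fun _ _ _ _ _ _ _ hf hg _ => detEnd_comp h2 hf hg)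
    (fun _ _ _ _ _ _ _ _ _ _ _ _ _ _ _ _ _ _ _ _ hi hip hp h₀₁ h₁₂ h₀ h₁ h₂ =>
      detEnd_exact h2 hi hip hp h₀₁ h₁₂ h₀ h₁ h₂)

theorem detK1_cls {ι : Type} [Fintype ι] [DecidableEq ι] (M : Matrix ι ι D)
    (h : Function.Bijective M.vecMulLinear) :
    detK1 h2 (K1Gen.cls ⟨ι → D, M.vecMulLinear⟩ h) = (detD h2).toFun M :=
  (FreeAbelianGroup.lift_apply_of _ _).trans
    (detEnd_eq h2 h (LinearEquiv.refl D (ι → D)) fun _ => rfl)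

theorem detK1_ofMatrix {n : ℕ} (M : (Matrix (Fin n) (Fin n) D)ˣ) :
    detK1 h2 (K1.ofMatrix M) = Additive.ofMul (dieudonneDet h2 (Fin n) M) :=
  (detK1_cls h2 M.1 _).trans (detD_apply h2 M)

/-- The classes of invertible matrices in `K₁`, as an invariant. -/
noncomputable def K1.detInvariant (A : Type u) [Ring A] : DetInvariant (RingHom.id A) (K1 A) :=
  K1Gen.detInvariant Function.bijective_id fun _ hM => BaseChange.bijective_vecMulLinear_iff.2 hM

theorem K1.exists_eq_sub {A : Type u} [Ring A] (z : K1 A) :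
    ∃ (ι : Type) (_ : Fintype ι) (_ : DecidableEq ι) (_ : Nonempty ι) (a b : Matrix ι ι A),
      IsUnit a ∧ IsUnit b ∧ z = (detInvariant A).toFun a - (detInvariant A).toFun b :=
  K1Gen.exists_eq_sub (φ := RingHom.id A) (fun _ => Function.bijective_id)
    (fun _ _ _ _ _ _ _ _ _ _ _ _ _ _ hf h hF => bijective_sandwich hf h hF)
    (fun _ hM => BaseChange.bijective_vecMulLinear_iff.1 hM) _
    (fun _ hM => BaseChange.bijective_vecMulLinear_iff.2 hM) z

theorem detK1_detInvariant {ι : Type} [Fintype ι] [DecidableEq ι] (M : (Matrix ι ι D)ˣ) :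
    detK1 h2 ((K1.detInvariant D).toFun M.1) = Additive.ofMul (dieudonneDet h2 ι M) := by
  rw [← detD_apply, ← detK1_cls h2 M.1 (BaseChange.bijective_vecMulLinear_iff.2 M.isUnit)]
  exact congrArg _ (K1Gen.detInvariant_apply
    (h0 := (Function.bijective_id : Function.Bijective (id : PUnit.{u + 1} → PUnit.{u + 1})))
    (hW := fun _ hM => BaseChange.bijective_vecMulLinear_iff.2 hM) (show Inverts (RingHom.id D) M.1 from M.isUnit))

/-- An invariant of matrices as a homomorphism on the general linear group. -/
def DetInvariant.toHom {A B : Type*} [Ring A] [Ring B] {φ : A →+* B} {K : Type*} [AddCommGroup K]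
    (χ : DetInvariant φ K) (ι : Type) [Fintype ι] [DecidableEq ι] :
    (Matrix ι ι A)ˣ →* Multiplicative K :=
  MonoidHom.mk' (fun M => Multiplicative.ofAdd (χ.toFun M.1)) fun M N => by
    rw [Units.val_mul, χ.map_mul (.of_isUnit M.isUnit) (.of_isUnit N.isUnit), ofAdd_add]

/-- An element is a difference of the classes of two matrices of one size. The class map on
`GL_n(D)` has an abelian target and so factors through the determinant, which gives injectivity; `1
× 1` matrices give surjectivity. -/
theorem detK1_bijective : Function.Bijective (detK1 h2) := by
  constructor
  · rw [injective_iff_map_eq_zero]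
    intro z hz
    obtain ⟨ι, _, _, _, _, _, ⟨a, rfl⟩, ⟨b, rfl⟩, rfl⟩ := K1.exists_eq_sub z
    rw [map_sub, detK1_detInvariant, detK1_detInvariant, sub_eq_zero] at hz
    exact sub_eq_zero.2 (eq_of_dieudonneDet_eq h2 ((K1.detInvariant D).toHom ι) hz)
  · intro c
    obtain ⟨x, hx⟩ := QuotientGroup.mk_surjective c.toMul
    refine ⟨K1.ofMatrix (diagonalHom (Fin 1) D fun _ => x), ?_⟩
    rw [detK1_ofMatrix, (isDet_dieudonneDet h2).diagonal, Fin.prod_univ_one]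
    exact hx

/-- The first `K`-group of a skew field is its abelianized unit group. -/
noncomputable def detK1Equiv : K1 D ≃+ Additive (Abelianization Dˣ) :=
  AddEquiv.ofBijective (detK1 h2) (detK1_bijective h2)

theorem detK1Equiv_ofMatrix_iff {n : ℕ} (M : (Matrix (Fin n) (Fin n) D)ˣ)
    (c : Abelianization Dˣ) :
    detK1Equiv h2 (K1.ofMatrix M) = Additive.ofMul c ↔ IsDieudonneDet M c := by
  rw [isDieudonneDet_iff h2]
  exact (detK1_ofMatrix h2 M).congr_left.trans Iff.rfl

end K1Det

end L2

/-! ### Passing from `R[G]` to `F[G]` -/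

namespace L2

section CentralLocalization

open MonoidAlgebra

variable {R F : Type*} [CommRing R] [CommRing F] [Algebra R F] (S : Submonoid R)
  [IsLocalization S F] {G : Type*} [Group G]

/-- A homomorphism on `R[G]` extends to the group ring over a localization of `R`. -/
theorem exists_extension_monoidAlgebra {B : Type*} [Ring B] (ψ : MonoidAlgebra R G →+* B)
    (h : ∀ s ∈ S, IsUnit (ψ (single 1 s))) : ∃ ψ' : MonoidAlgebra F G →+* B,
      ∀ x, ψ' (mapRingHom G (algebraMap R F) x) = ψ x := by
  let f : R →+* B := ψ.comp singleOneRingHom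
  have hf : ∀ r, f r = ψ (single 1 r) := fun r => rfl
  let fS : S →* Bˣ := IsUnit.liftRight (f.toMonoidHom.comp S.subtype) fun s => h s s.2
  have hfS : ∀ s : S, f s = fS s := fun s => rfl
  let θ : F →+* B := (OreLocalization.universalHom f fS hfS).comp
    (Localization.algEquiv S F).symm.toRingEquiv.toRingHom
  have hθ : ∀ r, θ (algebraMap R F r) = f r := by
    intro r
    change OreLocalization.universalHom f fS hfS ((Localization.algEquiv S F).symm _) = _
    rw [AlgEquiv.commutes]
    exact OreLocalization.universalHom_commutes f fS hfS
  let g : G →* B := ψ.toMonoidHom.comp (of R G)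
  have hfg : ∀ r x, Commute (f r) (g x) := fun r x => by
    change ψ _ * ψ _ = ψ _ * ψ _
    rw [← map_mul, ← map_mul]
    simp [single_mul_single]
  -- An element of `F` maps to `f(r) f(s)⁻¹`, and an element that commutes with a unit commutes with
  -- its inverse.
  have hθg : ∀ a x, Commute (θ a) (g x) := by
    intro a x
    obtain ⟨⟨r, s⟩, hrs⟩ := IsLocalization.surj S a
    have h1 : θ a * (fS s : B) = f r := by
      rw [← hfS, ← hθ, ← hθ, ← map_mul, hrs]
    have h2 : θ a = f r * ((fS s)⁻¹ : Bˣ) := by rw [← h1, Units.mul_inv_cancel_right]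
    rw [h2]
    exact (hfg r x).mul_left (Commute.units_inv_left (by rw [← hfS]; exact hfg s x))
  refine ⟨liftNCRingHom θ g hθg, fun x => ?_⟩
  induction x using MonoidAlgebra.induction_linear with
  | zero => simp
  | add x y hx hy => rw [map_add, map_add, hx, hy, map_add]
  | single m r =>
    rw [mapRingHom_single, liftNCRingHom_single, hθ]
    change ψ _ * ψ _ = _
    rw [← map_mul]
    simp [single_mul_single]

/-- Elements of the group ring over a localization have denominators. -/
theorem exists_denominator (x : MonoidAlgebra F G) : ∃ s ∈ S, ∃ y : MonoidAlgebra R G,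
    mapRingHom G (algebraMap R F) y = mapRingHom G (algebraMap R F) (single 1 s) * x := by
  induction x using MonoidAlgebra.induction_linear with
  | zero => exact ⟨1, one_mem _, 0, by simp⟩
  | add x y hx hy =>
    obtain ⟨s, hs, x', hx⟩ := hx
    obtain ⟨t, ht, y', hy⟩ := hy
    refine ⟨s * t, mul_mem hs ht, single 1 t * x' + single 1 s * y', ?_⟩
    have e : (single 1 (s * t) : MonoidAlgebra R G) = single 1 t * single 1 s := by
      rw [single_mul_single, one_mul, mul_comm]
    have e' : (single 1 (s * t) : MonoidAlgebra R G) = single 1 s * single 1 t := by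
      rw [single_mul_single, one_mul]
    rw [map_add, map_mul, map_mul, hx, hy, mul_add, ← mul_assoc, ← mul_assoc, ← map_mul, ← map_mul,
      ← e, ← e']
  | single m a =>
    obtain ⟨⟨r, s⟩, hrs⟩ := IsLocalization.surj S a
    refine ⟨s, s.2, single m r, ?_⟩
    rw [mapRingHom_single, mapRingHom_single, single_mul_single, one_mul, mul_comm, hrs]

/-- Matrices over the group ring over a localization have common denominators. -/
theorem exists_matrix_denominator {ι : Type*} [Fintype ι] [DecidableEq ι]
    (M : Matrix ι ι (MonoidAlgebra F G)) : ∃ s ∈ S, ∃ N : Matrix ι ι (MonoidAlgebra R G),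
      (mapRingHom G (algebraMap R F)).mapMatrix N =
        (mapRingHom G (algebraMap R F)).mapMatrix (Matrix.scalar ι (single 1 s)) * M := by
  choose s hs y hy using fun p : ι × ι => exists_denominator S (M p.1 p.2)
  refine ⟨∏ p, s p, prod_mem fun p _ => hs p, Matrix.of fun i j =>
    single 1 (∏ p ∈ Finset.univ.erase (i, j), s p) * y (i, j), ?_⟩
  ext i j : 1
  rw [Matrix.scalar_apply, RingHom.mapMatrix_apply, RingHom.mapMatrix_apply,
    Matrix.diagonal_map (map_zero _), Matrix.diagonal_mul, Matrix.map_apply, Matrix.of_apply,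
    map_mul, hy, ← mul_assoc, ← map_mul, single_mul_single, one_mul,
    Finset.prod_erase_mul _ _ (Finset.mem_univ (i, j))]

end CentralLocalization

section SkewField

variable {D : Type*} [DivisionRing D] {S : Type*} [Ring S] {ι : Type*} [Fintype ι] [DecidableEq ι]

/-- A skew field is rationally closed in every ring containing it. -/
theorem isUnit_of_isUnit_mapMatrix (f : D →+* S) (hf : Function.Injective f) {M : Matrix ι ι D}
    (h : IsUnit (f.mapMatrix M)) : IsUnit M := by
  rw [← BaseChange.bijective_vecMulLinear_iff]
  -- Only injectivity has to be pulled back from the larger ring: over a skew field an injective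
  -- endomorphism of a finite-dimensional space is bijective.
  have hinj : Function.Injective M.vecMulLinear := by
    rw [injective_iff_map_eq_zero]
    intro v hv
    obtain ⟨u, hu⟩ := h
    have h1 : Matrix.vecMul (f ∘ v) u.1 = 0 := by
      rw [hu]
      ext j
      have := congrArg f (congrFun hv j)
      rw [Matrix.vecMulLinear_apply] at this
      simpa [Matrix.vecMul, dotProduct, map_sum] using this
    have h2 : f ∘ v = 0 := by
      have := congrArg (fun w => Matrix.vecMul w (u⁻¹).1) h1
      simpa [Matrix.vecMul_vecMul] using this
    ext i
    exact hf (by rw [Pi.zero_apply, map_zero]; exact congrFun h2 i)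
  exact ⟨hinj, LinearMap.injective_iff_surjective.1 hinj⟩

end SkewField

section UnivLoc

variable {A : Type*} [Ring A] {B : Type*} [Ring B]

/-- The canonical map `A → A_Σ`. -/
noncomputable def UnivLoc.of (X : Set (SqMatrix A)) (a : A) : UnivLoc X :=
  (RingQuot.mkRingHom (LocRel X) (FreeAlgebra.ι ℤ (Sum.inl a)) : RingQuot (LocRel X))

theorem UnivLoc.lift_of (φ : A →+* B) {X : Set (SqMatrix A)} (h : X ⊆ invertedBy φ) (a : A) :
    UnivLoc.lift φ h (UnivLoc.of X a) = φ a :=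
  (RingQuot.lift_mkRingHom_apply _ _ _).trans (FreeAlgebra.lift_ι_apply _ _)

end UnivLoc

end L2

/-! ### Group rings and the skew field `𝒟(G;F)` -/

namespace L2

open Matrix

theorem RationallyClosed.divisionClosed {S : Type*} [Ring S] {T : Subring S}
    (h : RationallyClosed T) : DivisionClosed T := by
  intro x hx
  let e : Matrix (Fin 1) (Fin 1) T ≃+* T := uniqueRingEquiv
  let e' : Matrix (Fin 1) (Fin 1) S ≃+* S := uniqueRingEquiv
  have h1 : IsUnit (e.symm x) := h 1 _ (by
    have : Matrix.map (e.symm x) T.subtype = e'.symm (x : S) := rfl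
    rw [this]
    exact hx.map e'.symm)
  have h2 := h1.map e
  rwa [RingEquiv.apply_symm_apply] at h2

theorem divisionClosure_le_rationalClosure {S : Type*} [Ring S] (R : Subring S) :
    divisionClosure R ≤ rationalClosure R :=
  le_sInf fun _ hT => sInf_le ⟨hT.1, hT.2.divisionClosed⟩

/-- The division ring structure on a skew field. -/
noncomputable abbrev IsSkewField.divisionRing {D : Type*} [Ring D] (h : IsSkewField D) :
    DivisionRing D :=
  have := h.1
  DivisionRing.ofIsUnitOrEqZero fun a => (eq_or_ne a 0).symm.imp_left (h.2 a)

section GroupRings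

variable (G : Type u) [Group G] (R : Subring ℂ)

/-- The inclusion of `R` into its quotient field. -/
noncomputable def inclQuotField : R →+* (quotField R).toSubring :=
  Subring.inclusion (S := R) (T := (quotField R).toSubring) Subfield.subset_closure

theorem isLocalization_quotField : @IsLocalization' R _ (nonZeroDivisors R)
    (quotField R).toSubring _ (inclQuotField R).toAlgebra := by
  let := (inclQuotField R).toAlgebra
  refine (isLocalization_iff _ _).2 ⟨?_, ?_, ?_⟩
  · rintro ⟨r, hr⟩
    have hr0 : (r : ℂ) ≠ 0 := fun h => nonZeroDivisors.ne_zero hr (Subtype.ext h)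
    have hmem : (r : ℂ) ∈ quotField R := Subfield.subset_closure r.2
    exact IsUnit.of_mul_eq_one ⟨(r : ℂ)⁻¹, (quotField R).inv_mem hmem⟩
      (Subtype.ext (mul_inv_cancel₀ hr0))
  · rintro ⟨z, hz⟩
    -- The subfield generated by `R` consists of quotients `x / y`. The convention `x / 0 = 0` makes
    -- the case `y = 0` separate.
    obtain ⟨x, hx, y, hy, rfl⟩ := Subfield.mem_closure_iff.1 hz
    rw [Subring.closure_eq] at hx hy
    by_cases hy0 : y = 0
    · refine ⟨(0, 1), Subtype.ext ?_⟩
      simp [hy0]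
    · refine ⟨(⟨x, hx⟩, ⟨⟨y, hy⟩, mem_nonZeroDivisors_of_ne_zero fun h =>
        hy0 (congrArg Subtype.val h)⟩), Subtype.ext ?_⟩
      exact div_mul_cancel₀ x hy0
  · intro x y h
    refine ⟨1, ?_⟩
    have hxy : (x : ℂ) = y := congrArg (fun z : (quotField R).toSubring => (z : ℂ)) h
    rw [Subtype.ext hxy]

/-- The inclusion `R[G] → F[G]`. -/
noncomputable def inclGroupRing : MonoidAlgebra R G →+* MonoidAlgebra (quotField R).toSubring G :=
  MonoidAlgebra.mapRingHom G (inclQuotField R)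

theorem groupRingMap_inclGroupRing (x : MonoidAlgebra R G) :
    groupRingMap G (quotField R).toSubring (inclGroupRing G R x) = groupRingMap G R x := by
  refine congrArg (toUAlg G) ?_
  ext g
  simp only [MonoidAlgebra.coeff_mapRingHom, inclGroupRing]
  rfl

theorem omega_val (x : MonoidAlgebra R G) : (omega G R x : UAlg G) = groupRingMap G R x := rfl

theorem isUnit_groupRingMap_single {r : R} (hr : r ≠ 0) :
    IsUnit (groupRingMap G R (MonoidAlgebra.single 1 r)) := by
  have hr0 : (r : ℂ) ≠ 0 := fun h => hr (Subtype.ext h)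
  have h1 : groupRingMap G R (MonoidAlgebra.single 1 r) =
      toUAlg G (MonoidAlgebra.single 1 (r : ℂ)) :=
    congrArg (toUAlg G) (MonoidAlgebra.mapRingHom_single _ _ _)
  rw [h1]
  refine IsUnit.map _ (isUnit_of_two_sided (MonoidAlgebra.single 1 (r : ℂ)⁻¹) ?_ ?_)
  · rw [MonoidAlgebra.single_mul_single, mul_inv_cancel₀ hr0, one_mul]; rfl
  · rw [MonoidAlgebra.single_mul_single, inv_mul_cancel₀ hr0, one_mul]; rfl

variable {G R}

/-- A nonzero constant is already invertible in `ℂ[G]`, hence in `𝒰(G)`. So it cannot vanish in the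
skew field. -/
theorem isUnit_omega_single (hD : IsSkewField (DAlg G (quotField R))) {r : R} (hr : r ≠ 0) :
    IsUnit (omega G R (MonoidAlgebra.single 1 r)) := by
  refine hD.2 _ fun h => ?_
  have h1 := isUnit_groupRingMap_single G R hr
  rw [← omega_val, h] at h1
  have := hD.1
  have : Nontrivial (UAlg G) := Subtype.val_injective.nontrivial (α := DAlg G (quotField R))
  exact not_isUnit_zero h1

end GroupRings

end L2

/-! ### Consequences of property (ULA): universality and representation by triples -/

namespace L2

open Matrix

variable {G : Type u} [Group G] {R : Subring ℂ}

/-- This supplies the hypothesis under which the determinant theory above was developed. -/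
theorem two_ne_zero_DAlg (hD : IsSkewField (DAlg G (quotField R))) :
    (2 : DAlg G (quotField R)) ≠ 0 := by
  have := hD.1
  have h := isUnit_omega_single hD (two_ne_zero : (2 : R) ≠ 0)
  have h1 : (MonoidAlgebra.single 1 (2 : R) : MonoidAlgebra R G) = 2 :=
    map_ofNat (MonoidAlgebra.singleOneRingHom : R →+* MonoidAlgebra R G) 2
  rw [h1, map_ofNat] at h
  exact h.ne_zero

/-- The skew field `𝒟(G;F)` is the universal localization of `R[G]` at the matrices that it
inverts. -/
theorem exists_hom_of_propertyULA (h : PropertyULA G (quotField R)) {B : Type*} [Ring B]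
    (ψ : MonoidAlgebra R G →+* B)
    (hψ : ∀ {n : ℕ} {M : Matrix (Fin n) (Fin n) (MonoidAlgebra R G)},
      Inverts (omega G R) M → Inverts ψ M) :
    ∃ Ψ : DAlg G (quotField R) →+* B, ∀ a, Ψ (omega G R a) = ψ a := by
  let := (inclQuotField R).toAlgebra
  have hloc : IsLocalization (nonZeroDivisors R) (quotField R).toSubring :=
    isLocalization_quotField R
  -- Nonzero constants are `1 × 1` matrices inverted over `D`, so `ψ` inverts them and extends from
  -- `R[G]` to `F[G]`.
  have hunit : ∀ s ∈ nonZeroDivisors R, IsUnit (ψ (MonoidAlgebra.single 1 s)) := by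
    intro s hs
    have h1 := isUnit_omega_single h.2 (nonZeroDivisors.ne_zero hs)
    let e : Matrix (Fin 1) (Fin 1) (DAlg G (quotField R)) ≃+* DAlg G (quotField R) :=
      uniqueRingEquiv
    let e' : Matrix (Fin 1) (Fin 1) B ≃+* B := uniqueRingEquiv
    let e'' : Matrix (Fin 1) (Fin 1) (MonoidAlgebra R G) ≃+* MonoidAlgebra R G := uniqueRingEquiv
    have h2 : Inverts (omega G R) (e''.symm (MonoidAlgebra.single 1 s)) := h1.map e.symm
    exact (hψ h2).map e'
  obtain ⟨ψ', hψ'⟩ := exists_extension_monoidAlgebra (F := (quotField R).toSubring)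
    (nonZeroDivisors R) ψ hunit
  have hX : invertedBy (toRAlg G (quotField R)) ⊆ invertedBy ψ' := by
    rintro ⟨n, M⟩ hM
    have hM : IsUnit ((toRAlg G (quotField R)).mapMatrix M) := hM
    -- The hypothesis on `ψ` concerns matrices over `R[G]` only. Multiplying by a common
    -- denominator, which is invertible over `F[G]`, reduces the matrices over `F[G]` to those.
    obtain ⟨s, hs, N, hN⟩ := exists_matrix_denominator (nonZeroDivisors R) M
    have hsu : IsUnit ((MonoidAlgebra.mapRingHom G (algebraMap R (quotField R).toSubring)).mapMatrix
        (Matrix.scalar (Fin n) (MonoidAlgebra.single 1 s))) := by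
      have h1 := ((IsLocalization.map_units (quotField R).toSubring
        (⟨s, hs⟩ : nonZeroDivisors R)).map (MonoidAlgebra.singleOneRingHom :
          _ →+* MonoidAlgebra (quotField R).toSubring G)).map (Matrix.scalar (Fin n))
      convert h1 using 1
      ext i j : 1
      by_cases hij : i = j <;> simp [Matrix.diagonal_apply, hij]
    have h1 : IsUnit ((toRAlg G (quotField R)).mapMatrix
        ((MonoidAlgebra.mapRingHom G (algebraMap R (quotField R).toSubring)).mapMatrix N)) := by
      rw [hN, map_mul]
      exact (hsu.map _).mul hM
    -- Invertibility is known over `ℛ(G;F)` but needed over `𝒟(G;F)`. The two are compared inside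
    -- `𝒰(G)`, where a skew field is rationally closed.
    have h2 : IsUnit ((DAlg G (quotField R)).subtype.mapMatrix ((omega G R).mapMatrix N)) := by
      convert h1.map (RAlg G (quotField R)).subtype.mapMatrix using 1
      ext i j : 1
      exact (groupRingMap_inclGroupRing G R (N i j)).symm
    have h3 : Inverts ψ N := by
      let := h.2.divisionRing
      exact hψ (isUnit_of_isUnit_mapMatrix (DAlg G (quotField R)).subtype
        Subtype.val_injective h2)
    have h4 : ψ.mapMatrix N = ψ'.mapMatrix
        ((MonoidAlgebra.mapRingHom G (algebraMap R (quotField R).toSubring)).mapMatrix N) := by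
      ext i j : 1
      exact (hψ' _).symm
    rw [Inverts, h4, hN, map_mul] at h3
    obtain ⟨u, hu⟩ := hsu.map ψ'.mapMatrix
    rw [← hu, Units.isUnit_units_mul] at h3
    exact h3
  let e := RingEquiv.ofBijective (locMap (toRAlg G (quotField R))) h.1
  let j : DAlg G (quotField R) →+* RAlg G (quotField R) :=
    Subring.inclusion (divisionClosure_le_rationalClosure _)
  -- The map is the composite `𝒟(G;F) ⊆ ℛ(G;F) ≅ F[G]_Σ → B`.
  refine ⟨(UnivLoc.lift ψ' hX).comp (e.symm.toRingHom.comp j), fun a => ?_⟩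
  have h0 : j (omega G R a) = toRAlg G (quotField R) (inclGroupRing G R a) :=
    Subtype.ext (groupRingMap_inclGroupRing G R a).symm
  have h1 : j (omega G R a) = e (UnivLoc.of _ (inclGroupRing G R a)) :=
    h0.trans (UnivLoc.lift_of (toRAlg G (quotField R)) le_rfl _).symm
  change UnivLoc.lift ψ' hX (e.symm (j (omega G R a))) = _
  rw [h1, e.symm_apply_apply, UnivLoc.lift_of]
  exact hψ' a

/-- Every element of `𝒟(G;F)` is of the form `f s⁻¹ x` with matrices `f`, `s`, `x` over `R[G]`. -/
theorem exists_triple_eval_eq (hD : IsSkewField (DAlg G (quotField R)))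
    (d : DAlg G (quotField R)) : ∃ α : Triple (omega G R) Unit Unit, α.eval () () = d := by
  let e : Matrix Unit Unit (DAlg G (quotField R)) ≃+* DAlg G (quotField R) := uniqueRingEquiv
  have hofM : ∀ a, ∃ α : Triple (omega G R) Unit Unit, e α.eval = omega G R a := fun a =>
    ⟨Triple.ofMatrix (Matrix.scalar Unit a), by rw [Triple.eval_ofMatrix]; simp [e]⟩
  -- The values of triples form a subring closed under inverses. Its image in `𝒰(G)` is division
  -- closed and contains `F[G]`, so minimality of the division closure makes it everything.
  let T : Subring (DAlg G (quotField R)) :=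
    { carrier := {d | ∃ α : Triple (omega G R) Unit Unit, e α.eval = d}
      mul_mem' := by
        rintro _ _ ⟨α, rfl⟩ ⟨β, rfl⟩
        exact ⟨α.mul β, by rw [Triple.eval_mul, map_mul]⟩
      add_mem' := by
        rintro _ _ ⟨α, rfl⟩ ⟨β, rfl⟩
        exact ⟨α.add β, by rw [Triple.eval_add, map_add]⟩
      one_mem' := by
        obtain ⟨α, hα⟩ := hofM 1
        exact ⟨α, by rw [hα, map_one]⟩
      zero_mem' := by
        obtain ⟨α, hα⟩ := hofM 0
        exact ⟨α, by rw [hα, map_zero]⟩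
      neg_mem' := by
        rintro _ ⟨α, rfl⟩
        obtain ⟨β, hβ⟩ := hofM (-1)
        exact ⟨β.mul α, by rw [Triple.eval_mul, map_mul, hβ, map_neg, map_one, neg_one_mul]⟩ }
  have hinv : ∀ u : (DAlg G (quotField R))ˣ, u.1 ∈ T → (u⁻¹).1 ∈ T := by
    rintro u ⟨α, hα⟩
    have hu : IsUnit α.eval := by
      have := u.isUnit.map e.symm
      rwa [← hα, e.symm_apply_apply] at this
    refine ⟨α.inv hu, ?_⟩
    rw [Triple.eval_inv]
    have h1 : e (Ring.inverse α.eval) * u.1 = 1 := by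
      rw [← hα, ← map_mul, Ring.inverse_mul_cancel _ hu, map_one]
    rw [← Units.mul_eq_one_iff_eq_inv.1 h1]
  have hle : DAlg G (quotField R) ≤ T.map (DAlg G (quotField R)).subtype := by
    refine sInf_le ⟨?_, ?_⟩
    · rintro _ ⟨x, rfl⟩
      let := (inclQuotField R).toAlgebra
      have hloc : IsLocalization (nonZeroDivisors R) (quotField R).toSubring :=
        isLocalization_quotField R
      -- The triples have entries in `R[G]`, so an element of `F[G]` is written as `s⁻¹ y`.
      obtain ⟨s, hs, y, hy⟩ := exists_denominator (nonZeroDivisors R) x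
      obtain ⟨u, hu⟩ := isUnit_omega_single hD (nonZeroDivisors.ne_zero hs)
      have hy' : groupRingMap G R y = groupRingMap G R (MonoidAlgebra.single 1 s) *
          groupRingMap G (quotField R).toSubring x := by
        rw [← groupRingMap_inclGroupRing G R y,
          ← groupRingMap_inclGroupRing G R (MonoidAlgebra.single 1 s), ← map_mul]
        exact congrArg _ hy
      refine ⟨(u⁻¹).1 * omega G R y, mul_mem (hinv u (hu ▸ hofM _)) (hofM y), ?_⟩
      change ((u⁻¹).1 : UAlg G) * (omega G R y : UAlg G) = _
      rw [omega_val, hy', ← omega_val G R (MonoidAlgebra.single 1 s), ← hu, ← mul_assoc]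
      have : ((u⁻¹).1 : UAlg G) * ((u.1 : DAlg G (quotField R)) : UAlg G) = 1 :=
        congrArg Subtype.val u.inv_mul
      rw [this, one_mul]
    · rintro ⟨_, ⟨d, hd, rfl⟩⟩ hx
      have : Nontrivial (DAlg G (quotField R)) := hD.1
      have : Nontrivial (UAlg G) :=
        Subtype.val_injective.nontrivial (α := DAlg G (quotField R))
      obtain ⟨u, rfl⟩ := hD.2 d (by
        rintro rfl
        exact not_isUnit_zero (hx : IsUnit ((0 : DAlg G (quotField R)) : UAlg G)))
      exact isUnit_of_two_sided ⟨_, ⟨_, hinv u hd, rfl⟩⟩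
        (Subtype.ext (congrArg (DAlg G (quotField R)).subtype u.mul_inv))
        (Subtype.ext (congrArg (DAlg G (quotField R)).subtype u.inv_mul))
  obtain ⟨d', ⟨α, hα⟩, hd'⟩ := hle d.2
  exact ⟨α, hα.trans (Subtype.ext hd')⟩

end L2

/-! ### Naturality of the class of a matrix -/

namespace L2

open Matrix

section Functoriality

variable {A B : Type u} [Ring A] [Ring B] (φ : A →+* B) {ι : Type} [Fintype ι] [DecidableEq ι]

theorem K1.detInvariant_apply {M : Matrix ι ι A} (hM : IsUnit M) : (detInvariant A).toFun M =
    K1Gen.cls ⟨ι → A, M.vecMulLinear⟩ (BaseChange.bijective_vecMulLinear_iff.2 hM) :=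
  K1Gen.detInvariant_apply
    (h0 := (Function.bijective_id : Function.Bijective (id : PUnit.{u + 1} → PUnit.{u + 1})))
    (hW := fun _ hM => BaseChange.bijective_vecMulLinear_iff.2 hM)
    (show Inverts (RingHom.id A) M from hM)

theorem bijective_baseChange_map_id (P : Type u) [AddCommGroup P] [Module A P] :
    Function.Bijective (BaseChange.map φ (LinearMap.id : P →ₗ[A] P)) := by
  rw [BaseChange.map_id]; exact Function.bijective_id

/-- The classes of matrices inverted by `φ`, as an invariant. -/
noncomputable def K1Inv.detInvariant : DetInvariant φ (K1Inv φ) :=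
  K1Gen.detInvariant (bijective_baseChange_map_id φ PUnit) fun _ hM =>
    (BaseChange.bijective_map_vecMulLinear_iff _).2 hM

theorem K1Inv.detInvariant_apply {M : Matrix ι ι A} (hM : Inverts φ M) :
    (detInvariant φ).toFun M = K1Gen.cls ⟨ι → A, M.vecMulLinear⟩
      ((BaseChange.bijective_map_vecMulLinear_iff _).2 hM) :=
  K1Gen.detInvariant_apply (h0 := bijective_baseChange_map_id φ PUnit)
    (hW := fun _ hM => (BaseChange.bijective_map_vecMulLinear_iff _).2 hM) hM

theorem K1Inv.exists_eq_sub (z : K1Inv φ) :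
    ∃ (ι : Type) (_ : Fintype ι) (_ : DecidableEq ι) (_ : Nonempty ι) (a b : Matrix ι ι A),
      Inverts φ a ∧ Inverts φ b ∧ z = (detInvariant φ).toFun a - (detInvariant φ).toFun b :=
  K1Gen.exists_eq_sub (fun P => bijective_baseChange_map_id φ P)
    (fun P Q _ _ _ _ _ _ _ _ f g p F hf h hF => by
      refine bijective_sandwich hf (g := BaseChange.map φ g) (p := BaseChange.map φ p) ?_ ?_
      · rw [← BaseChange.map_comp, h, BaseChange.map_id]
      · rw [← BaseChange.map_comp, ← BaseChange.map_add', hF, BaseChange.map_add',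
          BaseChange.map_comp, BaseChange.map_comp, BaseChange.map_id])
    (fun _ hM => (BaseChange.bijective_map_vecMulLinear_iff _).1 hM) _
    (fun _ hM => (BaseChange.bijective_map_vecMulLinear_iff _).2 hM) z

/-- The base change of a free module is only isomorphic to a free module. Conjugating by that
isomorphism shows that on matrices the induced map applies `φ` to the entries. -/
theorem cls_baseChange_vecMulLinear {M : Matrix ι ι A}
    (h : Function.Bijective (BaseChange.map φ M.vecMulLinear)) :
    (K1Gen.cls ⟨BaseChange φ (ι → A), BaseChange.map φ M.vecMulLinear⟩ h : K1 B) =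
      (K1.detInvariant B).toFun (φ.mapMatrix M) := by
  rw [K1.detInvariant_apply ((BaseChange.bijective_map_vecMulLinear_iff _).1 h)]
  exact K1Gen.cls_congr (W := fun x : FGProjEnd B => Function.Bijective x.f) Function.bijective_id
    (BaseChange.piEquiv φ ι) (fun x => LinearMap.congr_fun (BaseChange.piEquiv_map φ M) x) _ _

theorem K1Inv.toK1_detInvariant {M : Matrix ι ι A} (hM : Inverts φ M) :
    K1Inv.toK1 φ ((detInvariant φ).toFun M) = (K1.detInvariant B).toFun (φ.mapMatrix M) := by
  rw [detInvariant_apply φ hM]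
  exact cls_baseChange_vecMulLinear φ ((BaseChange.bijective_map_vecMulLinear_iff _).2 hM)

theorem K1.map_detInvariant {M : Matrix ι ι A} (hM : IsUnit M) :
    K1.map.{u, u} φ ((detInvariant A).toFun M) = (detInvariant B).toFun (φ.mapMatrix M) := by
  rw [detInvariant_apply hM]
  exact cls_baseChange_vecMulLinear φ
    ((BaseChange.bijective_map_vecMulLinear_iff _).2 (Inverts.of_isUnit hM))

theorem K1.toInv_detInvariant {M : Matrix ι ι A} (hM : IsUnit M) :
    K1.toInv φ ((detInvariant A).toFun M) = (K1Inv.detInvariant φ).toFun M := by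
  rw [detInvariant_apply hM, K1Inv.detInvariant_apply φ (.of_isUnit hM)]
  rfl

/-- Matrix classes generate, and on them both sides apply `φ ∘ ψ` to the entries. This avoids
comparing an iterated base change of modules with a single one. -/
theorem K1Inv.toK1_toInv_map {C : Type u} [Ring C] (ψ : C →+* A) (z : K1 C) :
    K1Inv.toK1 φ (K1.toInv φ (K1.map.{u, u} ψ z)) = K1.map.{u, u} (φ.comp ψ) z := by
  obtain ⟨ι, _, _, _, a, b, ha, hb, rfl⟩ := K1.exists_eq_sub z
  have key : ∀ {M : Matrix ι ι C}, IsUnit M →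
      K1Inv.toK1 φ (K1.toInv φ (K1.map.{u, u} ψ ((K1.detInvariant C).toFun M))) =
        K1.map.{u, u} (φ.comp ψ) ((K1.detInvariant C).toFun M) := by
    intro M hM
    rw [K1.map_detInvariant _ hM, K1.map_detInvariant _ hM,
      K1.toInv_detInvariant _ (hM.map _), K1Inv.toK1_detInvariant _ (.of_isUnit (hM.map _))]
    rfl
  simp only [map_sub, key ha, key hb]

end Functoriality

/-! ### The comparison theorem for a universal skew field -/

section Main

variable {A : Type u} [Ring A] {D : Type u} [DivisionRing D] {φ : A →+* D}

/-- If `D` is a skew field with the universal property of the localization of `A` at the matrices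
inverted over `D`, then the group of endomorphisms of projective `A`-modules inverted over `D`
is `K₁(D)`. -/
theorem K1Inv.toK1_bijective (h2 : (2 : D) ≠ 0)
    (hrep : ∀ d : D, ∃ α : Triple φ Unit Unit, α.eval () () = d)
    (huniv : ∃ Ψ : D →+* LocRing (K1Inv.detInvariant φ) Unit, ∀ a, Ψ (φ a) = LocRing.of _ a) :
    Function.Bijective (K1Inv.toK1 φ) := by
  obtain ⟨Ψ, hΨ⟩ := huniv
  constructor
  · rw [injective_iff_map_eq_zero]
    intro z hz
    obtain ⟨ι, _, _, _, a, b, ha, hb, rfl⟩ := K1Inv.exists_eq_sub φ z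
    rw [map_sub, toK1_detInvariant φ ha, toK1_detInvariant φ hb, sub_eq_zero] at hz
    obtain ⟨u, hu⟩ := ha
    obtain ⟨v, hv⟩ := hb
    have h1 := congrArg (detK1 h2) hz
    rw [← hu, ← hv, detK1_detInvariant, detK1_detInvariant] at h1
    -- The tautological invariant with values in the group `K1Inv φ` itself is extended to
    -- `GL_n(D)`. Its value on `φ(a)` is `[a]`, so equality of determinants over `D` gives `[a] =
    -- [b]`.
    obtain ⟨V, hV⟩ := (K1Inv.detInvariant φ).exists_extension hrep hΨ ι
    have h3 := eq_of_dieudonneDet_eq h2 V h1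
    rw [hV a u hu.symm, hV b v hv.symm] at h3
    exact sub_eq_zero.2 h3
  · have key : ∀ {ι : Type} [Fintype ι] [DecidableEq ι] (X : Matrix ι ι D), IsUnit X →
        ∃ z, K1Inv.toK1 φ z = (K1.detInvariant D).toFun X := by
      intro ι _ _ X hX
      obtain ⟨α, rfl⟩ := exists_eval_eq hrep X
      have hZ : Inverts φ (α.ctx (0 : Matrix ι ι A) 1 1) := α.inverts_ctx_iff.2 hX
      -- The Schur complement factorization of `[[s, x], [-f, 0]]` over `D` expresses its class as
      -- the class of `s` plus the class of `X = f s⁻¹ x`.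
      refine ⟨(K1Inv.detInvariant φ).toFun (α.ctx (0 : Matrix ι ι A) 1 1) - (K1Inv.detInvariant φ).toFun α.s, ?_⟩
      rw [map_sub, toK1_detInvariant φ hZ, toK1_detInvariant φ α.inverts, sub_eq_iff_eq_add']
      have hs : Inverts (RingHom.id D) (φ.mapMatrix α.s) := α.inverts
      have hX : Inverts (RingHom.id D) α.eval := hX
      rw [α.mapMatrix_ctx, DetInvariant.map_mul _ ((hs.lower_iff _).2 hX) ((Inverts.one.upper_iff _).2 .one),
        DetInvariant.map_lower _ _ hs hX, DetInvariant.map_one_upper, add_zero]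
    intro z
    obtain ⟨ι, _, _, _, a, b, ha, hb, rfl⟩ := K1.exists_eq_sub z
    obtain ⟨z, hz⟩ := key a ha
    obtain ⟨w, hw⟩ := key b hb
    exact ⟨z - w, by rw [map_sub, hz, hw]⟩

end Main

end L2

/-! ### Application to `ω` and passage to cokernels -/

namespace L2

/-- An isomorphism induces an isomorphism of the cokernels of compatible homomorphisms. -/
theorem exists_quotient_addEquiv {X Y Z : Type*} [AddCommGroup X] [AddCommGroup Y] [AddGroup Z]
    {w : X →+ Y} (hw : Function.Bijective w) {f : Z →+ X} {g : Z →+ Y} (h : w.comp f = g) :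
    ∃ e : X ⧸ f.range ≃+ Y ⧸ g.range, ∀ x : X,
      e (QuotientAddGroup.mk x) = QuotientAddGroup.mk (w x) :=
  ⟨QuotientAddGroup.congr _ _ (AddEquiv.ofBijective w hw) (by
    rw [← h, AddMonoidHom.range_comp]; rfl), fun _ => rfl⟩

variable {G : Type u} [Group G] {R : Subring ℂ}

theorem omegaK1_bijective (h : PropertyULA G (quotField R)) :
    Function.Bijective (omegaK1 G R) := by
  let := h.2.divisionRing
  -- Universality is applied to the ring of triples as target; by construction it inverts every
  -- matrix that `ω` inverts.
  exact K1Inv.toK1_bijective (φ := omega G R) (two_ne_zero_DAlg h.2) (exists_triple_eval_eq h.2)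
    (exists_hom_of_propertyULA h _ fun hM => LocRing.inverts_of hM)

theorem omegaK1_comp_intToK1w : (omegaK1 G R).comp (intToK1w G R) = intToK1D G R :=
  AddMonoidHom.ext fun z => K1Inv.toK1_toInv_map (omega G R) (fromInt G R) z

theorem exists_quotient_omegaK1 (h : PropertyULA G (quotField R)) {Z : Type*} [AddGroup Z]
    (f : Z →+ K1 (MonoidAlgebra ℤ G)) :
    ∃ e : K1w G R ⧸ ((intToK1w G R).comp f).range ≃+
        K1 (DAlg G (quotField R)) ⧸ ((intToK1D G R).comp f).range,
      ∀ x : K1w G R, e (QuotientAddGroup.mk x) = QuotientAddGroup.mk (omegaK1 G R x) :=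
  exists_quotient_addEquiv (omegaK1_bijective h)
    (by rw [← AddMonoidHom.comp_assoc, omegaK1_comp_intToK1w])

theorem exists_detK1_DAlg (h : IsSkewField (DAlg G (quotField R))) :
    ∃ det : K1 (DAlg G (quotField R)) ≃+ Additive (Abelianization (DAlg G (quotField R))ˣ),
      ∀ (n : ℕ) (M : (Matrix (Fin n) (Fin n) (DAlg G (quotField R)))ˣ)
        (c : Abelianization (DAlg G (quotField R))ˣ),
        det (K1.ofMatrix M) = Additive.ofMul c ↔ IsDieudonneDet M c := by
  let := h.divisionRing
  exact ⟨detK1Equiv (two_ne_zero_DAlg h), fun n M c =>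
    detK1Equiv_ofMatrix_iff (two_ne_zero_DAlg h) M c⟩

end L2

theorem theorem2 {G : Type u} [Group G] (hG : ∀ g : G, g ≠ 1 → ¬ IsOfFinOrder g)
    (R : Subring ℂ) (hULA : L2.PropertyULA G (L2.quotField R)) :
    Function.Bijective (L2.omegaK1 G R) ∧
    (∃ e : L2.RedK1w G R ≃+ L2.RedK1D G R, ∀ x : L2.K1w G R,
      e (QuotientAddGroup.mk x) = QuotientAddGroup.mk (L2.omegaK1 G R x)) ∧
    (∃ e : L2.Whw G R ≃+ L2.WhD G R, ∀ x : L2.K1w G R,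
      e (QuotientAddGroup.mk x) = QuotientAddGroup.mk (L2.omegaK1 G R x)) ∧
    L2.IsSkewField (L2.DAlg G (L2.quotField R)) ∧
    (∃ det : L2.K1 (L2.DAlg G (L2.quotField R)) ≃+
        Additive (Abelianization (L2.DAlg G (L2.quotField R))ˣ),
      ∀ (n : ℕ) (M : (Matrix (Fin n) (Fin n) (L2.DAlg G (L2.quotField R)))ˣ)
        (c : Abelianization (L2.DAlg G (L2.quotField R))ˣ),
        det (L2.K1.ofMatrix M) = Additive.ofMul c ↔ L2.IsDieudonneDet M c) := by
  refine ⟨L2.omegaK1_bijective hULA, L2.exists_quotient_omegaK1 hULA (L2.signK1 G),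
    L2.exists_quotient_omegaK1 hULA (L2.trivialK1 G), hULA.2, ?_⟩
  exact L2.exists_detK1_DAlg hULA.2
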